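/- Let $M$ be a smooth surface homeomorphic to the 2-sphere $\mathbf S^2$, let $h$ be a smooth Riemannian metric on $M$, and let $X$ be a smooth Killing vector field of $h$ (that is, $\mathcal L_X h=0$) that is not identically zero. Then $(M,h)$ is a Riemannian warped product $([0,\ell],dr^2)\times_{\phi(r)}(\mathbf S^1,d\sigma^2)$ of an interval and a circle, with the two boundary circles collapsed to points, and the circles are the orbits of $X$. In detail, let $\mathbf S^1\subset\mathbb C$ be the unit circle with its standard metric $d\sigma^2$. There are $t_0>0$, $\ell>0$, two distinct points $p,q\in M$, a function $\phi$ that is smooth on $[0,\ell]$ and positive on $(0,\ell)$ with $\phi(0)=\phi(\ell)=0$, $\phi'(0)=1$, $\phi'(\ell)=-1$, and a map $\Phi:[0,\ell]\times\mathbf S^1\to M$, smooth up to the boundary, such that 1. $\Phi(0,z)=p$ and $\Phi(\ell,z)=q$ for all $z\in\mathbf S^1$, the map $\Phi$ restricts to a diffeomorphism from $(0,\ell)\times\mathbf S^1$ onto $M\setminus\{p,q\}$, and $\Phi^*h=dr^2+\phi(r)^2\,d\sigma^2$ on $(0,\ell)\times\mathbf S^1$; 2. for all $r\in[0,\ell]$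 and $z\in\mathbf S^1$, the curve $t\mapsto\Phi(r,z\,e^{2\pi i t/t_0})$ is an integral curve of $X$. In particular, every orbit of $X$ is closed and all orbits share the common period $t_0$: through every point of $M$ there is an integral curve $\gamma:\mathbb R\to M$ of $X$, every integral curve $\gamma:\mathbb R\to M$ of $X$ satisfies $\gamma(t+t_0)=\gamma(t)$ for all $t$, and $t_0$ is the least positive period of $\gamma$ unless $\gamma$ is constant at a zero of $X$. -/

import Mathlib

open Set
open scoped Manifold ContDiff

/-- Smooth Riemannian metrics on a smooth surface `M`. -/
abbrev SurfaceMetric (M : Type*) [TopologicalSpace M] [ChartedSpace (EuclideanSpace ℝ (Fin 2)) M]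
    [IsManifold (𝓡 2) ∞ M] : Type _ :=
  Bundle.ContMDiffRiemannianMetric (𝓡 2) ∞ (EuclideanSpace ℝ (Fin 2))
    (fun x : M => TangentSpace (𝓡 2) x)

/-- `X` is a Killing vector field of the metric `h`: it is smooth and `𝓛_X h = 0`, that is,
`X (h (Y, Z)) = h ([X, Y], Z) + h (Y, [X, Z])` at every point `x`, for all vector fields `Y`, `Z`
that are smooth near `x`. -/
structure IsKillingField {M : Type*} [TopologicalSpace M]
    [ChartedSpace (EuclideanSpace ℝ (Fin 2)) M] [IsManifold (𝓡 2) ∞ M]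
    (h : SurfaceMetric M) (X : (x : M) → TangentSpace (𝓡 2) x) : Prop where
  smooth : ContMDiff (𝓡 2) (𝓡 2).tangent ∞ (fun x => (⟨x, X x⟩ : TangentBundle (𝓡 2) M))
  lieDerivative_eq_zero : ∀ (x : M) (Y Z : (y : M) → TangentSpace (𝓡 2) y),
    ContMDiffAt (𝓡 2) (𝓡 2).tangent ∞ (fun y => (⟨y, Y y⟩ : TangentBundle (𝓡 2) M)) x →
    ContMDiffAt (𝓡 2) (𝓡 2).tangent ∞ (fun y => (⟨y, Z y⟩ : TangentBundle (𝓡 2) M)) x →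
    (mfderiv (𝓡 2) 𝓘(ℝ, ℝ) (fun y => h.inner y (Y y) (Z y)) x (X x) : ℝ) =
      h.inner x (VectorField.mlieBracket (𝓡 2) X Y x) (Z x) +
        h.inner x (Y x) (VectorField.mlieBracket (𝓡 2) X Z x)

/-- The standard metric `dσ²` of the unit circle, induced from `ℂ` (so that the circle has
length `2π`). -/
noncomputable def circleMetric (z : Circle) (v w : TangentSpace (𝓡 1) z) : ℝ :=
  inner (𝕜 := ℝ) (E := ℂ) (mfderiv (𝓡 1) 𝓘(ℝ, ℂ) (fun y : Circle => (y : ℂ)) z v)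
    (mfderiv (𝓡 1) 𝓘(ℝ, ℂ) (fun y : Circle => (y : ℂ)) z w)

/-- The bilinear form `dr² + φ(r)² dσ²` on the tangent space of `ℝ × S¹` at `x = (r, z)`. -/
noncomputable def warpedForm (φ : ℝ → ℝ) (x : ℝ × Circle)
    (u v : TangentSpace (𝓘(ℝ, ℝ).prod (𝓡 1)) x) : ℝ :=
  (u : ℝ × EuclideanSpace ℝ (Fin 1)).1 * (v : ℝ × EuclideanSpace ℝ (Fin 1)).1 +
    φ x.1 ^ 2 * circleMetric x.2 (u : ℝ × EuclideanSpace ℝ (Fin 1)).2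
      (v : ℝ × EuclideanSpace ℝ (Fin 1)).2

/-- The map `Φ` exhibits the Riemannian surface `(M, h)` as the warped product
`([0, ℓ], dr²) ×_φ (S¹, dσ²)`, whose two boundary circles are collapsed to the poles `p` and `q`. -/
structure IsWarpedProduct {M : Type*} [TopologicalSpace M]
    [ChartedSpace (EuclideanSpace ℝ (Fin 2)) M] [IsManifold (𝓡 2) ∞ M]
    (h : SurfaceMetric M) (ℓ : ℝ) (φ : ℝ → ℝ) (Φ : ℝ × Circle → M) (p q : M) : Prop where
  length_pos : 0 < ℓ
  -- the warping function: smooth, positive inside, closing up smoothly at both ends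
  warp_smooth : ContDiffOn ℝ ∞ φ (Icc 0 ℓ)
  warp_pos : ∀ r ∈ Ioo 0 ℓ, 0 < φ r
  warp_left : φ 0 = 0
  warp_right : φ ℓ = 0
  warp_deriv_left : HasDerivWithinAt φ 1 (Icc 0 ℓ) 0
  warp_deriv_right : HasDerivWithinAt φ (-1) (Icc 0 ℓ) ℓ
  -- the parametrization: smooth on the closed cylinder, with its boundary circles collapsed
  smooth : ContMDiffOn (𝓘(ℝ, ℝ).prod (𝓡 1)) (𝓡 2) ∞ Φ (Icc 0 ℓ ×ˢ univ)
  map_left : ∀ z, Φ (0, z) = p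
  map_right : ∀ z, Φ (ℓ, z) = q
  poles_ne : p ≠ q
  -- a diffeomorphism from the open cylinder onto the complement of the poles
  bijOn : BijOn Φ (Ioo 0 ℓ ×ˢ univ) {p, q}ᶜ
  smooth_inverse : ∃ Ψ : M → ℝ × Circle,
    ContMDiffOn (𝓡 2) (𝓘(ℝ, ℝ).prod (𝓡 1)) ∞ Ψ {p, q}ᶜ ∧ LeftInvOn Ψ Φ (Ioo 0 ℓ ×ˢ univ)
  -- the pull-back of `h` is `dr² + φ(r)² dσ²`
  isometry : ∀ x ∈ Ioo 0 ℓ ×ˢ (univ : Set Circle),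
    ∀ u v : TangentSpace (𝓘(ℝ, ℝ).prod (𝓡 1)) x,
      h.inner (Φ x) (mfderiv (𝓘(ℝ, ℝ).prod (𝓡 1)) (𝓡 2) Φ x u)
        (mfderiv (𝓘(ℝ, ℝ).prod (𝓡 1)) (𝓡 2) Φ x v) = warpedForm φ x u v

/-! The proof plays the flow of `X` against a Hamiltonian. Since a Killing field preserves area, the
contraction of the area form with `X` is closed, and on a sphere it is the differential of a
function `H`. No orientation is chosen: `H` is characterised by `dH(v)² = |X|²|v|² - ⟨X, v⟩²`, which
on a connected open set fixes it up to sign and a constant (`IsHamiltonianAt.eqOn`). Local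
Hamiltonians are therefore patched along covers with connected overlaps (`IsGluable.sphere`). `H` is
invariant under the flow.

The future meridians are the normal curves: unit speed curves orthogonal to `X`. Off the zeros of
`X` they are geodesics, because the velocity and `X` form a frame and Killing's equation gives both
components of the acceleration. A Killing field is determined by its 1-jet at a point, so the zeros
are isolated and the geodesic equation extends across them by continuity. Conversely, Clairaut's
relation keeps a geodesic orthogonal to `X` once it is so initially. Hence normal curves exist for
all time by compactness, are determined by position and velocity, are carried to normal curves by
the flow, and are unique up to direction through a regular point (`normal_match`).

Along a normal curve `c` one has `((H ∘ c)')² = |X|²`, so the critical points of `H ∘ c` are exactly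
the zeros of `X`. Start `c` at a minimum of `H`, which is a zero of `X`. Then `H` increases along
`c` up to the next zero, at parameter `ℓ`. Such a zero exists: otherwise the ray would accumulate at
some point, and comparing it with a normal curve through that point gives a contradiction
(`exists_zero`).

At a zero the linearised flow is a rotation of some angular speed `l`, and the flow at time `t`
fixes `c` as soon as its differential fixes the initial velocity; so it fixes `c` exactly at the
multiples of `T = 2π/l` (`exists_rotation`). Both ends of the meridian yield the same `T`. The set
swept out by the meridian under the flow is open and closed, hence everything. Since `H` separates
the orbits and `T` controls the time, `(r, e^{iθ}) ↦ Fl (Tθ/2π) (c r)` gives polar coordinates with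
warping function `φ = (T/2π) (H ∘ c)'`. The identity `φ² = (T/2π)²|X|²` and the quadratic vanishing
of `|X|²` at both ends give the slopes `1` and `-1`.

Smooth dependence of flows and geodesics on initial data comes from the inverse function theorem in
the Banach space of continuous paths. -/

open scoped Topology
set_option linter.unusedSectionVars false
set_option maxSynthPendingDepth 3

/-! ### Superposition operators on spaces of continuous functions -/

section Nemytskii

variable {K : Type} [TopologicalSpace K] [CompactSpace K]
  {E F : Type} [NormedAddCommGroup E] [NormedSpace ℝ E] [NormedAddCommGroup F] [NormedSpace ℝ F]

/-- Pointwise application of a continuous family of operators to a continuous function. -/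
noncomputable def pointwiseApply : C(K, E →L[ℝ] F) →L[ℝ] C(K, E) →L[ℝ] C(K, F) :=
  LinearMap.mkContinuous₂
    (LinearMap.mk₂ ℝ (fun (A : C(K, E →L[ℝ] F)) (v : C(K, E)) =>
        (⟨fun k => A k (v k), A.continuous.clm_apply v.continuous⟩ : C(K, F)))
      (by intros; ext; simp) (by intros; ext; simp) (by intros; ext; simp) (by intros; ext; simp))
    1 (by
      intro A v
      rw [one_mul, ContinuousMap.norm_le _ (by positivity)]
      intro k
      exact (ContinuousLinearMap.le_opNorm _ _).trans
        (mul_le_mul (A.norm_coe_le_norm k) (v.norm_coe_le_norm k) (norm_nonneg _)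
          ((norm_nonneg _).trans (A.norm_coe_le_norm k))))

@[simp] lemma pointwiseApply_apply (A : C(K, E →L[ℝ] F)) (v : C(K, E)) (k : K) :
    pointwiseApply A v k = A k (v k) := rfl

/-- The superposition (Nemytskii) operator `u ↦ f ∘ u`. -/
def superposition (f : C(E, F)) (u : C(K, E)) : C(K, F) := f.comp u

lemma continuous_superposition (f : C(E, F)) :
    Continuous (superposition f : C(K, E) → C(K, F)) :=
  ContinuousMap.continuous_postcomp f

/-- The mean value inequality on each segment from `u k` to `u k + v k` reduces the claim to a bound
on `f' y - f' (u k)`. That bound is uniform in `k` because `u ↦ f' ∘ u` is continuous for the sup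
norm. -/
lemma hasFDerivAt_superposition {f : C(E, F)} {f' : C(E, E →L[ℝ] F)}
    (h : ∀ x, HasFDerivAt f (f' x) x) (u : C(K, E)) :
    HasFDerivAt (superposition f : C(K, E) → C(K, F))
      (pointwiseApply (superposition f' u)) u := by
  rw [hasFDerivAt_iff_isLittleO_nhds_zero, Asymptotics.isLittleO_iff]
  intro ε hε
  have hc := (continuous_superposition (K := K) f').continuousAt (x := u)
  obtain ⟨δ, hδ, H⟩ := Metric.continuousAt_iff.1 hc ε hε
  filter_upwards [Metric.ball_mem_nhds (0 : C(K, E)) hδ] with v hv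
  rw [mem_ball_zero_iff] at hv
  rw [ContinuousMap.norm_le _ (by positivity)]
  intro k
  have hseg : ∀ y ∈ segment ℝ (u k) (u k + v k), ‖f' y - f' (u k)‖ ≤ ε := by
    intro y hy
    rw [segment_eq_image'] at hy
    obtain ⟨t, ht, rfl⟩ := hy
    have h1 : dist (u + t • v) u < δ := by
      rw [dist_eq_norm, add_sub_cancel_left, norm_smul, Real.norm_eq_abs, abs_of_nonneg ht.1]
      exact lt_of_le_of_lt (mul_le_of_le_one_left (norm_nonneg _) ht.2) hv
    have h2 := H h1
    rw [dist_eq_norm] at h2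
    have h3 := (ContinuousMap.norm_coe_le_norm
      (superposition f' (u + t • v) - superposition f' u) k).trans h2.le
    simpa [superposition] using h3
  have := (convex_segment (u k) (u k + v k)).norm_image_sub_le_of_norm_hasFDerivWithin_le'
    (f := f) (f' := f') (φ := f' (u k)) (C := ε)
    (fun y _ => (h y).hasFDerivWithinAt) hseg (left_mem_segment ℝ _ _) (right_mem_segment ℝ _ _)
  simp only [add_sub_cancel_left] at this
  refine (le_of_eq ?_).trans (this.trans ?_)
  · simp [superposition]
  · gcongr
    exact v.norm_coe_le_norm k

/-- Induction works because the derivative of a superposition operator is again built from one,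
namely that of `fderiv ℝ f`. The target space changes at each step, hence the quantification over
`F`. -/
lemma contDiff_superposition_nat (n : ℕ) : ∀ {F : Type} [NormedAddCommGroup F] [NormedSpace ℝ F]
    (f : C(E, F)), ContDiff ℝ ∞ f →
      ContDiff ℝ n (superposition f : C(K, E) → C(K, F)) := by
  induction n with
  | zero => intro F _ _ f _; exact contDiff_zero.2 (continuous_superposition f)
  | succ n ih =>
    intro F _ _ f hf
    have hd : Differentiable ℝ f := hf.differentiable (by simp)
    have hf' : ContDiff ℝ ∞ (fderiv ℝ f) := hf.fderiv_right (m := ∞) (by simp)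
    let f' : C(E, E →L[ℝ] F) := ⟨fderiv ℝ f, hf'.continuous⟩
    have hN : ∀ u, HasFDerivAt (superposition f : C(K, E) → C(K, F))
        (pointwiseApply (superposition f' u)) u :=
      hasFDerivAt_superposition (f' := f') fun x => (hd x).hasFDerivAt
    push_cast
    rw [contDiff_succ_iff_fderiv]
    refine ⟨fun u => (hN u).differentiableAt, by simp, ?_⟩
    rw [show fderiv ℝ (superposition f : C(K, E) → C(K, F)) =
      fun u => pointwiseApply (superposition f' u) from funext fun u => (hN u).fderiv]
    exact pointwiseApply.contDiff.comp (ih f' hf')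

lemma contDiff_superposition (f : C(E, F)) (hf : ContDiff ℝ ∞ f) :
    ContDiff ℝ ∞ (superposition f : C(K, E) → C(K, F)) :=
  contDiff_infty.2 fun n => contDiff_superposition_nat n f hf

end Nemytskii

/-! ### Inverse function theorem with a smooth local inverse -/

section InverseFunction

variable {E F : Type*} [NormedAddCommGroup E] [NormedSpace ℝ E] [CompleteSpace E]
  [NormedAddCommGroup F] [NormedSpace ℝ F]

/-- The inverse function theorem for a smooth map on an open set: the local inverse is smooth on
an open set. -/
theorem exists_openPartialHomeomorph_contDiffOn {f : E → F} {U : Set E} (hU : IsOpen U)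
    (hf : ContDiffOn ℝ ∞ f U) {a : E} (ha : a ∈ U) {f' : E ≃L[ℝ] F}
    (hf' : HasFDerivAt f (f' : E →L[ℝ] F) a) :
    ∃ e : OpenPartialHomeomorph E F, a ∈ e.source ∧ e.source ⊆ U ∧ (e : E → F) = f ∧
      ContDiffOn ℝ ∞ e.symm e.target := by
  have hfa : ContDiffAt ℝ ∞ f a := hf.contDiffAt (hU.mem_nhds ha)
  let e₀ := hfa.toOpenPartialHomeomorph f hf' (by simp)
  have he₀ : (e₀ : E → F) = f := rfl
  have ha₀ : a ∈ e₀.source := hfa.mem_toOpenPartialHomeomorph_source hf' (by simp)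
  have hcont : ContinuousOn (fderiv ℝ f) U := hf.continuousOn_fderiv_of_isOpen hU (by simp)
  -- Restricting to the open set where the derivative is invertible makes the inverse smooth on the
  -- whole target, not only at the image of `a`.
  have hopen : IsOpen (U ∩ fderiv ℝ f ⁻¹' range ((↑) : (E ≃L[ℝ] F) → E →L[ℝ] F)) :=
    hcont.isOpen_inter_preimage hU ContinuousLinearEquiv.isOpen
  refine ⟨e₀.restrOpen _ hopen, ?_, ?_, he₀, ?_⟩
  · exact ⟨ha₀, ha, f', hf'.fderiv.symm⟩
  · exact fun x hx => hx.2.1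
  · intro y hy
    obtain ⟨hx, hxU, g', hg'⟩ := (e₀.restrOpen _ hopen).map_target hy
    have hsm : ContDiffAt ℝ ∞ f ((e₀.restrOpen _ hopen).symm y) := hf.contDiffAt (hU.mem_nhds hxU)
    refine ((e₀.restrOpen _ hopen).contDiffAt_symm hy (f₀' := g') ?_ hsm).contDiffWithinAt
    rw [hg']
    exact (hsm.differentiableAt (by simp)).hasFDerivAt

end InverseFunction

/-! ### Smooth local flows of vector fields -/

section LocalFlow

variable {E : Type} [NormedAddCommGroup E] [NormedSpace ℝ E]

/-- Extension of a continuous function from the unit interval to the line. -/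
noncomputable def extendUnit (w : C(Icc (0:ℝ) 1, E)) (r : ℝ) : E :=
  w (projIcc 0 1 zero_le_one r)

lemma continuous_extendUnit (w : C(Icc (0:ℝ) 1, E)) : Continuous (extendUnit w) :=
  w.continuous.comp continuous_projIcc

lemma extendUnit_of_mem (w : C(Icc (0:ℝ) 1, E)) {r : ℝ} (hr : r ∈ Icc (0:ℝ) 1) :
    extendUnit w r = w ⟨r, hr⟩ := by
  rw [extendUnit, projIcc_of_mem _ hr]

/-- The Volterra operator `w ↦ (s ↦ ∫₀ˢ w)`. -/
noncomputable def volterra : C(Icc (0:ℝ) 1, E) →L[ℝ] C(Icc (0:ℝ) 1, E) :=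
  LinearMap.mkContinuous
    { toFun := fun w => ⟨fun s => ∫ r in (0:ℝ)..s, extendUnit w r,
        (intervalIntegral.continuous_primitive
          (fun a b => (continuous_extendUnit w).intervalIntegrable a b) 0).comp
          continuous_subtype_val⟩
      map_add' := by
        intro v w
        ext s
        simp only [ContinuousMap.coe_mk, ContinuousMap.add_apply]
        rw [← intervalIntegral.integral_add
          ((continuous_extendUnit v).intervalIntegrable _ _)
          ((continuous_extendUnit w).intervalIntegrable _ _)]
        rfl
      map_smul' := by
        intro c w
        ext s
        simp only [ContinuousMap.coe_mk, ContinuousMap.smul_apply, RingHom.id_apply]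
        rw [← intervalIntegral.integral_smul]
        rfl }
    1 (by
      intro w
      rw [one_mul, ContinuousMap.norm_le _ (norm_nonneg _)]
      intro s
      have h := intervalIntegral.norm_integral_le_of_norm_le_const (a := 0) (b := (s : ℝ))
        (f := extendUnit w) (C := ‖w‖) (fun r _ => w.norm_coe_le_norm _)
      refine h.trans ?_
      rw [sub_zero, abs_of_nonneg s.2.1]
      exact mul_le_of_le_one_right (norm_nonneg _) s.2.2)

lemma volterra_apply (w : C(Icc (0:ℝ) 1, E)) (s : Icc (0:ℝ) 1) :
    volterra w s = ∫ r in (0:ℝ)..s, extendUnit w r := rfl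

/-- The defect of the integral equation `u(s) = x + t ∫₀ˢ f(u)` as a function of `(x, t, u)`. -/
noncomputable def flowDefect (f : C(E, E)) (z : (E × ℝ) × C(Icc (0:ℝ) 1, E)) :
    (E × ℝ) × C(Icc (0:ℝ) 1, E) :=
  (z.1, z.2 - ContinuousLinearMap.const ℝ (Icc (0:ℝ) 1) z.1.1 -
    z.1.2 • volterra (superposition f z.2))

lemma contDiff_flowDefect (f : C(E, E)) (hf : ContDiff ℝ ∞ f) :
    ContDiff ℝ ∞ (flowDefect f) := by
  unfold flowDefect
  have h1 := contDiff_superposition (K := Icc (0:ℝ) 1) f hf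
  have h2 : ContDiff ℝ ∞ fun z : (E × ℝ) × C(Icc (0:ℝ) 1, E) => volterra (superposition f z.2) :=
    volterra.contDiff.comp (h1.comp contDiff_snd)
  have h3 : ContDiff ℝ ∞ fun z : (E × ℝ) × C(Icc (0:ℝ) 1, E) =>
      ContinuousLinearMap.const ℝ (Icc (0:ℝ) 1) z.1.1 :=
    (ContinuousLinearMap.const ℝ (Icc (0:ℝ) 1) (M := E)).contDiff.comp
      (contDiff_fst.comp contDiff_fst)
  exact contDiff_fst.prodMk ((contDiff_snd.sub h3).sub ((contDiff_snd.comp contDiff_fst).smul h2))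

/-- The derivative of the defect at a constant solution with time parameter `0`. -/
noncomputable def flowDefectDeriv (w : C(Icc (0:ℝ) 1, E)) :
    ((E × ℝ) × C(Icc (0:ℝ) 1, E)) ≃L[ℝ] ((E × ℝ) × C(Icc (0:ℝ) 1, E)) :=
  ContinuousLinearEquiv.equivOfInverse
    ((ContinuousLinearMap.fst ℝ _ _).prod (ContinuousLinearMap.snd ℝ _ _ -
      ((ContinuousLinearMap.const ℝ (Icc (0:ℝ) 1)).comp
        ((ContinuousLinearMap.fst ℝ _ _).comp (ContinuousLinearMap.fst ℝ _ _))) -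
      ((ContinuousLinearMap.snd ℝ _ _).comp (ContinuousLinearMap.fst ℝ _ _)).smulRight w))
    ((ContinuousLinearMap.fst ℝ _ _).prod (ContinuousLinearMap.snd ℝ _ _ +
      ((ContinuousLinearMap.const ℝ (Icc (0:ℝ) 1)).comp
        ((ContinuousLinearMap.fst ℝ _ _).comp (ContinuousLinearMap.fst ℝ _ _))) +
      ((ContinuousLinearMap.snd ℝ _ _).comp (ContinuousLinearMap.fst ℝ _ _)).smulRight w))
    (by
      rintro ⟨z, u⟩
      ext1
      · rfl
      · simp; abel)
    (by
      rintro ⟨z, u⟩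
      ext1
      · rfl
      · simp; abel)

/-- The integral term carries the time as a factor, so at time `0` only its derivative in the time
variable survives. What remains is triangular with identity blocks, hence invertible without any
smallness assumption. -/
lemma hasFDerivAt_flowDefect (f : C(E, E)) (hf : ContDiff ℝ ∞ f) (x₀ : E) :
    HasFDerivAt (flowDefect f)
      (flowDefectDeriv (volterra (superposition f (ContinuousLinearMap.const ℝ _ x₀))) :
        ((E × ℝ) × C(Icc (0:ℝ) 1, E)) →L[ℝ] ((E × ℝ) × C(Icc (0:ℝ) 1, E)))
      ((x₀, 0), ContinuousLinearMap.const ℝ _ x₀) := by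
  have h1 : Differentiable ℝ (superposition f : C(Icc (0:ℝ) 1, E) → C(Icc (0:ℝ) 1, E)) :=
    (contDiff_superposition f hf).differentiable (by simp)
  set z₀ : (E × ℝ) × C(Icc (0:ℝ) 1, E) := ((x₀, 0), ContinuousLinearMap.const ℝ _ x₀)
  have h2 : HasFDerivAt (fun z : (E × ℝ) × C(Icc (0:ℝ) 1, E) => volterra (superposition f z.2))
      (fderiv ℝ (fun z : (E × ℝ) × C(Icc (0:ℝ) 1, E) => volterra (superposition f z.2)) z₀) z₀ := by
    refine DifferentiableAt.hasFDerivAt ?_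
    exact (volterra.differentiable.comp (h1.comp differentiable_snd)) z₀
  have h3 : HasFDerivAt (fun z : (E × ℝ) × C(Icc (0:ℝ) 1, E) => z.1.2)
    ((ContinuousLinearMap.snd ℝ _ _).comp (ContinuousLinearMap.fst ℝ _ _)) z₀ :=
    ContinuousLinearMap.hasFDerivAt ((ContinuousLinearMap.snd ℝ E ℝ).comp
      (ContinuousLinearMap.fst ℝ (E × ℝ) C(Icc (0:ℝ) 1, E)))
  have h4 : HasFDerivAt (fun z : (E × ℝ) × C(Icc (0:ℝ) 1, E) =>
      ContinuousLinearMap.const ℝ (Icc (0:ℝ) 1) z.1.1)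
      ((ContinuousLinearMap.const ℝ (Icc (0:ℝ) 1)).comp
        ((ContinuousLinearMap.fst ℝ _ _).comp (ContinuousLinearMap.fst ℝ _ _))) z₀ :=
    ContinuousLinearMap.hasFDerivAt ((ContinuousLinearMap.const ℝ (Icc (0:ℝ) 1)).comp
        ((ContinuousLinearMap.fst ℝ E ℝ).comp
          (ContinuousLinearMap.fst ℝ (E × ℝ) C(Icc (0:ℝ) 1, E))))
  have h5 := (hasFDerivAt_fst (𝕜 := ℝ) (p := z₀)).prodMk
    ((((hasFDerivAt_snd (𝕜 := ℝ) (p := z₀))).sub h4).sub (h3.smul h2))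
  refine HasFDerivAt.congr_fderiv (f := flowDefect f) h5 (ContinuousLinearMap.ext fun z => ?_)
  simp [flowDefectDeriv, z₀, ContinuousLinearEquiv.equivOfInverse]

variable [CompleteSpace E]

/-- A smooth vector field on a Banach space has a smooth local flow. -/
theorem exists_local_flow_of_contDiff (f : E → E) (hf : ContDiff ℝ ∞ f) (x₀ : E) :
    ∃ δ > 0, ∃ φ : ℝ → E → E,
      ContDiffOn ℝ ∞ (Function.uncurry φ) (Ioo (-δ) δ ×ˢ Metric.ball x₀ δ) ∧
      ∀ x ∈ Metric.ball x₀ δ, φ 0 x = x ∧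
        ∀ t ∈ Ioo (-δ) δ, HasDerivAt (fun τ => φ τ x) (f (φ t x)) t := by
  let fc : C(E, E) := ⟨f, hf.continuous⟩
  obtain ⟨e, hz₀, -, heq, hsm⟩ := exists_openPartialHomeomorph_contDiffOn isOpen_univ
    (contDiff_flowDefect fc hf).contDiffOn (mem_univ _) (hasFDerivAt_flowDefect fc hf x₀)
  set c₀ : C(Icc (0:ℝ) 1, E) := ContinuousLinearMap.const ℝ _ x₀ with hc₀
  set z₀ : (E × ℝ) × C(Icc (0:ℝ) 1, E) := ((x₀, 0), c₀) with hz₀d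
  have hez₀ : e z₀ = ((x₀, 0), 0) := by
    rw [heq]; simp [flowDefect, z₀, c₀]
  -- Time enters as a parameter, so that the path space is fixed: `S t x` is the solution path run
  -- at speed `t` over the unit interval.
  let S : ℝ → E → C(Icc (0:ℝ) 1, E) := fun t x => (e.symm ((x, t), 0)).2
  let j : ℝ × E → (E × ℝ) × C(Icc (0:ℝ) 1, E) := fun p => ((p.2, p.1), 0)
  have hj : ContDiff ℝ ∞ j := (contDiff_snd.prodMk contDiff_fst).prodMk contDiff_const
  have hO : IsOpen (j ⁻¹' e.target) := e.open_target.preimage hj.continuous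
  have hSsm : ContDiffOn ℝ ∞ (Function.uncurry S) (j ⁻¹' e.target) :=
    contDiff_snd.comp_contDiffOn (hsm.comp hj.contDiffOn (fun _ h => h))
  have hz₀O : ((0 : ℝ), x₀) ∈ j ⁻¹' e.target := by
    have := e.map_source hz₀; rw [hez₀] at this; exact this
  have hS0 : S 0 x₀ = c₀ := by
    have := e.left_inv hz₀; rw [hez₀] at this
    simp only [S, this, z₀]
  -- the defining equation
  have hSeq : ∀ t x, (t, x) ∈ j ⁻¹' e.target →
      S t x = ContinuousLinearMap.const ℝ _ x + t • volterra (superposition fc (S t x)) := by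
    intro t x h
    have h1 := e.right_inv h
    rw [heq] at h1
    simp only [flowDefect, j, Prod.mk.injEq] at h1
    obtain ⟨h2, h3⟩ := h1
    rw [h2] at h3
    simp only at h3
    rw [sub_sub, sub_eq_zero] at h3
    exact h3
  have huniq : ∀ t x u, ((x, t), u) ∈ e.source →
      u = ContinuousLinearMap.const ℝ _ x + t • volterra (superposition fc u) → u = S t x := by
    intro t x u h hu
    have h1 : e ((x, t), u) = ((x, t), 0) := by
      rw [heq]; simp only [flowDefect, Prod.mk.injEq, true_and]
      rw [sub_sub, sub_eq_zero]; exact hu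
    have h2 := e.left_inv h
    rw [h1] at h2
    simp only [S, h2]
  obtain ⟨ρ, hρ, hsrc⟩ := Metric.isOpen_iff.1 e.open_source z₀ hz₀
  have hScont : ContinuousAt (Function.uncurry S) (0, x₀) :=
    hSsm.continuousOn.continuousAt (hO.mem_nhds hz₀O)
  have hev : ∀ᶠ p in 𝓝 ((0:ℝ), x₀), p ∈ j ⁻¹' e.target ∧ dist (Function.uncurry S p) c₀ < ρ := by
    refine Filter.Eventually.and (hO.mem_nhds hz₀O) ?_
    have h := Metric.continuousAt_iff'.1 hScont ρ hρ
    simp only [Function.uncurry_apply_pair, hS0] at h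
    exact h
  obtain ⟨δ', hδ', hball⟩ := Metric.eventually_nhds_iff_ball.1 hev
  obtain ⟨δ, hδ, hδδ', hδρ⟩ : ∃ δ > 0, δ ≤ δ' ∧ δ ≤ ρ :=
    ⟨min δ' ρ, lt_min hδ' hρ, min_le_left _ _, min_le_right _ _⟩
  have hgood : ∀ t ∈ Ioo (-δ) δ, ∀ x ∈ Metric.ball x₀ δ,
      (t, x) ∈ j ⁻¹' e.target ∧ dist (S t x) c₀ < ρ := by
    intro t ht x hx
    apply hball (t, x)
    rw [Metric.mem_ball, Prod.dist_eq, max_lt_iff]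
    refine ⟨?_, lt_of_lt_of_le hx hδδ'⟩
    rw [Real.dist_eq, sub_zero, abs_lt]
    exact ⟨by linarith [ht.1], by linarith [ht.2]⟩
  have one_mem : (1:ℝ) ∈ Icc (0:ℝ) 1 := by simp
  let φ : ℝ → E → E := fun t x => S t x ⟨1, one_mem⟩
  -- rescaling the time
  have hscale : ∀ t ∈ Ioo (-δ) δ, ∀ x ∈ Metric.ball x₀ δ, ∀ s (hs : s ∈ Icc (0:ℝ) 1),
      S t x ⟨s, hs⟩ = φ (t * s) x := by
    intro t ht x hx s hs
    obtain ⟨h1, h2⟩ := hgood t ht x hx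
    -- The path `S t x` slowed down by the factor `s` solves the integral equation with time `t * s`
    -- and is still close to `c₀`. Local uniqueness identifies it with `S (t * s) x`.
    let m : C(Icc (0:ℝ) 1, Icc (0:ℝ) 1) :=
      ⟨fun r => ⟨s * r, mul_nonneg hs.1 r.2.1, mul_le_one₀ hs.2 r.2.1 r.2.2⟩, by fun_prop⟩
    let u : C(Icc (0:ℝ) 1, E) := (S t x).comp m
    have hts : t * s ∈ Ioo (-δ) δ := by
      rw [mem_Ioo, ← abs_lt] at ht ⊢
      rw [abs_mul, abs_of_nonneg hs.1]
      exact lt_of_le_of_lt (mul_le_of_le_one_right (abs_nonneg _) hs.2) ht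
    have hu : u = S (t * s) x := by
      apply huniq
      · apply hsrc
        rw [Metric.mem_ball, Prod.dist_eq, max_lt_iff, Prod.dist_eq, max_lt_iff]
        refine ⟨⟨lt_of_lt_of_le hx hδρ, ?_⟩, ?_⟩
        · rw [Real.dist_eq, sub_zero, abs_lt]
          exact ⟨by linarith [hts.1], by linarith [hts.2]⟩
        · rw [ContinuousMap.dist_lt_iff hρ]
          intro r
          exact lt_of_le_of_lt (ContinuousMap.dist_apply_le_dist (f := S t x) (g := c₀) (m r)) h2
      · ext r
        have h3 := congrArg (fun v : C(Icc (0:ℝ) 1, E) => v (m r)) (hSeq t x h1)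
        simp only [ContinuousMap.add_apply, ContinuousMap.smul_apply, volterra_apply] at h3 ⊢
        change S t x (m r) = _
        rw [h3, mul_smul]
        refine congrArg₂ (· + ·) rfl (congrArg (t • ·) ?_)
        have h4 : ∀ q ∈ uIcc (0:ℝ) r, extendUnit (superposition fc u) q =
            extendUnit (superposition fc (S t x)) (s * q) := by
          intro q hq
          rw [uIcc_of_le r.2.1] at hq
          have hq' : q ∈ Icc (0:ℝ) 1 := ⟨hq.1, hq.2.trans r.2.2⟩
          rw [extendUnit_of_mem _ hq', extendUnit_of_mem _
            ⟨mul_nonneg hs.1 hq'.1, mul_le_one₀ hs.2 hq'.1 hq'.2⟩]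
          rfl
        rw [intervalIntegral.integral_congr h4,
          intervalIntegral.smul_integral_comp_mul_left (fun q => extendUnit
            (superposition fc (S t x)) q) s]
        simp [m]
    change (S t x) ⟨s, hs⟩ = S (t * s) x ⟨1, one_mem⟩
    rw [← hu]
    simp [u, m]
  have hφsm : ContDiffOn ℝ ∞ (Function.uncurry φ) (Ioo (-δ) δ ×ˢ Metric.ball x₀ δ) := by
    have h := hSsm.mono (s := j ⁻¹' e.target) (t := Ioo (-δ) δ ×ˢ Metric.ball x₀ δ)
      fun p hp => (hgood p.1 hp.1 p.2 hp.2).1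
    exact (ContinuousMap.evalCLM ℝ (⟨1, one_mem⟩ : Icc (0:ℝ) 1)).contDiff.comp_contDiffOn h
  have hint : ∀ x ∈ Metric.ball x₀ δ, ∀ t ∈ Ioo (-δ) δ,
      φ t x = x + ∫ r in (0:ℝ)..t, f (φ r x) := by
    intro x hx t ht
    have h3 := congrArg (fun v : C(Icc (0:ℝ) 1, E) => v ⟨1, one_mem⟩)
      (hSeq t x (hgood t ht x hx).1)
    simp only [ContinuousMap.add_apply, ContinuousMap.smul_apply, volterra_apply] at h3
    change S t x _ = _
    rw [h3]
    have h4 : ∀ q ∈ uIcc (0:ℝ) 1, extendUnit (superposition fc (S t x)) q = f (φ (t * q) x) := by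
      intro q hq
      rw [uIcc_of_le zero_le_one] at hq
      rw [extendUnit_of_mem _ hq]
      change f _ = _
      rw [hscale t ht x hx q hq]
    rw [intervalIntegral.integral_congr h4,
      intervalIntegral.smul_integral_comp_mul_left (fun q => f (φ q x)) t]
    simp
  refine ⟨δ, hδ, φ, hφsm, fun x hx => ⟨?_, fun t ht => ?_⟩⟩
  · simpa using hint x hx 0 ⟨by linarith, hδ⟩
  · have hc : ContinuousOn (fun r => f (φ r x)) (Ioo (-δ) δ) :=
      hf.continuous.comp_continuousOn (hφsm.continuousOn.comp
        (f := fun r : ℝ => (r, x)) (by fun_prop) (fun r hr => ⟨hr, hx⟩))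
    have hsub : uIcc 0 t ⊆ Ioo (-δ) δ :=
      (ordConnected_Ioo).uIcc_subset ⟨by linarith, hδ⟩ ht
    have hd := intervalIntegral.integral_hasDerivAt_right
      (hc.mono hsub).intervalIntegrable
      (hc.stronglyMeasurableAtFilter isOpen_Ioo t ht) (hc.continuousAt (isOpen_Ioo.mem_nhds ht))
    refine (hd.const_add x).congr_of_eventuallyEq ?_
    filter_upwards [isOpen_Ioo.mem_nhds ht] with r hr
    exact hint x hx r hr

/-- A smooth vector field on an open subset of a finite-dimensional space has a smooth local flow
at every point. -/
theorem exists_local_flow [FiniteDimensional ℝ E] {V : E → E} {U : Set E} (hU : IsOpen U)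
    (hV : ContDiffOn ℝ ∞ V U) {x₀ : E} (hx₀ : x₀ ∈ U) {N : Set E} (hN : N ∈ 𝓝 x₀) :
    ∃ δ > 0, ∃ φ : ℝ → E → E,
      ContDiffOn ℝ ∞ (Function.uncurry φ) (Ioo (-δ) δ ×ˢ Metric.ball x₀ δ) ∧
      ∀ x ∈ Metric.ball x₀ δ, φ 0 x = x ∧
        ∀ t ∈ Ioo (-δ) δ, φ t x ∈ N ∧ HasDerivAt (fun τ => φ τ x) (V (φ t x)) t := by
  obtain ⟨r, hr, hrU⟩ := Metric.nhds_basis_closedBall.mem_iff.1 (hU.mem_nhds hx₀)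
  -- Cutting the field off makes it globally smooth. Short flow lines starting near `x₀` stay in the
  -- ball of radius `r / 2`, where `χ = 1` and the field is unchanged.
  let χ : ContDiffBump x₀ := ⟨r / 2, r, by linarith, by linarith⟩
  have hsupp : tsupport χ ⊆ U := by rw [χ.tsupport_eq]; exact hrU
  have hf : ContDiff ℝ ∞ fun x => χ x • V x := by
    rw [contDiff_iff_contDiffAt]
    intro x
    by_cases hx : x ∈ U
    · exact χ.contDiff.contDiffAt.smul (hV.contDiffAt (hU.mem_nhds hx))
    · have h0 : (fun x => χ x • V x) =ᶠ[𝓝 x] fun _ => (0 : E) := by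
        have : (tsupport χ)ᶜ ∈ 𝓝 x := (isClosed_tsupport _).isOpen_compl.mem_nhds fun h => hx (hsupp h)
        filter_upwards [this] with y hy
        rw [image_eq_zero_of_notMem_tsupport hy, zero_smul]
      exact contDiffAt_const.congr_of_eventuallyEq h0
  obtain ⟨δ₁, hδ₁, φ, hφ, H⟩ := exists_local_flow_of_contDiff _ hf x₀
  have hcont : ContinuousAt (Function.uncurry φ) (0, x₀) :=
    hφ.continuousOn.continuousAt ((isOpen_Ioo.prod Metric.isOpen_ball).mem_nhds
      ⟨⟨by simpa using hδ₁, hδ₁⟩, Metric.mem_ball_self hδ₁⟩)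
  have hev : ∀ᶠ p in 𝓝 ((0:ℝ), x₀), Function.uncurry φ p ∈ N ∩ Metric.ball x₀ (r / 2) := by
    apply hcont
    simp only [Function.uncurry_apply_pair, (H x₀ (Metric.mem_ball_self hδ₁)).1]
    exact Filter.inter_mem hN (Metric.ball_mem_nhds _ (by linarith))
  obtain ⟨δ₂, hδ₂, hball⟩ := Metric.eventually_nhds_iff_ball.1 hev
  obtain ⟨δ, hδ, hδ1, hδ2⟩ : ∃ δ > 0, δ ≤ δ₁ ∧ δ ≤ δ₂ :=
    ⟨min δ₁ δ₂, lt_min hδ₁ hδ₂, min_le_left _ _, min_le_right _ _⟩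
  have hI : Ioo (-δ) δ ⊆ Ioo (-δ₁) δ₁ := Ioo_subset_Ioo (by linarith) hδ1
  have hB : Metric.ball x₀ δ ⊆ Metric.ball x₀ δ₁ := Metric.ball_subset_ball hδ1
  refine ⟨δ, hδ, φ, hφ.mono (prod_mono hI hB), fun x hx => ⟨(H x (hB hx)).1, fun t ht => ?_⟩⟩
  have hmem : φ t x ∈ N ∩ Metric.ball x₀ (r / 2) := by
    apply hball (t, x)
    rw [Metric.mem_ball, Prod.dist_eq, max_lt_iff]
    refine ⟨?_, lt_of_lt_of_le hx hδ2⟩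
    rw [Real.dist_eq, sub_zero, abs_lt]
    exact ⟨by linarith [ht.1], by linarith [ht.2]⟩
  refine ⟨hmem.1, ?_⟩
  have h := (H x (hB hx)).2 t (hI ht)
  rwa [χ.one_of_mem_closedBall (Metric.ball_subset_closedBall hmem.2), one_smul] at h

end LocalFlow

/-! ### Metrics and Killing fields in coordinates -/

section MetricOn

variable {E : Type} [NormedAddCommGroup E] [NormedSpace ℝ E]

/-- `g` is a smooth Riemannian metric on the open subset `U` of the vector space `E`. -/
structure SmoothMetricOn (g : E → E →L[ℝ] E →L[ℝ] ℝ) (U : Set E) : Prop where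
  isOpen : IsOpen U
  contDiffOn : ContDiffOn ℝ ∞ g U
  symm : ∀ x ∈ U, ∀ a b, g x a b = g x b a
  pos : ∀ x ∈ U, ∀ a, a ≠ 0 → 0 < g x a a

/-- `V` is a smooth Killing field of `g` on `U`, in coordinates. -/
structure KillingFieldOn (g : E → E →L[ℝ] E →L[ℝ] ℝ) (V : E → E) (U : Set E) : Prop where
  contDiffOn : ContDiffOn ℝ ∞ V U
  killing : ∀ x ∈ U, ∀ a b,
    fderiv ℝ g x (V x) a b + g x (fderiv ℝ V x a) b + g x a (fderiv ℝ V x b) = 0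

lemma HasDerivAt.bilinear {g : E → E →L[ℝ] E →L[ℝ] ℝ} {g' : E →L[ℝ] E →L[ℝ] E →L[ℝ] ℝ}
    {u a b : ℝ → E} {u' a' b' : E} {s : ℝ}
    (hg : HasFDerivAt g g' (u s)) (hu : HasDerivAt u u' s)
    (ha : HasDerivAt a a' s) (hb : HasDerivAt b b' s) :
    HasDerivAt (fun s => g (u s) (a s) (b s))
      (g' u' (a s) (b s) + g (u s) a' (b s) + g (u s) (a s) b') s := by
  have h1 : HasDerivAt (fun s => g (u s)) (g' u') s := hg.comp_hasDerivAt s hu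
  have h2 := (h1.clm_apply ha).clm_apply hb
  exact h2.congr_deriv (by rw [add_apply])

namespace SmoothMetricOn

variable {g : E → E →L[ℝ] E →L[ℝ] ℝ} {V : E → E} {U : Set E}

lemma contDiffAt (hg : SmoothMetricOn g U) {x : E} (hx : x ∈ U) : ContDiffAt ℝ ∞ g x :=
  hg.contDiffOn.contDiffAt (hg.isOpen.mem_nhds hx)

lemma hasFDerivAt (hg : SmoothMetricOn g U) {x : E} (hx : x ∈ U) :
    HasFDerivAt g (fderiv ℝ g x) x :=
  ((hg.contDiffAt hx).differentiableAt (by simp)).hasFDerivAt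

lemma contDiffAt_fderiv (hg : SmoothMetricOn g U) {x : E} (hx : x ∈ U) :
    ContDiffAt ℝ ∞ (fderiv ℝ g) x :=
  (hg.contDiffAt hx).fderiv_right (m := ∞) (by simp)

lemma eq_zero (hg : SmoothMetricOn g U) {x : E} (hx : x ∈ U) {a : E} (ha : g x a a = 0) :
    a = 0 := by
  by_contra h
  exact (hg.pos x hx a h).ne' ha

variable [FiniteDimensional ℝ E]

lemma isInvertible (hg : SmoothMetricOn g U) {x : E} (hx : x ∈ U) : (g x).IsInvertible := by
  have hinj : Function.Injective (g x) := by
    rw [injective_iff_map_eq_zero]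
    intro a ha
    exact hg.eq_zero hx (by simp [ha])
  have hdim : Module.finrank ℝ E = Module.finrank ℝ (E →L[ℝ] ℝ) := by
    rw [← (LinearMap.toContinuousLinearMap : (E →ₗ[ℝ] ℝ) ≃ₗ[ℝ] _).finrank_eq]
    exact (Subspace.dual_finrank_eq).symm
  let e : E ≃ₗ[ℝ] (E →L[ℝ] ℝ) :=
    LinearEquiv.ofInjectiveOfFinrankEq (g x : E →ₗ[ℝ] (E →L[ℝ] ℝ)) hinj hdim
  exact ⟨e.toContinuousLinearEquiv, by ext; rfl⟩

/-- Locally uniform positive definiteness. -/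
lemma eventually_ge (hg : SmoothMetricOn g U) {x : E} (hx : x ∈ U) :
    ∃ m > 0, ∀ᶠ y in 𝓝 x, ∀ a, m * ‖a‖ ^ 2 ≤ g y a a := by
  obtain ⟨m₀, hm₀, h₀⟩ : ∃ m₀ > 0, ∀ a ∈ Metric.sphere (0 : E) 1, m₀ ≤ g x a a := by
    rcases (Metric.sphere (0 : E) 1).eq_empty_or_nonempty with h | h
    · exact ⟨1, one_pos, by simp [h]⟩
    · have hc : Continuous fun a => g x a a := ((g x).continuous).clm_apply continuous_id
      obtain ⟨a₀, ha₀, hmin⟩ := (isCompact_sphere (0 : E) 1).exists_isMinOn h hc.continuousOn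
      refine ⟨g x a₀ a₀, hg.pos x hx a₀ ?_, fun a ha => hmin ha⟩
      rintro rfl
      simp at ha₀
  refine ⟨m₀ / 2, by linarith, ?_⟩
  have hcont := (hg.contDiffAt hx).continuousAt
  filter_upwards [Metric.continuousAt_iff'.1 hcont (m₀ / 2) (by linarith)] with y hy a
  rw [dist_eq_norm] at hy
  have h1 : m₀ * ‖a‖ ^ 2 ≤ g x a a := by
    by_cases ha : a = 0
    · simp [ha]
    · have hna : ‖a‖ ≠ 0 := norm_ne_zero_iff.2 ha
      have h2 := h₀ (‖a‖⁻¹ • a) (by simp [norm_smul, hna])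
      simp only [map_smul, smul_apply, smul_eq_mul] at h2
      have h3 : m₀ * ‖a‖ ^ 2 ≤ ‖a‖⁻¹ * (‖a‖⁻¹ * g x a a) * ‖a‖ ^ 2 := by gcongr
      convert h3 using 1
      field_simp
  have h2 : |(g y - g x) a a| ≤ (m₀ / 2) * ‖a‖ ^ 2 := by
    have h3 := (g y - g x).le_opNorm₂ a a
    rw [Real.norm_eq_abs] at h3
    refine h3.trans ?_
    rw [mul_assoc, ← sq]
    gcongr
  have h3 := (abs_le.1 h2).1
  simp only [sub_apply] at h3
  linarith

end SmoothMetricOn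

section Geodesic

variable {g : E → E →L[ℝ] E →L[ℝ] ℝ} {V : E → E} {U : Set E}

/-- The covector `w ↦ ½ ∂_w g(v, v) - ∂_v g(v, w)`. -/
noncomputable def geodesicForce (g : E → E →L[ℝ] E →L[ℝ] ℝ) (p : E × E) : E →L[ℝ] ℝ :=
  (1 / 2 : ℝ) • ((fderiv ℝ g p.1).flip p.2).flip p.2 - fderiv ℝ g p.1 p.2 p.2

/-- The acceleration of a geodesic of `g` at the point `p.1` with velocity `p.2`. -/
noncomputable def geodesicAcceleration (g : E → E →L[ℝ] E →L[ℝ] ℝ) (p : E × E) : E :=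
  (g p.1).inverse (geodesicForce g p)

lemma geodesicForce_apply (x v w : E) :
    geodesicForce g (x, v) w = (1 / 2) * fderiv ℝ g x w v v - fderiv ℝ g x v v w := by
  simp [geodesicForce, ContinuousLinearMap.flip_apply]

variable [FiniteDimensional ℝ E]

/-- The Euler-Lagrange form of the geodesic equation: lowering the index with `g` replaces
Christoffel symbols by first derivatives of `g` tested against arbitrary `w`. -/
lemma SmoothMetricOn.geodesicAcceleration_eq_iff (hg : SmoothMetricOn g U) {x : E} (hx : x ∈ U)
    (v a : E) : a = geodesicAcceleration g (x, v) ↔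
      ∀ w, g x a w = (1 / 2) * fderiv ℝ g x w v v - fderiv ℝ g x v v w := by
  rw [eq_comm, geodesicAcceleration, (hg.isInvertible hx).inverse_apply_eq, eq_comm]
  simp only [ContinuousLinearMap.ext_iff, geodesicForce_apply]

lemma SmoothMetricOn.contDiffOn_geodesicAcceleration (hg : SmoothMetricOn g U) :
    ContDiffOn ℝ ∞ (geodesicAcceleration g) (U ×ˢ univ) := by
  rintro ⟨x, v⟩ ⟨hx, -⟩
  apply ContDiffAt.contDiffWithinAt
  have h1 : ContDiffAt ℝ ∞ (fun p : E × E => fderiv ℝ g p.1) (x, v) :=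
    (hg.contDiffAt_fderiv hx).comp (x, v) contDiffAt_fst
  have hflip : ∀ (G : Type) [NormedAddCommGroup G] [NormedSpace ℝ G],
      ContDiff ℝ ∞ (fun L : E →L[ℝ] E →L[ℝ] G => L.flip) := fun G _ _ =>
    (ContinuousLinearMap.flipₗᵢ ℝ E E G : (E →L[ℝ] E →L[ℝ] G) ≃ₗᵢ[ℝ] _).contDiff
  have hsnd : ContDiffAt ℝ ∞ (fun p : E × E => p.2) (x, v) := contDiffAt_snd
  have h2 : ContDiffAt ℝ ∞ (geodesicForce g) (x, v) := by
    refine ContDiffAt.sub (contDiffAt_const.fun_smul ?_) ((h1.clm_apply hsnd).clm_apply hsnd)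
    have h3 : ContDiffAt ℝ ∞ (fun p : E × E => (fderiv ℝ g p.1).flip p.2) (x, v) :=
      ((hflip _).contDiffAt.comp (x, v) h1).clm_apply hsnd
    exact ((hflip _).contDiffAt.comp (x, v) h3).clm_apply hsnd
  have h4 : ContDiffAt ℝ ∞ (fun p : E × E => (g p.1).inverse) (x, v) :=
    ContDiffAt.comp (x, v) (f := fun p : E × E => g p.1)
      ((hg.isInvertible hx).contDiffAt_map_inverse) ((hg.contDiffAt hx).comp (x, v) contDiffAt_fst)
  exact h4.clm_apply h2

/-- The speed of a geodesic is constant. -/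
lemma SmoothMetricOn.hasDerivAt_speed (hg : SmoothMetricOn g U) {u v : ℝ → E} {s : ℝ}
    (hx : u s ∈ U) (hu : HasDerivAt u (v s) s)
    (hv : HasDerivAt v (geodesicAcceleration g (u s, v s)) s) :
    HasDerivAt (fun s => g (u s) (v s) (v s)) 0 s := by
  refine (HasDerivAt.bilinear (hg.hasFDerivAt hx) hu hv hv).congr_deriv ?_
  have h := (hg.geodesicAcceleration_eq_iff hx (v s) _).1 rfl (v s)
  rw [hg.symm _ hx (v s)]
  linarith

/-- Clairaut's relation: the inner product of the velocity of a geodesic with a Killing field is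
constant. -/
lemma KillingFieldOn.hasDerivAt_momentum (hg : SmoothMetricOn g U) (hV : KillingFieldOn g V U)
    {u v : ℝ → E} {s : ℝ} (hx : u s ∈ U) (hu : HasDerivAt u (v s) s)
    (hv : HasDerivAt v (geodesicAcceleration g (u s, v s)) s) :
    HasDerivAt (fun s => g (u s) (v s) (V (u s))) 0 s := by
  have hVd : HasFDerivAt V (fderiv ℝ V (u s)) (u s) :=
    ((hV.contDiffOn.contDiffAt (hg.isOpen.mem_nhds hx)).differentiableAt (by simp)).hasFDerivAt
  refine (HasDerivAt.bilinear (hg.hasFDerivAt hx) hu hv (hVd.comp_hasDerivAt s hu)).congr_deriv ?_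
  have h := (hg.geodesicAcceleration_eq_iff hx (v s) _).1 rfl (V (u s))
  have h2 := hV.killing _ hx (v s) (v s)
  rw [hg.symm _ hx (fderiv ℝ V (u s) (v s))] at h2
  simp only [Function.comp_apply] at h ⊢
  linarith

end Geodesic

/-! ### Killing fields in dimension two -/

section DimensionTwo

variable {g : E → E →L[ℝ] E →L[ℝ] ℝ} {V : E → E} {U : Set E}

/-- Two nonzero orthogonal vectors of a plane form a basis. -/
lemma SmoothMetricOn.exists_eq_add (hg : SmoothMetricOn g U) [FiniteDimensional ℝ E] (hE : Module.finrank ℝ E = 2)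
    {x : E} (hx : x ∈ U) {a b : E} (ha : a ≠ 0) (hb : b ≠ 0) (hab : g x a b = 0) (w : E) :
    ∃ r s : ℝ, w = r • a + s • b := by
  have hli : LinearIndependent ℝ ![a, b] := by
    rw [LinearIndependent.pair_iff]
    intro r s h
    have h1 : g x a (r • a + s • b) = 0 := by rw [h, map_zero]
    have h2 : g x b (r • a + s • b) = 0 := by rw [h, map_zero]
    have hba : g x b a = 0 := by rw [hg.symm x hx, hab]
    simp only [map_add, map_smul, smul_eq_mul, hab, hba, mul_zero, add_zero, zero_add,
      mul_eq_zero] at h1 h2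
    exact ⟨h1.resolve_right (hg.pos x hx a ha).ne', h2.resolve_right (hg.pos x hx b hb).ne'⟩
  have hspan := hli.span_eq_top_of_card_eq_finrank' (by simp [hE])
  have hw : w ∈ Submodule.span ℝ (range ![a, b]) := by rw [hspan]; trivial
  rw [Matrix.range_cons, Matrix.range_cons, Matrix.range_empty, union_empty] at hw
  rw [← insert_eq] at hw
  obtain ⟨r, s, h⟩ := Submodule.mem_span_pair.1 hw
  exact ⟨r, s, h.symm⟩

/-- A unit speed curve orthogonal to a nonvanishing Killing field of a surface is a geodesic. -/
lemma KillingFieldOn.acceleration_eq [FiniteDimensional ℝ E] (hg : SmoothMetricOn g U)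
    (hV : KillingFieldOn g V U)
    (hE : Module.finrank ℝ E = 2) {u v : ℝ → E} {a : E} {s : ℝ} (hx : u s ∈ U)
    (hu : HasDerivAt u (v s) s) (hv : HasDerivAt v a s)
    (h1 : HasDerivAt (fun s => g (u s) (v s) (v s)) 0 s)
    (h2 : HasDerivAt (fun s => g (u s) (v s) (V (u s))) 0 s)
    (hv0 : v s ≠ 0) (hV0 : V (u s) ≠ 0) (horth : g (u s) (v s) (V (u s)) = 0) :
    a = geodesicAcceleration g (u s, v s) := by
  have hVd : HasFDerivAt V (fderiv ℝ V (u s)) (u s) :=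
    ((hV.contDiffOn.contDiffAt (hg.isOpen.mem_nhds hx)).differentiableAt (by simp)).hasFDerivAt
  have e1 := (HasDerivAt.bilinear (hg.hasFDerivAt hx) hu hv hv).unique h1
  have e2 := (HasDerivAt.bilinear (hg.hasFDerivAt hx) hu hv (hVd.comp_hasDerivAt s hu)).unique h2
  rw [hg.symm _ hx (v s) a] at e1
  have e3 := hV.killing _ hx (v s) (v s)
  rw [hg.symm _ hx (fderiv ℝ V (u s) (v s))] at e3
  simp only [Function.comp_apply] at e2
  rw [hg.geodesicAcceleration_eq_iff hx]
  intro w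
  -- It suffices to test against the frame formed by the velocity and `V`. The constant speed `e1`
  -- gives the first component; the constant momentum `e2`, corrected by Killing's equation `e3`,
  -- gives the second.
  obtain ⟨r, t, rfl⟩ := hg.exists_eq_add hE hx hv0 hV0 horth w
  simp only [map_add, map_smul, add_apply, smul_apply,
    smul_eq_mul]
  linear_combination (r / 2) * e1 + t * e2 - (t / 2) * e3

/-- The covariant derivative of a Killing field of a surface at a zero is a multiple of a
quarter turn. -/
lemma KillingFieldOn.fderiv_fderiv_eq (hg : SmoothMetricOn g U) (hV : KillingFieldOn g V U)
    [FiniteDimensional ℝ E] (hE : Module.finrank ℝ E = 2) {x : E} (hx : x ∈ U) (hVx : V x = 0)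
    (hA : fderiv ℝ V x ≠ 0) {a : E} (ha : g x a a = 1) :
    ∃ l > 0, g x (fderiv ℝ V x a) (fderiv ℝ V x a) = l ^ 2 ∧
      fderiv ℝ V x (fderiv ℝ V x a) = -(l ^ 2) • a := by
  set A := fderiv ℝ V x with hAdef
  -- At a zero the term with the derivative of the metric disappears from Killing's equation,
  -- leaving that `A` is skew for `g x`.
  have hsk : ∀ a b, g x (A a) b + g x a (A b) = 0 := by
    intro a b
    have := hV.killing x hx a b
    rwa [hVx, map_zero, zero_apply, zero_apply,
      zero_add] at this
  have hself : ∀ a, g x a (A a) = 0 := by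
    intro a
    have h := hsk a a
    rw [hg.symm x hx (A a)] at h
    linarith
  have ha0 : a ≠ 0 := by rintro rfl; simp at ha
  -- A skew map of a plane that kills `a` has image orthogonal to `a`. If `A b ≠ 0`, expand `b` in
  -- the basis `a`, `A b`: since `b` is orthogonal to `A b`, it is a multiple of `a`, so `A b = 0`.
  have hAa : A a ≠ 0 := by
    intro h0
    obtain ⟨b, hb⟩ : ∃ b, A b ≠ 0 := by
      by_contra! h
      exact hA (ContinuousLinearMap.ext h)
    have h1 : g x a (A b) = 0 := by
      have := hsk a b; rw [h0] at this; simpa using this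
    obtain ⟨r, s, h⟩ := hg.exists_eq_add hE hx ha0 hb h1 b
    have h2 := hself b
    nth_rewrite 1 [h] at h2
    simp only [map_add, map_smul, add_apply, smul_apply,
      smul_eq_mul, h1, mul_zero, zero_add, mul_eq_zero] at h2
    rcases h2 with h2 | h2
    · rw [h2, zero_smul, add_zero] at h
      apply hb
      rw [h, map_smul, h0, smul_zero]
    · exact hb (hg.eq_zero hx h2)
  have hpos := hg.pos x hx _ hAa
  refine ⟨√(g x (A a) (A a)), Real.sqrt_pos.2 hpos, (Real.sq_sqrt hpos.le).symm, ?_⟩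
  rw [Real.sq_sqrt hpos.le]
  obtain ⟨r, s, h⟩ := hg.exists_eq_add hE hx ha0 hAa (hself a) (A (A a))
  have h1 : g x (A a) (A (A a)) = 0 := hself (A a)
  have h2 := hsk a (A a)
  have h3 : g x (A a) a = 0 := by rw [hg.symm x hx, hself]
  rw [h] at h1 h2
  simp only [map_add, map_smul, smul_eq_mul, ha, hself, h3, mul_zero, zero_add, mul_eq_zero,
    mul_one, add_zero] at h1 h2
  have hs : s = 0 := h1.resolve_right hpos.ne'
  rw [h, hs, zero_smul, add_zero]
  congr 1
  linarith

end DimensionTwo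

end MetricOn

lemma minSmoothness_two_le_infty : minSmoothness ℝ 2 ≤ (∞ : WithTop ℕ∞) := by
  rw [minSmoothness_of_isRCLikeNormedField]
  exact ENat.LEInfty.out

/-! ### Rigidity: a Killing field is determined by its 1-jet -/

section Rigidity

variable {E : Type} [NormedAddCommGroup E] [NormedSpace ℝ E]
variable {g : E → E →L[ℝ] E →L[ℝ] ℝ} {V : E → E} {U : Set E}

lemma KillingFieldOn.contDiffAt (hg : SmoothMetricOn g U) (hV : KillingFieldOn g V U) {x : E}
    (hx : x ∈ U) : ContDiffAt ℝ ∞ V x :=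
  hV.contDiffOn.contDiffAt (hg.isOpen.mem_nhds hx)

lemma KillingFieldOn.hasFDerivAt (hg : SmoothMetricOn g U) (hV : KillingFieldOn g V U) {x : E}
    (hx : x ∈ U) : HasFDerivAt V (fderiv ℝ V x) x :=
  ((hV.contDiffAt hg hx).differentiableAt (by simp)).hasFDerivAt

lemma KillingFieldOn.contDiffAt_fderiv (hg : SmoothMetricOn g U) (hV : KillingFieldOn g V U) {x : E}
    (hx : x ∈ U) : ContDiffAt ℝ ∞ (fderiv ℝ V) x :=
  (hV.contDiffAt hg hx).fderiv_right (m := ∞) (by simp)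

/-- The derivative of Killing's equation. -/
lemma KillingFieldOn.deriv_killing (hg : SmoothMetricOn g U) (hV : KillingFieldOn g V U) {x : E}
    (hx : x ∈ U) (w a b : E) :
    fderiv ℝ (fderiv ℝ g) x w (V x) a b + fderiv ℝ g x (fderiv ℝ V x w) a b +
      fderiv ℝ g x w (fderiv ℝ V x a) b + fderiv ℝ g x w a (fderiv ℝ V x b) +
      g x (fderiv ℝ (fderiv ℝ V) x w a) b + g x a (fderiv ℝ (fderiv ℝ V) x w b) = 0 := by
  have hV1 := hV.hasFDerivAt hg hx
  have hV2 : HasFDerivAt (fderiv ℝ V) (fderiv ℝ (fderiv ℝ V) x) x :=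
    ((hV.contDiffAt_fderiv hg hx).differentiableAt (by simp)).hasFDerivAt
  have hg1 := hg.hasFDerivAt hx
  have hg2 : HasFDerivAt (fderiv ℝ g) (fderiv ℝ (fderiv ℝ g) x) x :=
    ((hg.contDiffAt_fderiv hx).differentiableAt (by simp)).hasFDerivAt
  have hc : ∀ c : E, HasFDerivAt (fun _ : E => c) (0 : E →L[ℝ] E) x := fun c =>
    hasFDerivAt_const c x
  have h1 := ((hg2.clm_apply hV1).clm_apply (hc a)).clm_apply (hc b)
  have h2 := (hg1.clm_apply (hV2.clm_apply (hc a))).clm_apply (hc b)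
  have h3 := (hg1.clm_apply (hc a)).clm_apply (hV2.clm_apply (hc b))
  have h4 := (h1.add h2).add h3
  have h5 := (hasFDerivAt_const (𝕜 := ℝ) (0 : ℝ) x).congr_of_eventuallyEq
    (f₁ := fun y => fderiv ℝ g y (V y) a b + g y (fderiv ℝ V y a) b + g y a (fderiv ℝ V y b))
    (by filter_upwards [hg.isOpen.mem_nhds hx] with y hy using hV.killing y hy a b)
  have h6 := DFunLike.congr_fun (h4.unique h5) w
  simp at h6
  linarith

/-- The second derivatives of a Killing field are controlled by its `1`-jet. -/
lemma KillingFieldOn.norm_fderiv_fderiv_le [FiniteDimensional ℝ E] (hg : SmoothMetricOn g U)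
    (hV : KillingFieldOn g V U) {x₀ : E} (hx₀ : x₀ ∈ U) :
    ∃ K > 0, ∀ᶠ x in 𝓝 x₀,
      ‖fderiv ℝ (fderiv ℝ V) x‖ ≤ K * (‖V x‖ + ‖fderiv ℝ V x‖) := by
  obtain ⟨m, hm, hme⟩ := hg.eventually_ge hx₀
  set C := max ‖fderiv ℝ g x₀‖ ‖fderiv ℝ (fderiv ℝ g) x₀‖ + 1 with hC
  have hC0 : 0 < C := by positivity
  have hc1 : ContinuousAt (fun x => ‖fderiv ℝ g x‖) x₀ :=
    ((hg.contDiffAt_fderiv hx₀).continuousAt).norm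
  have hc2 : ContinuousAt (fun x => ‖fderiv ℝ (fderiv ℝ g) x‖) x₀ :=
    (((hg.contDiffAt_fderiv hx₀).fderiv_right (m := ∞) (by simp)).continuousAt).norm
  have hb1 : ∀ᶠ x in 𝓝 x₀, ‖fderiv ℝ g x‖ < C :=
    hc1.eventually_lt continuousAt_const (by rw [hC]; exact lt_of_le_of_lt (le_max_left _ _) (lt_add_one _))
  have hb2 : ∀ᶠ x in 𝓝 x₀, ‖fderiv ℝ (fderiv ℝ g) x‖ < C :=
    hc2.eventually_lt continuousAt_const (by rw [hC]; exact lt_of_le_of_lt (le_max_right _ _) (lt_add_one _))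
  -- The factor `9 / 2` is half of three remainders, each bounded with constant `3 * C`; `m` bounds
  -- the metric from below.
  refine ⟨9 / 2 * C / m, by positivity, ?_⟩
  filter_upwards [hme, hb1, hb2, hg.isOpen.mem_nhds hx₀] with x hmx h1 h2 hx
  set N := ‖V x‖ + ‖fderiv ℝ V x‖ with hN
  have hN0 : 0 ≤ N := by positivity
  set R : E → E → E → ℝ := fun w a b => -(fderiv ℝ (fderiv ℝ g) x w (V x) a b +
    fderiv ℝ g x (fderiv ℝ V x w) a b + fderiv ℝ g x w (fderiv ℝ V x a) b +
    fderiv ℝ g x w a (fderiv ℝ V x b)) with hR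
  have hRb : ∀ w a b, |R w a b| ≤ 3 * C * N * (‖w‖ * ‖a‖ * ‖b‖) := by
    intro w a b
    have t1 : |fderiv ℝ (fderiv ℝ g) x w (V x) a b| ≤ C * ‖w‖ * ‖V x‖ * ‖a‖ * ‖b‖ := by
      have := ((fderiv ℝ (fderiv ℝ g) x w (V x)).le_opNorm₂ a b)
      rw [Real.norm_eq_abs] at this
      refine this.trans ?_
      gcongr
      refine ((fderiv ℝ (fderiv ℝ g) x).le_opNorm₂ w (V x)).trans ?_
      gcongr
    have t2 : ∀ p q r : E, |fderiv ℝ g x p q r| ≤ C * ‖p‖ * ‖q‖ * ‖r‖ := by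
      intro p q r
      have := ((fderiv ℝ g x p).le_opNorm₂ q r)
      rw [Real.norm_eq_abs] at this
      refine this.trans ?_
      gcongr
      refine ((fderiv ℝ g x).le_opNorm p).trans ?_
      gcongr
    have t3 : ∀ c, ‖fderiv ℝ V x c‖ ≤ ‖fderiv ℝ V x‖ * ‖c‖ := fun c => (fderiv ℝ V x).le_opNorm c
    have u1 : |fderiv ℝ g x (fderiv ℝ V x w) a b| ≤ C * (‖fderiv ℝ V x‖ * ‖w‖) * ‖a‖ * ‖b‖ := by
      refine (t2 _ _ _).trans ?_
      gcongr; exact t3 w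
    have u2 : |fderiv ℝ g x w (fderiv ℝ V x a) b| ≤ C * ‖w‖ * (‖fderiv ℝ V x‖ * ‖a‖) * ‖b‖ := by
      refine (t2 _ _ _).trans ?_
      gcongr; exact t3 a
    have u3 : |fderiv ℝ g x w a (fderiv ℝ V x b)| ≤ C * ‖w‖ * ‖a‖ * (‖fderiv ℝ V x‖ * ‖b‖) := by
      refine (t2 _ _ _).trans ?_
      gcongr; exact t3 b
    have hP : 0 ≤ C * ‖V x‖ * (‖w‖ * ‖a‖ * ‖b‖) := by positivity
    rw [hR]
    simp only [abs_neg]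
    refine (abs_add_le _ _).trans ((add_le_add_left ((abs_add_le _ _).trans
      (add_le_add_left (abs_add_le _ _) _)) _).trans ?_)
    rw [hN]
    nlinarith
  -- The cyclic permutation trick for Christoffel symbols. The trilinear form `g (D²V w a, b)` is
  -- symmetric in `w`, `a`, and differentiating Killing's equation gives `R w a b` as its
  -- symmetrisation in `a`, `b`.
  have hS : ∀ w a b, 2 * g x (fderiv ℝ (fderiv ℝ V) x w a) b = R w a b - R b w a + R a b w := by
    have hsym : ∀ w a, fderiv ℝ (fderiv ℝ V) x w a = fderiv ℝ (fderiv ℝ V) x a w := fun w a =>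
      (hV.contDiffAt hg hx).isSymmSndFDerivAt minSmoothness_two_le_infty w a
    intro w a b
    have k1 := hV.deriv_killing hg hx w a b
    have k2 := hV.deriv_killing hg hx b w a
    have k3 := hV.deriv_killing hg hx a b w
    rw [hsym b a, hg.symm x hx w] at k2
    rw [hsym a w, hg.symm x hx b] at k3
    rw [hg.symm x hx a, hsym w b] at k1
    simp only [hR]
    linarith
  refine ContinuousLinearMap.opNorm_le_bound₂ _ (by positivity) fun w a => ?_
  set b := fderiv ℝ (fderiv ℝ V) x w a with hb
  by_cases hb0 : b = 0
  · rw [hb0, norm_zero]; positivity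
  have hbn : 0 < ‖b‖ := norm_pos_iff.2 hb0
  have e1 := hmx b
  have e2 := hS w a b
  rw [← hb] at e2
  have e3 := (abs_le.1 (hRb w a b)).2
  have e4 := (abs_le.1 (hRb b w a)).1
  have e5 := (abs_le.1 (hRb a b w)).2
  have e6 : m * ‖b‖ ^ 2 ≤ 9 / 2 * C * N * (‖w‖ * ‖a‖) * ‖b‖ := by nlinarith
  have e7 : m * ‖b‖ ≤ 9 / 2 * C * N * (‖w‖ * ‖a‖) := by
    refine le_of_mul_le_mul_right ?_ hbn
    calc m * ‖b‖ * ‖b‖ = m * ‖b‖ ^ 2 := by ring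
      _ ≤ _ := e6
  calc ‖b‖ = (m * ‖b‖) / m := by field_simp
    _ ≤ (9 / 2 * C * N * (‖w‖ * ‖a‖)) / m := by gcongr
    _ = 9 / 2 * C / m * N * ‖w‖ * ‖a‖ := by ring

/-- A Killing field whose `1`-jet vanishes at a point vanishes near that point. -/
theorem KillingFieldOn.eventually_eq_zero [FiniteDimensional ℝ E] (hg : SmoothMetricOn g U)
    (hV : KillingFieldOn g V U) {x₀ : E} (hx₀ : x₀ ∈ U) (h0 : V x₀ = 0)
    (h1 : fderiv ℝ V x₀ = 0) : ∀ᶠ x in 𝓝 x₀, V x = 0 := by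
  obtain ⟨K, hK, hKe⟩ := hV.norm_fderiv_fderiv_le hg hx₀
  obtain ⟨r, hr, hball⟩ := Metric.eventually_nhds_iff_ball.1
    (hKe.and (hg.isOpen.mem_nhds hx₀))
  refine Metric.eventually_nhds_iff_ball.2 ⟨r, hr, fun x hx => ?_⟩
  set w := x - x₀ with hw
  let γ : ℝ → E := fun t => x₀ + t • w
  have hγ : ∀ t, HasDerivAt γ w t := fun t => by
    have := ((hasDerivAt_id t).smul_const w).const_add x₀
    rw [one_smul] at this
    exact this
  have hmem : ∀ t ∈ Icc (0:ℝ) 1, γ t ∈ Metric.ball x₀ r := by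
    intro t ht
    rw [Metric.mem_ball, dist_eq_norm, add_sub_cancel_left, norm_smul, Real.norm_eq_abs,
      abs_of_nonneg ht.1]
    rw [Metric.mem_ball, dist_eq_norm] at hx
    exact lt_of_le_of_lt (mul_le_of_le_one_left (norm_nonneg _) ht.2) hx
  -- Along the segment to `x` the 1-jet satisfies `‖z'‖ ≤ const * ‖z‖` with `z 0 = 0`, so Grönwall's
  -- inequality makes it vanish.
  let z : ℝ → E × (E →L[ℝ] E) := fun t => (V (γ t), fderiv ℝ V (γ t))
  let z' : ℝ → E × (E →L[ℝ] E) := fun t =>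
    (fderiv ℝ V (γ t) w, fderiv ℝ (fderiv ℝ V) (γ t) w)
  have hz : ∀ t ∈ Icc (0:ℝ) 1, HasDerivAt z (z' t) t := by
    intro t ht
    have hU := (hball _ (hmem t ht)).2
    have hV2 : HasFDerivAt (fderiv ℝ V) (fderiv ℝ (fderiv ℝ V) (γ t)) (γ t) :=
      ((hV.contDiffAt_fderiv hg hU).differentiableAt (by simp)).hasFDerivAt
    exact ((hV.hasFDerivAt hg hU).comp_hasDerivAt t (hγ t)).prodMk
      (hV2.comp_hasDerivAt t (hγ t))
  have hz0 : z 0 = 0 := by simp [z, γ, h0, h1]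
  have hbound : ∀ t ∈ Ico (0:ℝ) 1, ‖z' t‖ ≤ ((1 + 2 * K) * ‖w‖) * ‖z t‖ := by
    intro t ht
    have hk := (hball _ (hmem t ⟨ht.1, ht.2.le⟩)).1
    have n1 : ‖V (γ t)‖ ≤ ‖z t‖ := norm_fst_le (z t)
    have n2 : ‖fderiv ℝ V (γ t)‖ ≤ ‖z t‖ := norm_snd_le (z t)
    rw [Prod.norm_def, max_le_iff]
    constructor
    · refine ((fderiv ℝ V (γ t)).le_opNorm w).trans ?_
      have : 0 ≤ K * ‖w‖ * ‖z t‖ := by positivity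
      have : ‖fderiv ℝ V (γ t)‖ * ‖w‖ ≤ ‖z t‖ * ‖w‖ := by gcongr
      nlinarith
    · refine ((fderiv ℝ (fderiv ℝ V) (γ t)).le_opNorm w).trans ?_
      have h3 : ‖fderiv ℝ (fderiv ℝ V) (γ t)‖ ≤ K * (‖z t‖ + ‖z t‖) := hk.trans (by gcongr)
      have : ‖fderiv ℝ (fderiv ℝ V) (γ t)‖ * ‖w‖ ≤ K * (‖z t‖ + ‖z t‖) * ‖w‖ := by gcongr
      have : 0 ≤ ‖w‖ * ‖z t‖ := by positivity
      nlinarith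
  have := eq_zero_of_abs_deriv_le_mul_abs_self_of_eq_zero_right
    (f := z) (f' := z') (a := 0) (b := 1)
    (fun t ht => (hz t ht).continuousAt.continuousWithinAt)
    (fun t ht => (hz t ⟨ht.1, ht.2.le⟩).hasDerivWithinAt) hz0 hbound 1 (by simp)
  have h2 := congrArg Prod.fst this
  simpa [z, γ, hw] using h2

/-- The zeros of a Killing field of a surface are isolated, unless its `1`-jet vanishes. -/
theorem KillingFieldOn.eventually_ne_zero [FiniteDimensional ℝ E] (hg : SmoothMetricOn g U)
    (hV : KillingFieldOn g V U) (hE : Module.finrank ℝ E = 2) {x : E} (hx : x ∈ U)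
    (h : V x = 0 → fderiv ℝ V x ≠ 0) : ∀ᶠ y in 𝓝[≠] x, V y ≠ 0 := by
  by_cases hVx : V x = 0
  swap
  · exact ((hV.contDiffAt hg hx).continuousAt.eventually_ne hVx).filter_mono nhdsWithin_le_nhds
  -- At a zero the derivative is injective, being a nonzero multiple of a quarter turn. Hence it is
  -- antilipschitz, and `V` cannot vanish again nearby.
  have hinj : LinearMap.ker (fderiv ℝ V x : E →ₗ[ℝ] E) = ⊥ := by
    rw [LinearMap.ker_eq_bot']
    intro a ha
    by_contra ha0
    have hp := hg.pos x hx a ha0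
    have hs : √(g x a a) ≠ 0 := (Real.sqrt_pos.2 hp).ne'
    obtain ⟨l, hl, h1, -⟩ := hV.fderiv_fderiv_eq hg hE hx hVx (h hVx)
      (a := (√(g x a a))⁻¹ • a) (by
        simp only [map_smul, smul_apply, smul_eq_mul]
        field_simp
        rw [Real.sq_sqrt hp.le])
    have ha' : fderiv ℝ V x a = 0 := ha
    rw [map_smul, ha', smul_zero, map_zero] at h1
    have : 0 < l ^ 2 := by positivity
    rw [← h1] at this
    exact lt_irrefl _ this
  obtain ⟨K, hK, hK'⟩ := LinearMap.exists_antilipschitzWith _ hinj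
  have := (hV.hasFDerivAt hg hx).eventually_ne (c := 0) ⟨K, hK'⟩
  exact this

end Rigidity

/-! ### Variation of a Killing flow -/

section Variation

variable {E : Type} [NormedAddCommGroup E] [NormedSpace ℝ E]
variable {g : E → E →L[ℝ] E →L[ℝ] ℝ} {V : E → E} {U : Set E}

/-- The variation field of a family of integral curves solves the linearized equation. -/
lemma hasDerivAt_variation {u : ℝ × ℝ → E} {s₀ t₀ : ℝ} (hu : ContDiffAt ℝ ∞ u (s₀, t₀))
    (hV : DifferentiableAt ℝ V (u (s₀, t₀)))
    (h : ∀ᶠ p in 𝓝 (s₀, t₀), HasDerivAt (fun t => u (p.1, t)) (V (u p)) p.2) :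
    HasDerivAt (fun t => deriv (fun s => u (s, t)) s₀)
      (fderiv ℝ V (u (s₀, t₀)) (deriv (fun s => u (s, t₀)) s₀)) t₀ := by
  have hev : ∀ᶠ p in 𝓝 (s₀, t₀), DifferentiableAt ℝ u p := by
    have := (hu.of_le (m := 1) (by simp)).eventually (by simp)
    filter_upwards [this] with p hp using hp.differentiableAt (by simp)
  have h1 : ∀ p : ℝ × ℝ, DifferentiableAt ℝ u p →
      HasDerivAt (fun s => u (s, p.2)) (fderiv ℝ u p (1, 0)) p.1 := fun p hp =>
    HasFDerivAt.comp_hasDerivAt (f := fun s : ℝ => (s, p.2)) p.1 hp.hasFDerivAt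
      ((hasDerivAt_id p.1).prodMk (hasDerivAt_const p.1 p.2))
  have h2 : ∀ p : ℝ × ℝ, DifferentiableAt ℝ u p →
      HasDerivAt (fun t => u (p.1, t)) (fderiv ℝ u p (0, 1)) p.2 := fun p hp =>
    HasFDerivAt.comp_hasDerivAt (f := fun t : ℝ => (p.1, t)) p.2 hp.hasFDerivAt
      ((hasDerivAt_const p.2 p.1).prodMk (hasDerivAt_id p.2))
  have hF : HasFDerivAt (fderiv ℝ u) (fderiv ℝ (fderiv ℝ u) (s₀, t₀)) (s₀, t₀) :=
    ((hu.fderiv_right (m := ∞) (by simp)).differentiableAt (by simp)).hasFDerivAt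
  have hev' := hev.self_of_nhds
  have hct : Filter.Tendsto (fun t : ℝ => (s₀, t)) (𝓝 t₀) (𝓝 (s₀, t₀)) :=
    (Continuous.prodMk_right s₀).tendsto t₀
  have e1 : (fun t => deriv (fun s => u (s, t)) s₀) =ᶠ[𝓝 t₀] fun t => fderiv ℝ u (s₀, t) (1, 0) := by
    filter_upwards [hct.eventually hev] with t ht using (h1 (s₀, t) ht).deriv
  have e2 : HasDerivAt (fun t => fderiv ℝ u (s₀, t) (1, 0))
      (fderiv ℝ (fderiv ℝ u) (s₀, t₀) (0, 1) (1, 0)) t₀ := by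
    have := hF.comp_hasDerivAt t₀ (f := fun t : ℝ => (s₀, t))
      ((hasDerivAt_const t₀ s₀).prodMk (hasDerivAt_id t₀))
    simpa using this.clm_apply (hasDerivAt_const t₀ ((1:ℝ), (0:ℝ)))
  have e3 : (fun p => fderiv ℝ u p (0, 1)) =ᶠ[𝓝 (s₀, t₀)] fun p => V (u p) := by
    filter_upwards [hev, h] with p hp hp' using (h2 p hp).unique hp'
  -- Differentiating `∂ₜu = V(u)` in `s` computes one mixed partial; symmetry of the second
  -- derivative turns it into the time derivative of the variation field.
  have e4 : fderiv ℝ (fderiv ℝ u) (s₀, t₀) (1, 0) (0, 1) =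
      fderiv ℝ V (u (s₀, t₀)) (fderiv ℝ u (s₀, t₀) (1, 0)) := by
    have k1 := (hF.clm_apply (hasFDerivAt_const ((0:ℝ), (1:ℝ)) (s₀, t₀))).congr_of_eventuallyEq
      e3.symm
    have k2 := hV.hasFDerivAt.comp (s₀, t₀) hev'.hasFDerivAt
    simpa using DFunLike.congr_fun (k1.unique k2) (1, 0)
  rw [(h1 (s₀, t₀) hev').deriv, ← e4, hu.isSymmSndFDerivAt minSmoothness_two_le_infty (1, 0) (0, 1)]
  exact e2.congr_of_eventuallyEq e1

/-- A Killing flow preserves lengths. -/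
lemma KillingFieldOn.hasDerivAt_variation_self (hg : SmoothMetricOn g U)
    (hV : KillingFieldOn g V U) {u J : ℝ → E} {t : ℝ} (hx : u t ∈ U)
    (hu : HasDerivAt u (V (u t)) t) (hJ : HasDerivAt J (fderiv ℝ V (u t) (J t)) t) :
    HasDerivAt (fun t => g (u t) (J t) (J t)) 0 t :=
  (HasDerivAt.bilinear (hg.hasFDerivAt hx) hu hJ hJ).congr_deriv (hV.killing _ hx _ _)

/-- A Killing flow preserves the inner product with the Killing field. -/
lemma KillingFieldOn.hasDerivAt_variation_field (hg : SmoothMetricOn g U)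
    (hV : KillingFieldOn g V U) {u J : ℝ → E} {t : ℝ} (hx : u t ∈ U)
    (hu : HasDerivAt u (V (u t)) t) (hJ : HasDerivAt J (fderiv ℝ V (u t) (J t)) t) :
    HasDerivAt (fun t => g (u t) (J t) (V (u t))) 0 t :=
  (HasDerivAt.bilinear (hg.hasFDerivAt hx) hu hJ
    ((hV.hasFDerivAt hg hx).comp_hasDerivAt t hu)).congr_deriv (hV.killing _ hx _ _)

end Variation

/-! ### The closed one-form of a Killing field in the plane -/

section Hamiltonian

local notation "E₂" => EuclideanSpace ℝ (Fin 2)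

variable {g : E₂ → E₂ →L[ℝ] E₂ →L[ℝ] ℝ} {V : E₂ → E₂} {U : Set E₂}

/-- The first standard basis vector of the plane. -/
noncomputable def planeBasisZero : E₂ := EuclideanSpace.single 0 1

/-- The second standard basis vector of the plane. -/
noncomputable def planeBasisOne : E₂ := EuclideanSpace.single 1 1

lemma plane_eq (a : E₂) : a = a 0 • planeBasisZero + a 1 • planeBasisOne := by
  ext i
  fin_cases i <;> simp [planeBasisZero, planeBasisOne]

/-- The Gram determinant of a metric with respect to the standard basis. -/
noncomputable def gramDet (g : E₂ → E₂ →L[ℝ] E₂ →L[ℝ] ℝ) (x : E₂) : ℝ :=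
  g x planeBasisZero planeBasisZero * g x planeBasisOne planeBasisOne -
    g x planeBasisZero planeBasisOne ^ 2

lemma SmoothMetricOn.gramDet_pos (hg : SmoothMetricOn g U) {x : E₂} (hx : x ∈ U) :
    0 < gramDet g x := by
  set e := planeBasisZero
  set f := planeBasisOne
  have hf : f ≠ 0 := fun h => by simpa [f, planeBasisOne] using congrArg (fun v : E₂ => v 1) h
  have hff := hg.pos x hx f hf
  set a := g x f f • e - g x e f • f with ha
  have ha0 : a ≠ 0 := fun h => by
    have := congrArg (fun v : E₂ => v 0) h
    simp [ha, e, f, planeBasisOne, planeBasisZero] at this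
    exact hf (hg.eq_zero hx this)
  have h := hg.pos x hx a ha0
  have h2 : g x a a = g x f f * gramDet g x := by
    simp only [ha, gramDet, map_sub, map_smul, sub_apply, smul_apply, smul_eq_mul,
      hg.symm x hx f e]
    ring
  rw [h2] at h
  exact (pos_iff_pos_of_mul_pos h).1 hff

/-- The contraction of the area form with the vector field `V`. -/
noncomputable def areaContraction (g : E₂ → E₂ →L[ℝ] E₂ →L[ℝ] ℝ) (V : E₂ → E₂) (x : E₂) :
    E₂ →L[ℝ] ℝ :=
  √(gramDet g x) • (V x 0 • EuclideanSpace.proj 1 - V x 1 • EuclideanSpace.proj 0)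

/-- Lagrange's identity: the squared area spanned by `V x` and `w` is their Gram determinant. The
square does not see the orientation, so this form of the identity passes between charts without a
choice of signs. -/
lemma SmoothMetricOn.areaContraction_sq (hg : SmoothMetricOn g U) {x : E₂} (hx : x ∈ U) (w : E₂) :
    areaContraction g V x w ^ 2 = g x (V x) (V x) * g x w w - g x (V x) w ^ 2 := by
  have h1 : areaContraction g V x w ^ 2 = gramDet g x * (V x 0 * w 1 - V x 1 * w 0) ^ 2 := by
    simp only [areaContraction, smul_apply, sub_apply, smul_eq_mul,
      mul_pow, Real.sq_sqrt (hg.gramDet_pos hx).le]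
    rfl
  have h2 := hg.symm x hx planeBasisOne planeBasisZero
  have h3 : ∀ a b : E₂, g x a b = a 0 * b 0 * g x planeBasisZero planeBasisZero +
      (a 0 * b 1 + a 1 * b 0) * g x planeBasisZero planeBasisOne +
      a 1 * b 1 * g x planeBasisOne planeBasisOne := by
    intro a b
    conv_lhs => rw [plane_eq a, plane_eq b]
    simp only [map_add, map_smul, add_apply, smul_apply, smul_eq_mul, h2]
    ring
  rw [h1, h3 (V x) (V x), h3 w w, h3 (V x) w, gramDet]
  ring

lemma SmoothMetricOn.contDiffAt_sqrt_gramDet (hg : SmoothMetricOn g U) {x : E₂} (hx : x ∈ U) :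
    ContDiffAt ℝ ∞ (fun y => √(gramDet g y)) x := by
  refine ContDiffAt.sqrt ?_ (hg.gramDet_pos hx).ne'
  have h : ∀ a b, ContDiffAt ℝ ∞ (fun y => g y a b) x := fun a b =>
    ((hg.contDiffAt hx).clm_apply contDiffAt_const).clm_apply contDiffAt_const
  exact ((h _ _).mul (h _ _)).sub ((h _ _).pow 2)

lemma KillingFieldOn.contDiffAt_areaContraction (hg : SmoothMetricOn g U)
    (hV : KillingFieldOn g V U) {x : E₂} (hx : x ∈ U) :
    ContDiffAt ℝ ∞ (areaContraction g V) x := by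
  have h : ∀ i, ContDiffAt ℝ ∞ (fun y => V y i) x := fun i =>
    (EuclideanSpace.proj (𝕜 := ℝ) i).contDiff.contDiffAt.comp x (hV.contDiffAt hg hx)
  exact (hg.contDiffAt_sqrt_gramDet hx).smul
    (((h 0).smul contDiffAt_const).sub ((h 1).smul contDiffAt_const))

/-- A Killing field preserves the area. -/
lemma KillingFieldOn.fderiv_sqrt_gramDet (hg : SmoothMetricOn g U) (hV : KillingFieldOn g V U)
    {x : E₂} (hx : x ∈ U) :
    fderiv ℝ (fun y => √(gramDet g y)) x (V x) + √(gramDet g x) *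
      (fderiv ℝ V x planeBasisZero 0 + fderiv ℝ V x planeBasisOne 1) = 0 := by
  set e := planeBasisZero
  set f := planeBasisOne
  have hS := ((hg.contDiffAt_sqrt_gramDet hx).differentiableAt (by simp)).hasFDerivAt
  have hpos := Real.sqrt_pos.2 (hg.gramDet_pos hx)
  have hc : ∀ c : E₂, HasFDerivAt (fun _ : E₂ => c) (0 : E₂ →L[ℝ] E₂) x := fun c =>
    hasFDerivAt_const c x
  have hd : ∀ a b, HasFDerivAt (fun y => g y a b) _ x := fun a b =>
    ((hg.hasFDerivAt hx).clm_apply (hc a)).clm_apply (hc b)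
  have hG := ((hd e e).mul (hd f f)).sub ((hd e f).pow 2)
  -- The derivative of the root is extracted by differentiating `√G * √G = G`; the factor `2 * √G`
  -- is cancelled at the end.
  have hS2 := hS.mul hS
  have heq : (fun y => √(gramDet g y)) * (fun y => √(gramDet g y)) =ᶠ[𝓝 x]
      (fun y => g y e e) * (fun y => g y f f) - (fun y => g y e f) ^ 2 := by
    filter_upwards [hg.isOpen.mem_nhds hx] with y hy
    exact Real.mul_self_sqrt (hg.gramDet_pos hy).le
  have h1 := DFunLike.congr_fun ((hS2.congr_of_eventuallyEq heq.symm).unique hG) (V x)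
  simp at h1
  have k1 := hV.killing x hx e e
  have k2 := hV.killing x hx f f
  have k3 := hV.killing x hx e f
  have hsym := hg.symm x hx f e
  rw [plane_eq (fderiv ℝ V x e)] at k1 k3
  rw [plane_eq (fderiv ℝ V x f)] at k2 k3
  change _ + g x (_ • e + _ • f) _ + _ = 0 at k1
  change _ + g x e (_ • e + _ • f) = 0 at k1
  change _ + g x (_ • e + _ • f) _ + g x _ (_ • e + _ • f) = 0 at k2
  change _ + g x (_ • e + _ • f) _ + g x _ (_ • e + _ • f) = 0 at k3
  simp only [map_add, map_smul, add_apply, smul_apply, smul_eq_mul, hsym] at k1 k2 k3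
  have hsq : √(gramDet g x) * √(gramDet g x) = g x e e * g x f f - g x e f ^ 2 :=
    Real.mul_self_sqrt (hg.gramDet_pos hx).le
  apply (mul_eq_zero.1 (?_ : (2 * √(gramDet g x)) * _ = 0)).resolve_left (by positivity)
  linear_combination h1 + 2 * (fderiv ℝ V x e 0 + fderiv ℝ V x f 1) * hsq +
    g x f f * k1 + g x e e * k2 - 2 * g x e f * k3

/-- The contraction of the area form with a Killing field is closed. -/
lemma KillingFieldOn.fderiv_areaContraction_symm (hg : SmoothMetricOn g U)
    (hV : KillingFieldOn g V U) {x : E₂} (hx : x ∈ U) (a b : E₂) :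
    fderiv ℝ (areaContraction g V) x a b = fderiv ℝ (areaContraction g V) x b a := by
  have hS := ((hg.contDiffAt_sqrt_gramDet hx).differentiableAt (by simp)).hasFDerivAt
  have hVi : ∀ i, HasFDerivAt (fun y => V y i)
      ((EuclideanSpace.proj (𝕜 := ℝ) i).comp (fderiv ℝ V x)) x := fun i =>
    (EuclideanSpace.proj (𝕜 := ℝ) i).hasFDerivAt.comp x (hV.hasFDerivAt hg hx)
  have hω : ∀ c d : E₂, fderiv ℝ (areaContraction g V) x c d =
      fderiv ℝ (fun y => √(gramDet g y)) x c * (V x 0 * d 1 - V x 1 * d 0) +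
        √(gramDet g x) * (fderiv ℝ V x c 0 * d 1 - fderiv ℝ V x c 1 * d 0) := by
    intro c d
    have h1 := ((hV.contDiffAt_areaContraction hg hx).differentiableAt (by simp)).hasFDerivAt
    have h2 := h1.clm_apply (hasFDerivAt_const d x)
    have h3 := hS.mul (((hVi 0).mul_const (d 1)).sub ((hVi 1).mul_const (d 0)))
    have h4 : (fun y => areaContraction g V y d) = (fun y => √(gramDet g y)) *
        ((fun y => V y 0 * d 1) - fun y => V y 1 * d 0) := by
      funext y
      simp [areaContraction]
    rw [h4] at h2
    have h5 := DFunLike.congr_fun (h2.unique h3) c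
    simp at h5
    linarith
  have hdiv := hV.fderiv_sqrt_gramDet hg hx
  rw [hω a b, hω b a]
  set S := fderiv ℝ (fun y => √(gramDet g y)) x
  have ea : ∀ c, S c = c 0 * S planeBasisZero + c 1 * S planeBasisOne := by
    intro c
    conv_lhs => rw [plane_eq c]
    simp
  have eb : ∀ c i, fderiv ℝ V x c i =
      c 0 * fderiv ℝ V x planeBasisZero i + c 1 * fderiv ℝ V x planeBasisOne i := by
    intro c i
    conv_lhs => rw [plane_eq c]
    simp
  rw [ea (V x)] at hdiv
  rw [ea a, ea b, eb a, eb b, eb a, eb b]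
  -- Cartan's formula in coordinates: the exterior derivative of the contraction is the coordinate
  -- area of `a`, `b` times the divergence expression, which `hdiv` makes vanish.
  linear_combination (a 0 * b 1 - a 1 * b 0) * hdiv

/-- On a convex set, a Killing field has a Hamiltonian function. -/
theorem KillingFieldOn.exists_hamiltonian (hg : SmoothMetricOn g U) (hV : KillingFieldOn g V U)
    {s : Set E₂} (hs : Convex ℝ s) (hso : IsOpen s) (hsU : s ⊆ U) :
    ∃ f : E₂ → ℝ, ContDiffOn ℝ ∞ f s ∧ ∀ x ∈ s, ∀ w,
      fderiv ℝ f x w ^ 2 = g x (V x) (V x) * g x w w - g x (V x) w ^ 2 := by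
  have hsm : ContDiffOn ℝ ∞ (areaContraction g V) s := fun x hx =>
    (hV.contDiffAt_areaContraction hg (hsU hx)).contDiffWithinAt
  obtain ⟨f, hf⟩ := hs.exists_forall_hasFDerivAt_of_fderiv_symmetric hso
    (hsm.differentiableOn (by simp))
    fun x hx a b => hV.fderiv_areaContraction_symm hg (hsU hx) a b
  refine ⟨f, ?_, fun x hx w => ?_⟩
  · rw [contDiffOn_infty_iff_fderiv_of_isOpen hso]
    exact ⟨fun x hx => (hf x hx).differentiableAt.differentiableWithinAt,
      hsm.congr fun x hx => (hf x hx).fderiv⟩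
  · rw [(hf x hx).fderiv, hg.areaContraction_sq (hsU hx)]

end Hamiltonian

/-! ### Gluing local properties over rectangles and over the sphere -/

section Gluing

/-- A property of open sets that passes to open subsets, holds locally, and passes to unions of two
sets with connected intersection. -/
structure IsGluable {X : Type*} [TopologicalSpace X] (P : Set X → Prop) : Prop where
  mono : ∀ U V, IsOpen U → IsOpen V → U ⊆ V → P V → P U
  locally_holds : ∀ x, ∃ U, IsOpen U ∧ x ∈ U ∧ P U
  glue : ∀ U V, IsOpen U → IsOpen V → IsPreconnected (U ∩ V) → P U → P V → P (U ∪ V)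

/-- Gluing along a line: a property of open intervals that is hereditary, local and can be glued
holds for all open intervals. -/
lemma holds_of_interval_glue {Q : ℝ → ℝ → Prop}
    (hmono : ∀ a b a' b', a ≤ a' → b' ≤ b → Q a b → Q a' b')
    (hloc : ∀ x, ∃ δ > 0, Q (x - δ) (x + δ))
    (hglue : ∀ a b c d, a < c → c < b → b < d → Q a b → Q c d → Q a d) (a b : ℝ) : Q a b := by
  rcases lt_or_ge a b with hab | hab
  swap
  · obtain ⟨δ, hδ, h⟩ := hloc a
    exact hmono _ _ _ _ (by linarith) (by linarith) h
  by_contra hQ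
  -- If `Q a b` failed, the right ends reachable from `a` would be bounded by `b`. The interval
  -- around their supremum on which `Q` holds then reaches strictly further, after gluing if
  -- necessary.
  let S : Set ℝ := {t | a < t ∧ Q a t}
  have hne : S.Nonempty := by
    obtain ⟨δ, hδ, h⟩ := hloc a
    exact ⟨a + δ, by linarith, hmono _ _ _ _ (by linarith) le_rfl h⟩
  have hbdd : ∀ t ∈ S, t ≤ b := fun t ht => by
    by_contra! h
    exact hQ (hmono _ _ _ _ le_rfl h.le ht.2)
  obtain ⟨δ, hδ, hs⟩ := hloc (sSup S)
  obtain ⟨t, ht, hlt⟩ := exists_lt_of_lt_csSup hne (show sSup S - δ < sSup S by linarith)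
  have hle := le_csSup ⟨b, hbdd⟩ ht
  have hmem : sSup S + δ ∈ S := by
    refine ⟨by linarith [ht.1], ?_⟩
    rcases lt_or_ge a (sSup S - δ) with h | h
    · exact hglue a t (sSup S - δ) (sSup S + δ) h hlt (by linarith) ht.2 hs
    · exact hmono _ _ _ _ h le_rfl hs
  linarith [le_csSup ⟨b, hbdd⟩ hmem]

namespace IsGluable

/-- A gluable property of open subsets of the plane holds for open rectangles. -/
lemma rectangle {P : Set (ℝ × ℝ) → Prop} (h : IsGluable P) (a b c d : ℝ) :
    P (Ioo a b ×ˢ Ioo c d) := by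
  have ho : ∀ a b c d : ℝ, IsOpen (Ioo a b ×ˢ Ioo c d) := fun a b c d => isOpen_Ioo.prod isOpen_Ioo
  have hsub : ∀ {a b c d a' b' c' d' : ℝ}, a ≤ a' → b' ≤ b → c ≤ c' → d' ≤ d →
      P (Ioo a b ×ˢ Ioo c d) → P (Ioo a' b' ×ˢ Ioo c' d') := fun h1 h2 h3 h4 hP =>
    h.mono _ _ (ho _ _ _ _) (ho _ _ _ _) (prod_mono (Ioo_subset_Ioo h1 h2) (Ioo_subset_Ioo h3 h4)) hP
  refine holds_of_interval_glue (Q := fun a b => P (Ioo a b ×ˢ Ioo c d))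
    (fun a b a' b' h1 h2 hP => hsub h1 h2 le_rfl le_rfl hP) (fun x => ?_) ?_ a b
  -- First build a strip of height `Ioo c d` around the line over `x`, whose width may shrink at
  -- each gluing; then glue such strips sideways. All overlaps are rectangles, hence connected.
  · refine holds_of_interval_glue (Q := fun c d => ∃ δ > 0, P (Ioo (x - δ) (x + δ) ×ˢ Ioo c d))
      ?_ ?_ ?_ c d
    · rintro c d c' d' h1 h2 ⟨δ, hδ, hP⟩
      exact ⟨δ, hδ, hsub le_rfl le_rfl h1 h2 hP⟩
    · intro y
      obtain ⟨U, hU, hxU, hP⟩ := h.locally_holds (x, y)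
      obtain ⟨δ, hδ, hball⟩ := Metric.isOpen_iff.1 hU _ hxU
      refine ⟨δ, hδ, δ, hδ, h.mono _ _ (ho _ _ _ _) hU (fun p hp => hball ?_) hP⟩
      rw [← ball_prod_same, Real.ball_eq_Ioo, Real.ball_eq_Ioo]
      exact hp
    · rintro c d c' d' h1 h2 h3 ⟨δ₁, hδ₁, hP₁⟩ ⟨δ₂, hδ₂, hP₂⟩
      refine ⟨min δ₁ δ₂, lt_min hδ₁ hδ₂, ?_⟩
      have e1 := min_le_left δ₁ δ₂
      have e2 := min_le_right δ₁ δ₂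
      set δ := min δ₁ δ₂
      have q1 : P (Ioo (x - δ) (x + δ) ×ˢ Ioo c d) :=
        hsub (by linarith) (by linarith) le_rfl le_rfl hP₁
      have q2 : P (Ioo (x - δ) (x + δ) ×ˢ Ioo c' d') :=
        hsub (by linarith) (by linarith) le_rfl le_rfl hP₂
      have hun : Ioo (x - δ) (x + δ) ×ˢ Ioo c d' =
          Ioo (x - δ) (x + δ) ×ˢ Ioo c d ∪ Ioo (x - δ) (x + δ) ×ˢ Ioo c' d' := by
        rw [← prod_union, Ioo_union_Ioo' h2 (by linarith), min_eq_left h1.le, max_eq_right h3.le]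
      rw [hun]
      refine h.glue _ _ (ho _ _ _ _) (ho _ _ _ _) ?_ q1 q2
      rw [prod_inter_prod]
      simp only [Ioo_inter_Ioo]
      exact isPreconnected_Ioo.prod isPreconnected_Ioo
  · intro a b a' b' h1 h2 h3 q1 q2
    have hun : Ioo a b' ×ˢ Ioo c d = Ioo a b ×ˢ Ioo c d ∪ Ioo a' b' ×ˢ Ioo c d := by
      rw [← union_prod, Ioo_union_Ioo' h2 (by linarith), min_eq_left h1.le, max_eq_right h3.le]
    rw [hun]
    refine h.glue _ _ (ho _ _ _ _) (ho _ _ _ _) ?_ q1 q2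
    rw [prod_inter_prod]
    simp only [Ioo_inter_Ioo]
    exact isPreconnected_Ioo.prod isPreconnected_Ioo

lemma homeomorph {X Y : Type*} [TopologicalSpace X] [TopologicalSpace Y] {P : Set X → Prop}
    (h : IsGluable P) (e : X ≃ₜ Y) : IsGluable fun U : Set Y => P (e ⁻¹' U) where
  mono U V hU hV hUV hP := h.mono _ _ (hU.preimage e.continuous) (hV.preimage e.continuous)
    (preimage_mono hUV) hP
  locally_holds y := by
    obtain ⟨U, hU, hy, hP⟩ := h.locally_holds (e.symm y)
    refine ⟨e.symm ⁻¹' U, hU.preimage e.symm.continuous, hy, ?_⟩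
    rwa [← preimage_comp, e.symm_comp_self, preimage_id]
  glue U V hU hV hUV hPU hPV := by
    rw [preimage_union]
    refine h.glue _ _ (hU.preimage e.continuous) (hV.preimage e.continuous) ?_ hPU hPV
    rw [← preimage_inter, ← e.image_symm]
    exact hUV.image _ e.symm.continuous.continuousOn

end IsGluable

section Sphere

local notation "𝕊" => Metric.sphere (0 : EuclideanSpace ℝ (Fin 3)) 1

lemma mem_unitSphere_iff (v : EuclideanSpace ℝ (Fin 3)) :
    v ∈ 𝕊 ↔ v 0 ^ 2 + v 1 ^ 2 + v 2 ^ 2 = 1 := by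
  rw [mem_sphere_zero_iff_norm, EuclideanSpace.norm_eq, Real.sqrt_eq_one, Fin.sum_univ_three]
  simp only [Real.norm_eq_abs, sq_abs]

lemma continuous_sphere_coord (i : Fin 3) : Continuous fun s : 𝕊 => (s : EuclideanSpace ℝ (Fin 3)) i :=
  (EuclideanSpace.proj (𝕜 := ℝ) i).continuous.comp continuous_subtype_val

/-- Inverse stereographic projection, from the north or the south pole. -/
noncomputable def invStereo (ε : ℤˣ) (p : ℝ × ℝ) : 𝕊 :=
  ⟨!₂[2 * p.1 / (p.1 ^ 2 + p.2 ^ 2 + 1), 2 * p.2 / (p.1 ^ 2 + p.2 ^ 2 + 1),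
      ((ε : ℤ) : ℝ) * (p.1 ^ 2 + p.2 ^ 2 - 1) / (p.1 ^ 2 + p.2 ^ 2 + 1)], by
    rw [mem_unitSphere_iff]
    have h : p.1 ^ 2 + p.2 ^ 2 + 1 ≠ 0 := by positivity
    have hε : (((ε : ℤ) : ℝ)) ^ 2 = 1 := by exact_mod_cast Int.units_coe_mul_self ε ▸ sq _
    simp
    field_simp
    rw [hε]
    ring⟩

lemma continuous_invStereo (ε : ℤˣ) : Continuous (invStereo ε) := by
  refine Continuous.subtype_mk ((PiLp.continuous_toLp 2 _).comp (continuous_pi fun i => ?_)) _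
  have h : ∀ p : ℝ × ℝ, p.1 ^ 2 + p.2 ^ 2 + 1 ≠ 0 := fun p => by positivity
  fin_cases i <;> simp <;> fun_prop (disch := exact h _)

/-- The open set where stereographic projection takes values in `W`. -/
def stereoPreimage (ε : ℤˣ) (W : Set (ℝ × ℝ)) : Set 𝕊 :=
  {s | ((ε : ℤ) : ℝ) * s.1 2 < 1 ∧
    (s.1 0 / (1 - ((ε : ℤ) : ℝ) * s.1 2), s.1 1 / (1 - ((ε : ℤ) : ℝ) * s.1 2)) ∈ W}

/-- Openness is visible from the defining inequality and quotient, whereas unions and connectedness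
are visible from the image. -/
lemma stereoPreimage_eq_image (ε : ℤˣ) (W : Set (ℝ × ℝ)) :
    stereoPreimage ε W = invStereo ε '' W := by
  have hε : (((ε : ℤ) : ℝ)) ^ 2 = 1 := by exact_mod_cast Int.units_coe_mul_self ε ▸ sq _
  set c : ℝ := ((ε : ℤ) : ℝ) with hc
  ext s
  constructor
  · rintro ⟨h1, h2⟩
    refine ⟨_, h2, ?_⟩
    have hs := (mem_unitSphere_iff s.1).1 s.2
    have h3 : 1 - c * s.1 2 ≠ 0 := by linarith
    have h4 : (s.1 0 / (1 - c * s.1 2)) ^ 2 + (s.1 1 / (1 - c * s.1 2)) ^ 2 =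
        (1 + c * s.1 2) / (1 - c * s.1 2) := by
      field_simp
      linear_combination hs + s.1 2 ^ 2 * hε
    have h5 : (1 + c * s.1 2) / (1 - c * s.1 2) + 1 = 2 / (1 - c * s.1 2) := by
      field_simp; ring
    have h6 : (1 + c * s.1 2) / (1 - c * s.1 2) - 1 = 2 * c * s.1 2 / (1 - c * s.1 2) := by
      field_simp; ring
    apply Subtype.ext
    ext i
    fin_cases i
    · simp [invStereo, ← hc, h4, h5]; field_simp
    · simp [invStereo, ← hc, h4, h5]; field_simp
    · simp [invStereo, h4, h5, h6, ← hc]; field_simp; rw [hε, one_mul]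
  · rintro ⟨p, hp, rfl⟩
    have h : 0 < p.1 ^ 2 + p.2 ^ 2 + 1 := by positivity
    have h3 : c * (c * (p.1 ^ 2 + p.2 ^ 2 - 1) / (p.1 ^ 2 + p.2 ^ 2 + 1)) =
        1 - 2 / (p.1 ^ 2 + p.2 ^ 2 + 1) := by
      field_simp
      rw [hε]
      ring
    have h4 : 0 < 2 / (p.1 ^ 2 + p.2 ^ 2 + 1) := by positivity
    constructor
    · simp [invStereo, ← hc, h3, h]
    · simp only [invStereo, ← hc]
      convert hp using 1
      ext
      · simp [h3]; field_simp
      · simp [h3]; field_simp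

lemma isOpen_stereoPreimage (ε : ℤˣ) {W : Set (ℝ × ℝ)} (hW : IsOpen W) :
    IsOpen (stereoPreimage ε W) := by
  have h0 := continuous_sphere_coord 0
  have h1 := continuous_sphere_coord 1
  have h2 := continuous_sphere_coord 2
  have hO : IsOpen {s : 𝕊 | ((ε : ℤ) : ℝ) * s.1 2 < 1} :=
    isOpen_lt (continuous_const.mul h2) continuous_const
  have hd : ContinuousOn (fun s : 𝕊 => 1 - ((ε : ℤ) : ℝ) * s.1 2)
      {s : 𝕊 | ((ε : ℤ) : ℝ) * s.1 2 < 1} := (continuous_const.sub (continuous_const.mul h2)).continuousOn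
  have hd0 : ∀ s ∈ {s : 𝕊 | ((ε : ℤ) : ℝ) * s.1 2 < 1}, 1 - ((ε : ℤ) : ℝ) * s.1 2 ≠ 0 :=
    fun s hs => by have : ((ε : ℤ) : ℝ) * s.1 2 < 1 := hs; linarith
  exact ((h0.continuousOn.div hd hd0).prodMk (h1.continuousOn.div hd hd0)).isOpen_inter_preimage hO hW

/-- A gluable property of open subsets of the sphere holds for the sphere. -/
lemma IsGluable.sphere {P : Set 𝕊 → Prop} (h : IsGluable P) : P univ := by
  have hP : ∀ ε, IsGluable fun W => P (stereoPreimage ε W) := fun ε =>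
    { mono := fun U V hU hV hUV hPV => h.mono _ _ (isOpen_stereoPreimage ε hU)
        (isOpen_stereoPreimage ε hV) (fun s hs => ⟨hs.1, hUV hs.2⟩) hPV
      locally_holds := fun p => by
        obtain ⟨U, hU, hpU, hPU⟩ := h.locally_holds (invStereo ε p)
        have hW : IsOpen (invStereo ε ⁻¹' U) := hU.preimage (continuous_invStereo ε)
        refine ⟨_, hW, hpU, h.mono _ _ (isOpen_stereoPreimage ε hW) hU ?_ hPU⟩
        rw [stereoPreimage_eq_image]
        exact image_preimage_subset _ _
      glue := fun U V hU hV hUV hPU hPV => by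
        have e : stereoPreimage ε (U ∪ V) = stereoPreimage ε U ∪ stereoPreimage ε V := by
          simp only [stereoPreimage_eq_image, image_union]
        rw [e]
        refine h.glue _ _ (isOpen_stereoPreimage ε hU) (isOpen_stereoPreimage ε hV) ?_ hPU hPV
        have e' : stereoPreimage ε U ∩ stereoPreimage ε V = stereoPreimage ε (U ∩ V) := by
          ext s
          exact ⟨fun hs => ⟨hs.1.1, hs.1.2, hs.2.2⟩, fun hs => ⟨⟨hs.1, hs.2.1⟩, hs.1, hs.2.2⟩⟩
        rw [e', stereoPreimage_eq_image]
        exact hUV.image _ (continuous_invStereo ε).continuousOn }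
  -- Two overlapping caps cover the sphere. On a cap the denominator exceeds `1 / 2`, so the
  -- stereographic coordinates have absolute value less than `2` and the square of half-width `3`
  -- contains them.
  let C : ℤˣ → Set 𝕊 := fun ε => {s | ((ε : ℤ) : ℝ) * s.1 2 < 1 / 2}
  have hCo : ∀ ε, IsOpen (C ε) := fun ε =>
    isOpen_lt (continuous_const.mul (continuous_sphere_coord 2)) continuous_const
  have hC : ∀ ε, P (C ε) := by
    intro ε
    refine h.mono _ _ (hCo ε) (isOpen_stereoPreimage ε (isOpen_Ioo.prod isOpen_Ioo)) ?_
      ((hP ε).rectangle (-3) 3 (-3) 3)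
    intro s hs
    have hs' : ((ε : ℤ) : ℝ) * s.1 2 < 1 / 2 := hs
    have h1 := (mem_unitSphere_iff s.1).1 s.2
    have hd : (1 : ℝ) / 2 < 1 - ((ε : ℤ) : ℝ) * s.1 2 := by linarith
    have key : ∀ i : Fin 3, s.1 i ^ 2 ≤ 1 → s.1 i / (1 - ((ε : ℤ) : ℝ) * s.1 2) ∈ Ioo (-3 : ℝ) 3 := by
      intro i hi
      have := abs_le.1 ((sq_le_one_iff_abs_le_one _).1 hi)
      constructor
      · rw [lt_div_iff₀ (by linarith)]; linarith
      · rw [div_lt_iff₀ (by linarith)]; linarith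
    exact ⟨by linarith, key 0 (by nlinarith), key 1 (by nlinarith)⟩
  have hun : C 1 ∪ C (-1) = univ := by
    ext s
    simp only [C, mem_union, mem_ofPred_eq, mem_univ, iff_true]
    push_cast
    by_contra! hs
    linarith
  rw [← hun]
  refine h.glue _ _ (hCo _) (hCo _) ?_ (hC 1) (hC (-1))
  -- The caps meet in an equatorial band, whose connectedness follows from cylindrical coordinates
  -- with the angle ranging over the whole line.
  have hmem : ∀ p : ℝ × Icc (-(1:ℝ) / 2) (1 / 2), !₂[√(1 - (p.2 : ℝ) ^ 2) * Real.cos p.1,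
      √(1 - (p.2 : ℝ) ^ 2) * Real.sin p.1, (p.2 : ℝ)] ∈ 𝕊 := by
    rintro ⟨θ, z, hz⟩
    rw [mem_unitSphere_iff]
    have hz2 : 0 ≤ 1 - z ^ 2 := by nlinarith [hz.1, hz.2]
    simp [mul_pow, Real.sq_sqrt hz2]
    linear_combination (1 - z ^ 2) * Real.cos_sq_add_sin_sq θ
  let f : ℝ × Icc (-(1:ℝ) / 2) (1 / 2) → 𝕊 := fun p => ⟨_, hmem p⟩
  have hf : Continuous f := by
    refine Continuous.subtype_mk ((PiLp.continuous_toLp 2 _).comp (continuous_pi fun i => ?_)) _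
    fin_cases i <;> simp <;> fun_prop
  have himg : C 1 ∩ C (-1) = f '' (univ ×ˢ {z : Icc (-(1:ℝ) / 2) (1 / 2) | (z : ℝ) ∈ Ioo (-(1:ℝ) / 2) (1 / 2)}) := by
    ext s
    constructor
    · rintro ⟨h1, h2⟩
      simp only [C, mem_ofPred_eq] at h1 h2
      push_cast at h1 h2
      have hs := (mem_unitSphere_iff s.1).1 s.2
      have hz2 : 0 < 1 - s.1 2 ^ 2 := by nlinarith
      obtain ⟨θ, h3, h4⟩ : ∃ θ : ℝ, s.1 0 = √(1 - s.1 2 ^ 2) * Real.cos θ ∧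
          s.1 1 = √(1 - s.1 2 ^ 2) * Real.sin θ := by
        refine ⟨Complex.arg ⟨s.1 0, s.1 1⟩, ?_, ?_⟩
        · have hn : ‖(⟨s.1 0, s.1 1⟩ : ℂ)‖ = √(1 - s.1 2 ^ 2) := by
            rw [Complex.norm_def, Complex.normSq_mk]; congr 1; linarith
          rw [← hn, Complex.norm_mul_cos_arg]
        · have hn : ‖(⟨s.1 0, s.1 1⟩ : ℂ)‖ = √(1 - s.1 2 ^ 2) := by
            rw [Complex.norm_def, Complex.normSq_mk]; congr 1; linarith
          rw [← hn, Complex.norm_mul_sin_arg]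
      refine ⟨(θ, ⟨s.1 2, by constructor <;> linarith⟩), ⟨trivial, by constructor <;> simp <;> linarith⟩, ?_⟩
      apply Subtype.ext
      ext i
      fin_cases i
      · simp [f, h3]
      · simp [f, h4]
      · simp [f]
    · rintro ⟨⟨θ, z⟩, ⟨-, hz⟩, rfl⟩
      have hz' : (z : ℝ) ∈ Ioo (-(1:ℝ) / 2) (1 / 2) := hz
      constructor
      · simpa [C, f] using hz'.2
      · simp [C, f]; linarith [hz'.1]
  rw [himg]
  refine (isPreconnected_univ.prod ?_).image _ hf.continuousOn
  have : {z : Icc (-(1:ℝ) / 2) (1 / 2) | (z : ℝ) ∈ Ioo (-(1:ℝ) / 2) (1 / 2)} =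
      Subtype.val ⁻¹' Ioo (-(1:ℝ) / 2) (1 / 2) := rfl
  rw [this, ← Topology.IsInducing.subtypeVal.isPreconnected_image, Subtype.image_preimage_coe,
    inter_eq_right.2 Ioo_subset_Icc_self]
  exact isPreconnected_Ioo

end Sphere

end Gluing

/-! ### Riemannian surfaces in coordinates -/

section Chart

variable {M : Type*} [TopologicalSpace M] [ChartedSpace (EuclideanSpace ℝ (Fin 2)) M]
  [IsManifold (𝓡 2) ∞ M]

local notation "E₂" => EuclideanSpace ℝ (Fin 2)
local notation "𝔢" => extChartAt (𝓡 2)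

lemma isOpen_chart_target (x₀ : M) : IsOpen (𝔢 x₀).target :=
  isOpen_extChartAt_target x₀

/-- The derivative of the inverse of the chart at `x₀`. -/
noncomputable def chartFrame (x₀ : M) (y : E₂) : E₂ →L[ℝ] E₂ :=
  mfderiv 𝓘(ℝ, E₂) (𝓡 2) (𝔢 x₀).symm y

/-- The derivative of the chart at `x₀`. -/
noncomputable def chartCoframe (x₀ : M) (x : M) : E₂ →L[ℝ] E₂ :=
  mfderiv (𝓡 2) 𝓘(ℝ, E₂) (𝔢 x₀) x

lemma chartFrame_eq (x₀ : M) (y : E₂) :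
    chartFrame x₀ y = mfderivWithin 𝓘(ℝ, E₂) (𝓡 2) (𝔢 x₀).symm (range (𝓡 2)) y := by
  rw [chartFrame, ModelWithCorners.range_eq_univ, mfderivWithin_univ]

lemma chartCoframe_frame {x₀ : M} {y : E₂} (hy : y ∈ (𝔢 x₀).target) (a : E₂) :
    chartCoframe x₀ ((𝔢 x₀).symm y) (chartFrame x₀ y a) = a := by
  have := mfderiv_extChartAt_comp_mfderivWithin_extChartAt_symm (I := 𝓡 2) hy
  rw [chartFrame_eq]
  exact congrArg (fun L : E₂ →L[ℝ] E₂ => L a) this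

lemma chartFrame_coframe {x₀ x : M} (hx : x ∈ (𝔢 x₀).source) (v : E₂) :
    chartFrame x₀ (𝔢 x₀ x) (chartCoframe x₀ x v) = v := by
  have := mfderivWithin_extChartAt_symm_comp_mfderiv_extChartAt' (I := 𝓡 2) hx
  rw [chartFrame_eq]
  exact congrArg (fun L : E₂ →L[ℝ] E₂ => L v) this

/-- A Riemannian metric at a point, on the model space. -/
noncomputable def innerAt (h : SurfaceMetric M) (x : M) : E₂ →L[ℝ] E₂ →L[ℝ] ℝ := h.inner x

/-- The coordinate expression of a Riemannian metric. -/
noncomputable def chartMetric (h : SurfaceMetric M) (x₀ : M) (y : E₂) : E₂ →L[ℝ] E₂ →L[ℝ] ℝ :=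
  (innerAt h ((𝔢 x₀).symm y)).bilinearComp (chartFrame x₀ y) (chartFrame x₀ y)

/-- The coordinate expression of a vector field. -/
noncomputable def chartField (X : (x : M) → TangentSpace (𝓡 2) x) (x₀ : M) (y : E₂) : E₂ :=
  chartCoframe x₀ ((𝔢 x₀).symm y) (X ((𝔢 x₀).symm y))

/-- The vector field with a given coordinate expression. -/
noncomputable def pullbackField (x₀ : M) (V : E₂ → E₂) : (x : M) → TangentSpace (𝓡 2) x :=
  VectorField.mpullback (𝓡 2) 𝓘(ℝ, E₂) (𝔢 x₀) V

lemma chartMetric_apply (h : SurfaceMetric M) (x₀ : M) (y a b : E₂) :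
    chartMetric h x₀ y a b = innerAt h ((𝔢 x₀).symm y) (chartFrame x₀ y a) (chartFrame x₀ y b) :=
  rfl

lemma chartField_apply (X : (x : M) → TangentSpace (𝓡 2) x) {x₀ x : M}
    (hx : x ∈ (𝔢 x₀).source) : chartField X x₀ (𝔢 x₀ x) = chartCoframe x₀ x (X x) := by
  rw [chartField, (𝔢 x₀).left_inv hx]

lemma chartMetric_coframe (h : SurfaceMetric M) {x₀ x : M} (hx : x ∈ (𝔢 x₀).source) (v w : E₂) :
    chartMetric h x₀ (𝔢 x₀ x) (chartCoframe x₀ x v) (chartCoframe x₀ x w) = innerAt h x v w := by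
  rw [chartMetric_apply, chartFrame_coframe hx, chartFrame_coframe hx, (𝔢 x₀).left_inv hx]

lemma chartField_eq_zero_iff (X : (x : M) → TangentSpace (𝓡 2) x) {x₀ x : M}
    (hx : x ∈ (𝔢 x₀).source) : chartField X x₀ (𝔢 x₀ x) = 0 ↔ X x = 0 := by
  rw [chartField_apply X hx]
  constructor
  · intro h0
    have := chartFrame_coframe hx (X x)
    rw [h0, map_zero] at this
    exact this.symm
  · intro h0
    exact (congrArg (chartCoframe x₀ x) h0).trans (map_zero _)

lemma inverse_mfderiv_chart {x₀ x : M} (hx : x ∈ (𝔢 x₀).source) :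
    (mfderiv (𝓡 2) 𝓘(ℝ, E₂) (𝔢 x₀) x).inverse = (chartFrame x₀ (𝔢 x₀ x) : E₂ →L[ℝ] E₂) := by
  apply ContinuousLinearMap.inverse_eq
  · ext1 a
    have := chartCoframe_frame ((𝔢 x₀).map_source hx) a
    rw [(𝔢 x₀).left_inv hx] at this
    exact this
  · ext1 v
    exact chartFrame_coframe hx v

lemma inverse_mfderiv_chart_symm {x₀ : M} {y : E₂} (hy : y ∈ (𝔢 x₀).target) :
    (mfderiv 𝓘(ℝ, E₂) (𝓡 2) (𝔢 x₀).symm y).inverse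
      = (chartCoframe x₀ ((𝔢 x₀).symm y) : E₂ →L[ℝ] E₂) := by
  apply ContinuousLinearMap.inverse_eq
  · ext1 v
    have := chartFrame_coframe ((𝔢 x₀).map_target hy) v
    rw [(𝔢 x₀).right_inv hy] at this
    exact this
  · ext1 a
    exact chartCoframe_frame hy a

lemma chartField_eq_mpullback (X : (x : M) → TangentSpace (𝓡 2) x) {x₀ : M} {y : E₂}
    (hy : y ∈ (𝔢 x₀).target) :
    VectorField.mpullback 𝓘(ℝ, E₂) (𝓡 2) (𝔢 x₀).symm X y = chartField X x₀ y := by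
  rw [VectorField.mpullback_apply, inverse_mfderiv_chart_symm hy]
  rfl

lemma pullbackField_apply {x₀ x : M} (hx : x ∈ (𝔢 x₀).source) (V : E₂ → E₂) :
    pullbackField x₀ V x = chartFrame x₀ (𝔢 x₀ x) (V (𝔢 x₀ x)) :=
  congrArg (fun L : E₂ →L[ℝ] E₂ => L (V (𝔢 x₀ x))) (inverse_mfderiv_chart hx)

lemma pullbackField_chartField (X : (x : M) → TangentSpace (𝓡 2) x) {x₀ x : M}
    (hx : x ∈ (𝔢 x₀).source) : pullbackField x₀ (chartField X x₀) x = X x := by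
  rw [pullbackField_apply hx, chartField_apply X hx]
  exact chartFrame_coframe hx _

lemma contMDiffAt_chart_symm {x₀ : M} {y : E₂} (hy : y ∈ (𝔢 x₀).target) :
    ContMDiffAt 𝓘(ℝ, E₂) (𝓡 2) ∞ (𝔢 x₀).symm y :=
  (contMDiffOn_extChartAt_symm x₀).contMDiffAt ((isOpen_chart_target x₀).mem_nhds hy)

lemma contMDiffAt_chart {x₀ x : M} (hx : x ∈ (𝔢 x₀).source) :
    ContMDiffAt (𝓡 2) 𝓘(ℝ, E₂) ∞ (𝔢 x₀) x :=
  contMDiffAt_extChartAt' (by simpa using hx)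

lemma contDiffOn_chartField {X : (x : M) → TangentSpace (𝓡 2) x}
    (hX : ContMDiff (𝓡 2) (𝓡 2).tangent ∞ (fun x => (⟨x, X x⟩ : TangentBundle (𝓡 2) M)))
    (x₀ : M) : ContDiffOn ℝ ∞ (chartField X x₀) (𝔢 x₀).target := by
  intro y hy
  have h1 : ContMDiffAt 𝓘(ℝ, E₂) (𝓘(ℝ, E₂)).tangent ∞ (fun y => (⟨y,
      VectorField.mpullback 𝓘(ℝ, E₂) (𝓡 2) (𝔢 x₀).symm X y⟩ : TangentBundle 𝓘(ℝ, E₂) E₂)) y := by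
    refine ContMDiffAt.mpullback_vectorField_preimage (hX _) (contMDiffAt_chart_symm hy) ?_ le_rfl
    have := isInvertible_mfderivWithin_extChartAt_symm (I := 𝓡 2) hy
    rwa [ModelWithCorners.range_eq_univ, mfderivWithin_univ] at this
  have h2 := contMDiffAt_vectorSpace_iff_contDiffAt.1 h1
  refine (h2.congr_of_eventuallyEq ?_).contDiffWithinAt
  filter_upwards [(isOpen_chart_target x₀).mem_nhds hy] with z hz
  exact (chartField_eq_mpullback X hz).symm

/-- Fields with constant coefficients in a chart are the test fields: their inner products are the
metric coefficients, and Killing's equation is evaluated on them. -/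
lemma contMDiffAt_pullbackField {x₀ x : M} (hx : x ∈ (𝔢 x₀).source) (a : E₂) :
    ContMDiffAt (𝓡 2) (𝓡 2).tangent ∞
      (fun x => (⟨x, pullbackField x₀ (fun _ => a) x⟩ : TangentBundle (𝓡 2) M)) x := by
  refine ContMDiffAt.mpullback_vectorField_preimage ?_ (contMDiffAt_chart hx)
    (isInvertible_mfderiv_extChartAt hx) le_rfl
  exact contMDiffAt_vectorSpace_iff_contDiffAt.2 contDiffAt_const

lemma inner_pullbackField (h : SurfaceMetric M) {x₀ x : M} (hx : x ∈ (𝔢 x₀).source)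
    (V W : E₂ → E₂) : h.inner x (pullbackField x₀ V x) (pullbackField x₀ W x)
      = chartMetric h x₀ (𝔢 x₀ x) (V (𝔢 x₀ x)) (W (𝔢 x₀ x)) := by
  rw [chartMetric_apply, (𝔢 x₀).left_inv hx, pullbackField_apply hx, pullbackField_apply hx]
  rfl

lemma contMDiffAt_inner_pullbackField (h : SurfaceMetric M) {x₀ x : M} (hx : x ∈ (𝔢 x₀).source)
    (a b : E₂) : ContMDiffAt (𝓡 2) 𝓘(ℝ, ℝ) ∞ (fun x =>
      h.inner x (pullbackField x₀ (fun _ => a) x) (pullbackField x₀ (fun _ => b) x)) x := by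
  have := ContMDiffAt.clm_bundle_apply₂ (F₁ := E₂) (F₂ := E₂) (F₃ := ℝ)
    (E₃ := Bundle.Trivial M ℝ) (b := fun x : M => x)
    h.contMDiff.contMDiffAt (contMDiffAt_pullbackField hx a) (contMDiffAt_pullbackField hx b)
  rw [Bundle.contMDiffAt_totalSpace] at this
  exact this.2

lemma contDiffOn_chartMetric (h : SurfaceMetric M) (x₀ : M) :
    ContDiffOn ℝ ∞ (chartMetric h x₀) (𝔢 x₀).target := by
  refine contDiffOn_clm_apply.2 fun a => contDiffOn_clm_apply.2 fun b => ?_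
  intro y hy
  have h1 := (contMDiffAt_inner_pullbackField h ((𝔢 x₀).map_target hy) a b).comp y
    (contMDiffAt_chart_symm hy)
  refine ((contMDiffAt_iff_contDiffAt.1 h1).congr_of_eventuallyEq ?_).contDiffWithinAt
  filter_upwards [(isOpen_chart_target x₀).mem_nhds hy] with z hz
  have := inner_pullbackField h ((𝔢 x₀).map_target hz) (fun _ => a) (fun _ => b)
  rw [(𝔢 x₀).right_inv hz] at this
  exact this.symm

theorem smoothMetricOn_chartMetric (h : SurfaceMetric M) (x₀ : M) :
    SmoothMetricOn (chartMetric h x₀) (𝔢 x₀).target where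
  isOpen := isOpen_chart_target x₀
  contDiffOn := contDiffOn_chartMetric h x₀
  symm y _ a b := by
    rw [chartMetric_apply, chartMetric_apply]
    exact h.symm _ _ _
  pos y hy a ha := by
    rw [chartMetric_apply]
    refine h.pos _ _ fun h0 => ha ?_
    have := chartCoframe_frame hy a
    exact this.symm.trans ((congrArg _ h0).trans (map_zero _))

lemma mlieBracket_eq_lieBracket {E : Type*} [NormedAddCommGroup E] [NormedSpace ℝ E]
    (V W : (x : E) → TangentSpace 𝓘(ℝ, E) x) :
    VectorField.mlieBracket 𝓘(ℝ, E) V W = VectorField.lieBracket ℝ V W := by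
  rw [← VectorField.mlieBracketWithin_univ, VectorField.mlieBracketWithin_eq_lieBracketWithin]
  exact VectorField.lieBracketWithin_univ

/-- On fields with constant coefficients the bracket with `X` is minus the derivative of the
coordinate expression of `X`, so the vanishing Lie derivative becomes Killing's equation in
coordinates. -/
theorem IsKillingField.killingFieldOn {h : SurfaceMetric M} {X : (x : M) → TangentSpace (𝓡 2) x}
    (hX : IsKillingField h X) (x₀ : M) :
    KillingFieldOn (chartMetric h x₀) (chartField X x₀) (𝔢 x₀).target where
  contDiffOn := contDiffOn_chartField hX.smooth x₀
  killing y hy a b := by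
    have : IsManifold (𝓡 2) (minSmoothness ℝ 2) M :=
      IsManifold.of_le (n := ∞) minSmoothness_two_le_infty
    have hx := (𝔢 x₀).map_target hy
    set x := (𝔢 x₀).symm y with hxdef
    have hxy : 𝔢 x₀ x = y := (𝔢 x₀).right_inv hy
    have hN := (isOpen_chart_target x₀).mem_nhds hy
    have hVat := (contDiffOn_chartField hX.smooth x₀).contDiffAt hN
    have hgat := (contDiffOn_chartMetric h x₀).contDiffAt hN
    have hsrc : (𝔢 x₀).source ∈ 𝓝 x := (isOpen_extChartAt_source x₀).mem_nhds hx
    have heat := contMDiffAt_chart hx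
    have hbr : ∀ c : E₂, VectorField.mlieBracket (𝓡 2) X (pullbackField x₀ fun _ => c) x
        = pullbackField x₀ (fun _ => - fderiv ℝ (chartField X x₀) y c) x := by
      intro c
      have e1 : X =ᶠ[𝓝 x] pullbackField x₀ (chartField X x₀) := by
        filter_upwards [hsrc] with z hz
        exact (pullbackField_chartField X hz).symm
      refine (e1.mlieBracket_vectorField_eq Filter.EventuallyEq.rfl).trans ?_
      have e2 : VectorField.mpullback (𝓡 2) 𝓘(ℝ, E₂) (𝔢 x₀)
          (VectorField.mlieBracket 𝓘(ℝ, E₂) (chartField X x₀) (fun _ => c)) x = _ :=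
        VectorField.mpullback_mlieBracket (n := ∞) (I := 𝓡 2) (I' := 𝓘(ℝ, E₂)) (f := 𝔢 x₀)
          (V := chartField X x₀) (W := fun _ => c) (x₀ := x)
          (by
            rw [hxy]
            exact (contMDiffAt_vectorSpace_iff_contDiffAt.2 hVat).mdifferentiableAt (by simp))
          ((contMDiffAt_vectorSpace_iff_contDiffAt.2
            (contDiffAt_const : ContDiffAt ℝ ∞ _ _)).mdifferentiableAt (by simp))
          heat minSmoothness_two_le_infty
      refine e2.symm.trans ?_
      have e3 : VectorField.mlieBracket 𝓘(ℝ, E₂) (chartField X x₀) (fun _ => c)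
          = VectorField.lieBracket ℝ (chartField X x₀) (fun _ => c) :=
        mlieBracket_eq_lieBracket _ _
      rw [e3]
      refine (pullbackField_apply hx _).trans ((pullbackField_apply hx _).trans ?_).symm
      rw [hxy, VectorField.lieBracket]
      simp
      rfl
    have hK := hX.lieDerivative_eq_zero x _ _ (contMDiffAt_pullbackField hx a)
      (contMDiffAt_pullbackField hx b)
    rw [hbr a, hbr b] at hK
    have k1 := inner_pullbackField h hx (fun _ => -(fderiv ℝ (chartField X x₀) y) a) (fun _ => b)
    have k2 := inner_pullbackField h hx (fun _ => a) (fun _ => -(fderiv ℝ (chartField X x₀) y) b)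
    rw [k1, k2, hxy] at hK
    have hd : mfderiv (𝓡 2) 𝓘(ℝ, ℝ) (fun x =>
      h.inner x (pullbackField x₀ (fun _ => a) x) (pullbackField x₀ (fun _ => b) x)) x
        = mfderiv (𝓡 2) 𝓘(ℝ, ℝ) ((fun y => chartMetric h x₀ y a b) ∘ 𝔢 x₀) x := by
      apply Filter.EventuallyEq.mfderiv_eq
      filter_upwards [hsrc] with z hz
      exact inner_pullbackField h hz _ _
    have hg' : HasFDerivAt (fun y => chartMetric h x₀ y a b)
        (((ContinuousLinearMap.apply ℝ ℝ b).comp (ContinuousLinearMap.apply ℝ (E₂ →L[ℝ] ℝ) a)).comp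
          (fderiv ℝ (chartMetric h x₀) y)) y :=
      (((ContinuousLinearMap.apply ℝ ℝ b).comp
        (ContinuousLinearMap.apply ℝ (E₂ →L[ℝ] ℝ) a)).hasFDerivAt).comp y
        (hgat.differentiableAt (by simp)).hasFDerivAt
    rw [← hxy] at hg'
    rw [hd, (hg'.hasMFDerivAt.comp x (heat.mdifferentiableAt (by simp)).hasMFDerivAt).mfderiv] at hK
    have hK2 : fderiv ℝ (chartMetric h x₀) y (chartField X x₀ y) a b
      = chartMetric h x₀ y (-(fderiv ℝ (chartField X x₀) y a)) b
        + chartMetric h x₀ y a (-(fderiv ℝ (chartField X x₀) y b)) := by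
      refine Eq.trans ?_ hK
      rw [hxy]; rfl
    rw [hK2]
    simp

/-! #### Curves in coordinates -/

/-- The linear map `t ↦ t • w`. -/
noncomputable def lineMap (w : E₂) : ℝ →L[ℝ] E₂ := (1 : ℝ →L[ℝ] ℝ).smulRight w

@[simp] lemma lineMap_one (w : E₂) : lineMap w 1 = w := by simp [lineMap]

lemma HasMFDerivAt.hasDerivAt_chart {c : ℝ → M} {s : ℝ} {L : ℝ →L[ℝ] E₂}
    (hc : HasMFDerivAt 𝓘(ℝ, ℝ) (𝓡 2) c s L) {x₀ : M} (hs : c s ∈ (𝔢 x₀).source) :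
    HasDerivAt (fun τ => 𝔢 x₀ (c τ)) (chartCoframe x₀ (c s) (L 1)) s := by
  have h1 := ((contMDiffAt_chart hs).mdifferentiableAt (by simp)).hasMFDerivAt.comp s hc
  have h2 : HasFDerivAt (fun τ => 𝔢 x₀ (c τ)) ((chartCoframe x₀ (c s)).comp L) s :=
    hasMFDerivAt_iff_hasFDerivAt.1 h1
  exact h2.hasDerivAt

lemma HasDerivAt.hasMFDerivAt_chart_symm {u : ℝ → E₂} {s : ℝ} {w : E₂} (hu : HasDerivAt u w s)
    {x₀ : M} (hs : u s ∈ (𝔢 x₀).target) :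
    HasMFDerivAt 𝓘(ℝ, ℝ) (𝓡 2) (fun τ => (𝔢 x₀).symm (u τ)) s
      (lineMap (chartFrame x₀ (u s) w)) := by
  have h1 := ((contMDiffAt_chart_symm hs).mdifferentiableAt (by simp)).hasMFDerivAt.comp s
    hu.hasFDerivAt.hasMFDerivAt
  have h2 : lineMap (chartFrame x₀ (u s) w)
      = (chartFrame x₀ (u s)).comp (ContinuousLinearMap.toSpanSingleton ℝ w) := by
    ext1
    simp [lineMap]
  rw [h2]
  exact h1

/-- The velocity of a curve in a surface. -/
noncomputable def velocity (c : ℝ → M) (s : ℝ) : E₂ := mfderiv 𝓘(ℝ, ℝ) (𝓡 2) c s (1 : ℝ)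

lemma hasDerivAt_chart {c : ℝ → M} {s : ℝ} (hc : MDifferentiableAt 𝓘(ℝ, ℝ) (𝓡 2) c s) {x₀ : M}
    (hs : c s ∈ (𝔢 x₀).source) :
    HasDerivAt (fun τ => 𝔢 x₀ (c τ)) (chartCoframe x₀ (c s) (velocity c s)) s :=
  hc.hasMFDerivAt.hasDerivAt_chart hs

lemma IsMIntegralCurve.hasDerivAt_chart {X : (x : M) → TangentSpace (𝓡 2) x} {γ : ℝ → M}
    (hγ : IsMIntegralCurve γ X) {s : ℝ} {x₀ : M} (hs : γ s ∈ (𝔢 x₀).source) :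
    HasDerivAt (fun τ => 𝔢 x₀ (γ τ)) (chartField X x₀ (𝔢 x₀ (γ s))) s := by
  rw [chartField_apply X hs]
  exact ((hγ s).hasDerivAt_chart hs).congr_deriv (congrArg (chartCoframe x₀ (γ s))
    (one_smul ℝ (X (γ s) : E₂)))

end Chart

/-! ### The flow of a vector field on a compact surface -/

section Flow

variable {M : Type*} [TopologicalSpace M] [ChartedSpace (EuclideanSpace ℝ (Fin 2)) M]
  [IsManifold (𝓡 2) ∞ M]

local notation "E₂" => EuclideanSpace ℝ (Fin 2)
local notation "𝔢" => extChartAt (𝓡 2)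

/-- `Fl` is the smooth global flow of the vector field `X`. -/
structure IsFlow (X : (x : M) → TangentSpace (𝓡 2) x) (Fl : ℝ → M → M) : Prop where
  zero : ∀ x, Fl 0 x = x
  integral : ∀ x, IsMIntegralCurve (fun t => Fl t x) X
  contMDiff : ContMDiff (𝓘(ℝ, ℝ).prod (𝓡 2)) (𝓡 2) ∞ (fun p : ℝ × M => Fl p.1 p.2)

lemma IsFlow.contMDiff_time {X : (x : M) → TangentSpace (𝓡 2) x} {Fl : ℝ → M → M}
    (hF : IsFlow X Fl) (t : ℝ) : ContMDiff (𝓡 2) (𝓡 2) ∞ (Fl t) :=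
  hF.contMDiff.comp (contMDiff_const.prodMk contMDiff_id)

lemma exists_local_flow_chart {X : (x : M) → TangentSpace (𝓡 2) x}
    (hX : ContMDiff (𝓡 2) (𝓡 2).tangent ∞ (fun x => (⟨x, X x⟩ : TangentBundle (𝓡 2) M)))
    (x₀ : M) : ∃ δ > 0, ∃ W ∈ 𝓝 x₀, ∃ ψ : ℝ → M → M,
      (∀ x ∈ W, ∀ t ∈ Ioo (-δ) δ,
        ContMDiffAt (𝓘(ℝ, ℝ).prod (𝓡 2)) (𝓡 2) ∞ (fun p : ℝ × M => ψ p.1 p.2) (t, x)) ∧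
      ∀ x ∈ W, ψ 0 x = x ∧ IsMIntegralCurveOn (fun t => ψ t x) X (Ioo (-δ) δ) := by
  obtain ⟨δ, hδ, φ, hφ, h⟩ := exists_local_flow (isOpen_chart_target x₀)
    (contDiffOn_chartField hX x₀) (mem_extChartAt_target x₀)
    ((isOpen_chart_target x₀).mem_nhds (mem_extChartAt_target x₀))
  have hW : (𝔢 x₀).source ∩ 𝔢 x₀ ⁻¹' Metric.ball (𝔢 x₀ x₀) δ ∈ 𝓝 x₀ :=
    Filter.inter_mem (extChartAt_source_mem_nhds x₀)
      ((continuousAt_extChartAt x₀).preimage_mem_nhds (Metric.ball_mem_nhds _ hδ))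
  refine ⟨δ, hδ, _, hW, fun t x => (𝔢 x₀).symm (φ t (𝔢 x₀ x)), ?_, ?_⟩
  · rintro x ⟨hx, hxb⟩ t ht
    have h1 : ContMDiffAt (𝓘(ℝ, ℝ).prod (𝓡 2)) (𝓘(ℝ, ℝ).prod 𝓘(ℝ, E₂)) ∞
        (fun p : ℝ × M => (p.1, 𝔢 x₀ p.2)) (t, x) :=
      contMDiffAt_fst.prodMk ((contMDiffAt_chart hx).comp (t, x) contMDiffAt_snd)
    have h2 : ContDiffAt ℝ ∞ (Function.uncurry φ) (t, 𝔢 x₀ x) :=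
      hφ.contDiffAt ((isOpen_Ioo.prod Metric.isOpen_ball).mem_nhds ⟨ht, hxb⟩)
    have h3 := h2.contMDiffAt
    rw [modelWithCornersSelf_prod, ← chartedSpaceSelf_prod] at h3
    exact (contMDiffAt_chart_symm ((h _ hxb).2 t ht).1).comp (t, x) (h3.comp (t, x) h1)
  · rintro x ⟨hx, hxb⟩
    refine ⟨(congrArg _ (h _ hxb).1).trans ((𝔢 x₀).left_inv hx), fun t ht => ?_⟩
    obtain ⟨h1, h2⟩ := (h _ hxb).2 t ht
    have h3 := h2.hasMFDerivAt_chart_symm h1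
    have h4 : chartFrame x₀ (φ t (𝔢 x₀ x)) (chartField X x₀ (φ t (𝔢 x₀ x)))
        = X ((𝔢 x₀).symm (φ t (𝔢 x₀ x))) := by
      have := chartFrame_coframe ((𝔢 x₀).map_target h1) (X ((𝔢 x₀).symm (φ t (𝔢 x₀ x))))
      rw [(𝔢 x₀).right_inv h1] at this
      exact this
    rw [h4] at h3
    exact h3.hasMFDerivWithinAt

variable [CompactSpace M] [T2Space M]

/-- The lifetime is locally constant in the initial point, so a finite subcover provides a common
one. This is what makes the integral curves complete. -/
lemma exists_uniform_local_flow {X : (x : M) → TangentSpace (𝓡 2) x}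
    (hX : ContMDiff (𝓡 2) (𝓡 2).tangent ∞ (fun x => (⟨x, X x⟩ : TangentBundle (𝓡 2) M))) :
    ∃ ε > 0, ∀ x₀ : M, ∃ W ∈ 𝓝 x₀, ∃ ψ : ℝ → M → M,
      (∀ x ∈ W, ∀ t ∈ Ioo (-ε) ε,
        ContMDiffAt (𝓘(ℝ, ℝ).prod (𝓡 2)) (𝓡 2) ∞ (fun p : ℝ × M => ψ p.1 p.2) (t, x)) ∧
      ∀ x ∈ W, ψ 0 x = x ∧ IsMIntegralCurveOn (fun t => ψ t x) X (Ioo (-ε) ε) := by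
  classical
  choose δ hδ W hW ψ hψ hψ' using exists_local_flow_chart hX
  obtain ⟨F, hF⟩ := isCompact_univ.elim_nhds_subcover (fun x => interior (W x))
    (fun x _ => interior_mem_nhds.2 (hW x))
  have hε : ∃ ε > 0, ∀ x ∈ F, ε ≤ δ x := by
    clear hF
    induction F using Finset.induction_on with
    | empty => exact ⟨1, one_pos, by simp⟩
    | insert a F _ ih =>
      obtain ⟨ε, h1, h2⟩ := ih
      refine ⟨min ε (δ a), lt_min h1 (hδ a), fun x hx => ?_⟩
      rcases Finset.mem_insert.1 hx with rfl | hx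
      · exact min_le_right _ _
      · exact (min_le_left _ _).trans (h2 x hx)
  obtain ⟨ε, hε, hle⟩ := hε
  refine ⟨ε, hε, fun x₀ => ?_⟩
  obtain ⟨y, hy, hxy⟩ := mem_iUnion₂.1 (hF.2 (mem_univ x₀))
  have hsub : Ioo (-ε) ε ⊆ Ioo (-δ y) (δ y) :=
    Ioo_subset_Ioo (neg_le_neg (hle y hy)) (hle y hy)
  exact ⟨W y, mem_interior_iff_mem_nhds.1 hxy, ψ y, fun x hx t ht => hψ y x hx t (hsub ht),
    fun x hx => ⟨(hψ' y x hx).1, (hψ' y x hx).2.mono hsub⟩⟩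

lemma eq_of_isMIntegralCurve {X : (x : M) → TangentSpace (𝓡 2) x}
    (hX : ContMDiff (𝓡 2) (𝓡 2).tangent ∞ (fun x => (⟨x, X x⟩ : TangentBundle (𝓡 2) M)))
    {γ γ' : ℝ → M} (hγ : IsMIntegralCurve γ X) (hγ' : IsMIntegralCurve γ' X) {t₀ : ℝ}
    (h : γ t₀ = γ' t₀) : γ = γ' :=
  isMIntegralCurve_Ioo_eq_of_contMDiff_boundaryless (I := 𝓡 2) (hX.of_le ENat.LEInfty.out) hγ hγ' h

theorem exists_isFlow {X : (x : M) → TangentSpace (𝓡 2) x}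
    (hX : ContMDiff (𝓡 2) (𝓡 2).tangent ∞ (fun x => (⟨x, X x⟩ : TangentBundle (𝓡 2) M))) :
    ∃ Fl, IsFlow X Fl := by
  obtain ⟨ε, hε, hloc⟩ := exists_uniform_local_flow hX
  have hX1 : ContMDiff (𝓡 2) (𝓡 2).tangent 1 (fun x => (⟨x, X x⟩ : TangentBundle (𝓡 2) M)) :=
    hX.of_le ENat.LEInfty.out
  have hex : ∀ x : M, ∃ γ : ℝ → M, γ 0 = x ∧ IsMIntegralCurve γ X := by
    refine fun x => exists_isMIntegralCurve_of_isMIntegralCurveOn hX1 hε (fun y => ?_) x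
    obtain ⟨W, hW, ψ, -, h⟩ := hloc y
    exact ⟨fun t => ψ t y, h y (mem_of_mem_nhds hW)⟩
  choose γ hγ0 hγ using hex
  have hadd : ∀ s t x, γ x (s + t) = γ (γ x t) s := by
    intro s t x
    have := eq_of_isMIntegralCurve hX ((hγ x).comp_add t) (hγ (γ x t)) (t₀ := 0)
      (by simp [hγ0])
    exact congrFun this s
  refine ⟨fun t x => γ x t, hγ0, hγ, ?_⟩
  -- Smoothness is propagated by doubling the time: the flow at time `t` is the flow at time `t / 2`
  -- applied twice.
  have key : ∀ n : ℕ, ∀ x, ∀ t ∈ Ioo (-(2 ^ n * ε)) (2 ^ n * ε),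
      ContMDiffAt (𝓘(ℝ, ℝ).prod (𝓡 2)) (𝓡 2) ∞ (fun p : ℝ × M => γ p.2 p.1) (t, x) := by
    intro n
    induction n with
    | zero =>
      intro x t ht
      simp only [pow_zero, one_mul] at ht
      obtain ⟨W, hW, ψ, h1, h2⟩ := hloc x
      refine (h1 x (mem_of_mem_nhds hW) t ht).congr_of_eventuallyEq ?_
      filter_upwards [prod_mem_nhds (isOpen_Ioo.mem_nhds ht) hW] with p hp
      exact isMIntegralCurveOn_Ioo_eqOn_of_contMDiff_boundaryless (I := 𝓡 2) (t₀ := 0)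
        ⟨by linarith, by linarith⟩ hX1 ((hγ p.2).isMIntegralCurveOn _) (h2 p.2 hp.2).2
        (by rw [hγ0, (h2 p.2 hp.2).1]) hp.1
    | succ n ih =>
      intro x t ht
      have ht2 : t / 2 ∈ Ioo (-(2 ^ n * ε)) (2 ^ n * ε) := by
        rw [pow_succ] at ht
        constructor <;> [have := ht.1; have := ht.2] <;> linarith
      have hhalf : ContMDiffAt (𝓘(ℝ, ℝ).prod (𝓡 2)) 𝓘(ℝ, ℝ) ∞ (fun p : ℝ × M => p.1 / 2) (t, x) := by
        have : ContMDiff 𝓘(ℝ, ℝ) 𝓘(ℝ, ℝ) ∞ (fun s : ℝ => s / 2) :=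
          (contDiff_id.div_const 2).contMDiff
        exact this.contMDiffAt.comp (t, x) contMDiffAt_fst
      have h1 : ContMDiffAt (𝓘(ℝ, ℝ).prod (𝓡 2)) (𝓡 2) ∞
          (fun p : ℝ × M => γ p.2 (p.1 / 2)) (t, x) :=
        (ih x (t / 2) ht2).comp (t, x) (hhalf.prodMk contMDiffAt_snd)
      have h2 : ContMDiffAt (𝓘(ℝ, ℝ).prod (𝓡 2)) (𝓡 2) ∞
          (fun p : ℝ × M => γ (γ p.2 (p.1 / 2)) (p.1 / 2)) (t, x) :=
        (ih (γ x (t / 2)) (t / 2) ht2).comp (t, x) (hhalf.prodMk h1)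
      refine h2.congr_of_eventuallyEq (Filter.Eventually.of_forall fun p => ?_)
      change γ p.2 p.1 = γ (γ p.2 (p.1 / 2)) (p.1 / 2)
      rw [← hadd, add_halves]
  rintro ⟨t, x⟩
  obtain ⟨n, hn⟩ := pow_unbounded_of_one_lt (|t| / ε) (one_lt_two : (1 : ℝ) < 2)
  rw [div_lt_iff₀ hε] at hn
  exact key n x t (abs_lt.1 hn)

namespace IsFlow

variable {X : (x : M) → TangentSpace (𝓡 2) x} {Fl : ℝ → M → M}

lemma eq_flow (hX : ContMDiff (𝓡 2) (𝓡 2).tangent ∞ (fun x => (⟨x, X x⟩ : TangentBundle (𝓡 2) M)))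
    (hF : IsFlow X Fl) {γ : ℝ → M} (hγ : IsMIntegralCurve γ X) (t : ℝ) : γ t = Fl t (γ 0) :=
  congrFun (eq_of_isMIntegralCurve hX hγ (hF.integral (γ 0)) (t₀ := 0) (hF.zero _).symm) t

lemma add (hX : ContMDiff (𝓡 2) (𝓡 2).tangent ∞ (fun x => (⟨x, X x⟩ : TangentBundle (𝓡 2) M)))
    (hF : IsFlow X Fl) (s t : ℝ) (x : M) : Fl (s + t) x = Fl s (Fl t x) := by
  have := hF.eq_flow hX ((hF.integral x).comp_add t) s
  simpa using this

lemma eq_self_of_eq_zero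
    (hX : ContMDiff (𝓡 2) (𝓡 2).tangent ∞ (fun x => (⟨x, X x⟩ : TangentBundle (𝓡 2) M)))
    (hF : IsFlow X Fl) {x : M} (hx : X x = 0) (t : ℝ) : Fl t x = x :=
  (hF.eq_flow hX (isMIntegralCurve_const hx) t).symm

end IsFlow

end Flow

/-! ### Zeros of Killing fields and curves orthogonal to them -/

section Normal

variable {M : Type*} [TopologicalSpace M] [ChartedSpace (EuclideanSpace ℝ (Fin 2)) M]
  [IsManifold (𝓡 2) ∞ M]

local notation "E₂" => EuclideanSpace ℝ (Fin 2)
local notation "𝔢" => extChartAt (𝓡 2)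

variable {h : SurfaceMetric M} {X : (x : M) → TangentSpace (𝓡 2) x}

lemma finrank_plane : Module.finrank ℝ E₂ = 2 := by simp

/-- The value of a vector field, in the model space. -/
def fieldAt (X : (x : M) → TangentSpace (𝓡 2) x) (x : M) : E₂ := X x

lemma chartField_eq_coframe (X : (x : M) → TangentSpace (𝓡 2) x) {x₀ x : M}
    (hx : x ∈ (𝔢 x₀).source) : chartField X x₀ (𝔢 x₀ x) = chartCoframe x₀ x (fieldAt X x) :=
  chartField_apply X hx

lemma chartFrame_field (X : (x : M) → TangentSpace (𝓡 2) x) {x₀ : M} {y : E₂}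
    (hy : y ∈ (𝔢 x₀).target) :
    chartFrame x₀ y (chartField X x₀ y) = fieldAt X ((𝔢 x₀).symm y) := by
  have := chartFrame_coframe ((𝔢 x₀).map_target hy) (fieldAt X ((𝔢 x₀).symm y))
  rw [(𝔢 x₀).right_inv hy] at this
  exact this

lemma chartSource_mem_nhds {x₀ x : M} (hx : x ∈ (𝔢 x₀).source) : (𝔢 x₀).source ∈ 𝓝 x :=
  (isOpen_extChartAt_source x₀).mem_nhds hx

lemma continuousAt_chart {x₀ x : M} (hx : x ∈ (𝔢 x₀).source) : ContinuousAt (𝔢 x₀) x :=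
  (contMDiffAt_chart hx).continuousAt

lemma eventually_of_chart {x₀ x : M} (hx : x ∈ (𝔢 x₀).source) {P : E₂ → Prop}
    (hP : ∀ᶠ y in 𝓝 (𝔢 x₀ x), P y) : ∀ᶠ y in 𝓝 x, P (𝔢 x₀ y) :=
  (continuousAt_chart hx).eventually hP

lemma eventually_chart_of {x₀ x : M} (hx : x ∈ (𝔢 x₀).source) {P : M → Prop}
    (hP : ∀ᶠ y in 𝓝 x, P y) : ∀ᶠ y in 𝓝 (𝔢 x₀ x), P ((𝔢 x₀).symm y) := by
  have h1 := (contMDiffAt_chart_symm ((𝔢 x₀).map_source hx)).continuousAt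
  rw [ContinuousAt, (𝔢 x₀).left_inv hx] at h1
  exact h1.eventually hP

namespace IsKillingField

lemma eventually_eq_zero (hX : IsKillingField h X) {x₀ x : M} (hx : x ∈ (𝔢 x₀).source)
    (h0 : X x = 0) (h1 : fderiv ℝ (chartField X x₀) (𝔢 x₀ x) = 0) : ∀ᶠ y in 𝓝 x, X y = 0 := by
  have hV := (hX.killingFieldOn x₀).eventually_eq_zero (smoothMetricOn_chartMetric h x₀)
    ((𝔢 x₀).map_source hx) ((chartField_eq_zero_iff X hx).2 h0) h1
  filter_upwards [eventually_of_chart hx hV, chartSource_mem_nhds hx] with y hy hys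
  exact (chartField_eq_zero_iff X hys).1 hy

/-- Otherwise `X` vanishes near `x`. The set of points near which `X` vanishes is open, and closed
because the 1-jet vanishes at its limit points by continuity; connectedness would give `X = 0`. -/
lemma fderiv_chartField_ne_zero [PreconnectedSpace M] (hX : IsKillingField h X)
    (hne : ∃ x, X x ≠ 0) {x₀ x : M} (hx : x ∈ (𝔢 x₀).source) (h0 : X x = 0) :
    fderiv ℝ (chartField X x₀) (𝔢 x₀ x) ≠ 0 := by
  intro h1
  set S : Set M := {y | ∀ᶠ z in 𝓝 y, X z = 0} with hS
  have hopen : IsOpen S := isOpen_setOfPred_eventually_nhds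
  have hclosed : IsClosed S := by
    refine isClosed_of_closure_subset fun y hy => ?_
    have hfreq : ∃ᶠ z in 𝓝 y, z ∈ S := mem_closure_iff_frequently.1 hy
    have hys : y ∈ (𝔢 y).source := mem_extChartAt_source y
    have hK := hX.killingFieldOn y
    have hg := smoothMetricOn_chartMetric h y
    have hyt := (𝔢 y).map_source hys
    have hcont : ContinuousAt (fun z => (chartField X y (𝔢 y z),
        fderiv ℝ (chartField X y) (𝔢 y z))) y :=
      ((hK.contDiffAt hg hyt).continuousAt.prodMk
        (hK.contDiffAt_fderiv hg hyt).continuousAt).comp (continuousAt_chart hys)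
    have hfr : ∃ᶠ z in 𝓝 y, (chartField X y (𝔢 y z), fderiv ℝ (chartField X y) (𝔢 y z))
        ∈ ({0} : Set (E₂ × (E₂ →L[ℝ] E₂))) := by
      refine (hfreq.and_eventually (chartSource_mem_nhds hys)).mono ?_
      rintro z ⟨hz, hzs⟩
      have hV : chartField X y =ᶠ[𝓝 (𝔢 y z)] fun _ => 0 := by
        filter_upwards [eventually_chart_of hzs hz,
          (isOpen_chart_target y).mem_nhds ((𝔢 y).map_source hzs)] with w hw hwt
        have := (chartField_eq_zero_iff X ((𝔢 y).map_target hwt)).2 hw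
        rwa [(𝔢 y).right_inv hwt] at this
      rw [mem_singleton_iff, hV.fderiv_eq, hV.eq_of_nhds]
      simp
    have h3 := isClosed_singleton.mem_of_frequently_of_tendsto hfr hcont
    rw [mem_singleton_iff, Prod.mk_eq_zero] at h3
    exact hX.eventually_eq_zero hys ((chartField_eq_zero_iff X hys).1 h3.1) h3.2
  have hxS : x ∈ S := hX.eventually_eq_zero hx h0 h1
  have huniv := IsClopen.eq_univ ⟨hclosed, hopen⟩ ⟨x, hxS⟩
  obtain ⟨y, hy⟩ := hne
  have : y ∈ S := huniv ▸ mem_univ y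
  exact hy this.self_of_nhds

lemma eventually_ne_zero [PreconnectedSpace M] (hX : IsKillingField h X)
    (hne : ∃ x, X x ≠ 0) (x : M) : ∀ᶠ y in 𝓝[≠] x, X y ≠ 0 := by
  have hx : x ∈ (𝔢 x).source := mem_extChartAt_source x
  have h1 := (hX.killingFieldOn x).eventually_ne_zero (smoothMetricOn_chartMetric h x)
    finrank_plane ((𝔢 x).map_source hx) (fun h0 => hX.fderiv_chartField_ne_zero hne hx
      ((chartField_eq_zero_iff X hx).1 h0))
  rw [eventually_nhdsWithin_iff] at h1 ⊢
  filter_upwards [eventually_of_chart hx h1, chartSource_mem_nhds hx] with y hy hys hne'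
  intro h0
  refine hy (fun he => hne' ((𝔢 x).injOn hys hx he)) ((chartField_eq_zero_iff X hys).2 h0)

end IsKillingField

lemma ContDiffAt.contDiffAt_deriv {F : Type*} [NormedAddCommGroup F] [NormedSpace ℝ F]
    {u : ℝ → F} {s : ℝ} (hu : ContDiffAt ℝ ∞ u s) : ContDiffAt ℝ ∞ (deriv u) s :=
  (hu.fderiv_right (m := ∞) le_rfl).clm_apply contDiffAt_const

/-! #### Unit speed curves orthogonal to a vector field -/

lemma velocity_congr {c c' : ℝ → M} {s : ℝ} (hc : c =ᶠ[𝓝 s] c') : velocity c s = velocity c' s := by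
  rw [velocity, velocity, hc.mfderiv_eq]
  rfl

lemma HasMFDerivAt.velocity_eq {c : ℝ → M} {s : ℝ} {L : ℝ →L[ℝ] E₂}
    (hc : HasMFDerivAt 𝓘(ℝ, ℝ) (𝓡 2) c s L) : velocity c s = L 1 := by
  rw [velocity, hc.mfderiv]
  rfl

lemma ContMDiffAt.contDiffAt_chart {c : ℝ → M} {s : ℝ} (hc : ContMDiffAt 𝓘(ℝ, ℝ) (𝓡 2) ∞ c s)
    {x₀ : M} (hs : c s ∈ (𝔢 x₀).source) : ContDiffAt ℝ ∞ (fun τ => 𝔢 x₀ (c τ)) s :=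
  contMDiffAt_iff_contDiffAt.1 ((contMDiffAt_chart hs).comp s hc)

lemma ContMDiffAt.deriv_chart {c : ℝ → M} {s : ℝ} (hc : ContMDiffAt 𝓘(ℝ, ℝ) (𝓡 2) ∞ c s)
    {x₀ : M} (hs : c s ∈ (𝔢 x₀).source) :
    deriv (fun τ => 𝔢 x₀ (c τ)) s = chartCoframe x₀ (c s) (velocity c s) :=
  (hasDerivAt_chart (hc.mdifferentiableAt (by simp)) hs).deriv

variable (h X) in
/-- `c` is smooth at `s`, with unit velocity orthogonal to `X`. -/
structure IsNormalAt (c : ℝ → M) (s : ℝ) : Prop where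
  contMDiffAt : ContMDiffAt 𝓘(ℝ, ℝ) (𝓡 2) ∞ c s
  unit : innerAt h (c s) (velocity c s) (velocity c s) = 1
  orth : innerAt h (c s) (velocity c s) (fieldAt X (c s)) = 0

lemma IsNormalAt.congr {c c' : ℝ → M} {s : ℝ} (hc : IsNormalAt h X c s) (he : c' =ᶠ[𝓝 s] c) :
    IsNormalAt h X c' s := by
  have h1 := he.eq_of_nhds
  refine ⟨hc.contMDiffAt.congr_of_eventuallyEq he, ?_, ?_⟩
  · rw [velocity_congr he, h1]; exact hc.unit
  · rw [velocity_congr he, h1]; exact hc.orth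

lemma IsNormalAt.chart {c : ℝ → M} {s : ℝ} (hc : IsNormalAt h X c s) {x₀ : M}
    (hs : c s ∈ (𝔢 x₀).source) :
    chartMetric h x₀ (𝔢 x₀ (c s)) (deriv (fun τ => 𝔢 x₀ (c τ)) s)
      (deriv (fun τ => 𝔢 x₀ (c τ)) s) = 1 ∧
    chartMetric h x₀ (𝔢 x₀ (c s)) (deriv (fun τ => 𝔢 x₀ (c τ)) s)
      (chartField X x₀ (𝔢 x₀ (c s))) = 0 := by
  rw [hc.contMDiffAt.deriv_chart hs, chartField_eq_coframe X hs, chartMetric_coframe h hs,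
    chartMetric_coframe h hs]
  exact ⟨hc.unit, hc.orth⟩

lemma isNormalAt_chart_symm {u : ℝ → E₂} {s : ℝ} (hu : ContDiffAt ℝ ∞ u s) {x₀ : M}
    (hs : u s ∈ (𝔢 x₀).target) (h1 : chartMetric h x₀ (u s) (deriv u s) (deriv u s) = 1)
    (h2 : chartMetric h x₀ (u s) (deriv u s) (chartField X x₀ (u s)) = 0) :
    IsNormalAt h X (fun τ => (𝔢 x₀).symm (u τ)) s := by
  have hv : velocity (fun τ => (𝔢 x₀).symm (u τ)) s = chartFrame x₀ (u s) (deriv u s) := by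
    have hd := (hu.differentiableAt (by simp)).hasDerivAt
    rw [(hd.hasMFDerivAt_chart_symm hs).velocity_eq, lineMap_one]
  refine ⟨(contMDiffAt_chart_symm hs).comp s hu.contMDiffAt, ?_, ?_⟩
  · rw [hv]; exact h1
  · rw [hv, ← chartFrame_field X hs]; exact h2

lemma IsNormalAt.deriv_chart_ne_zero {c : ℝ → M} {s : ℝ} (hc : IsNormalAt h X c s) {x₀ : M}
    (hs : c s ∈ (𝔢 x₀).source) : deriv (fun τ => 𝔢 x₀ (c τ)) s ≠ 0 := by
  intro h0
  have := (hc.chart hs).1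
  rw [h0] at this
  simp at this

lemma IsNormalAt.eventually_ne {c : ℝ → M} {s : ℝ} (hc : IsNormalAt h X c s) :
    ∀ᶠ τ in 𝓝[≠] s, c τ ≠ c s := by
  have hs : c s ∈ (𝔢 (c s)).source := mem_extChartAt_source _
  have h1 := ((hc.contMDiffAt.contDiffAt_chart hs).differentiableAt (by simp)).hasDerivAt
  filter_upwards [h1.eventually_ne (c := 𝔢 (c s) (c s)) (hc.deriv_chart_ne_zero hs)] with τ hτ he
  exact hτ (by rw [he])

/-- Having nonzero velocity, the curve leaves the point `c s`, near which there is no other zero. -/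
lemma IsNormalAt.eventually_field_ne_zero [PreconnectedSpace M] (hX : IsKillingField h X)
    (hne : ∃ x, X x ≠ 0) {c : ℝ → M} {s : ℝ} (hc : IsNormalAt h X c s) :
    ∀ᶠ τ in 𝓝[≠] s, X (c τ) ≠ 0 := by
  have h1 : Filter.Tendsto c (𝓝[≠] s) (𝓝[≠] (c s)) :=
    tendsto_nhdsWithin_iff.2 ⟨hc.contMDiffAt.continuousAt.tendsto.mono_left nhdsWithin_le_nhds,
      hc.eventually_ne⟩
  exact h1.eventually (hX.eventually_ne_zero hne (c s))

/-- Unit speed curves orthogonal to a Killing field are geodesics. -/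
theorem IsNormalAt.hasDerivAt_deriv [PreconnectedSpace M] (hX : IsKillingField h X)
    (hne : ∃ x, X x ≠ 0) {c : ℝ → M} {s : ℝ} (hc : ∀ᶠ τ in 𝓝 s, IsNormalAt h X c τ) {x₀ : M}
    (hs : c s ∈ (𝔢 x₀).source) :
    HasDerivAt (deriv fun τ => 𝔢 x₀ (c τ)) (geodesicAcceleration (chartMetric h x₀)
      (𝔢 x₀ (c s), deriv (fun τ => 𝔢 x₀ (c τ)) s)) s := by
  set u : ℝ → E₂ := fun τ => 𝔢 x₀ (c τ) with hu
  have hg := smoothMetricOn_chartMetric h x₀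
  have hK := hX.killingFieldOn x₀
  have hcs := hc.self_of_nhds
  have hus : ContDiffAt ℝ ∞ u s := hcs.contMDiffAt.contDiffAt_chart hs
  have hut : u s ∈ (𝔢 x₀).target := (𝔢 x₀).map_source hs
  have hd1 : ContDiffAt ℝ ∞ (deriv u) s := hus.contDiffAt_deriv
  have hd2 : ContDiffAt ℝ ∞ (deriv (deriv u)) s := hd1.contDiffAt_deriv
  have hcsrc : ∀ᶠ τ in 𝓝 s, c τ ∈ (𝔢 x₀).source :=
    hcs.contMDiffAt.continuousAt.eventually (chartSource_mem_nhds hs)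
  have hgen : ∀ᶠ τ in 𝓝 s, X (c τ) ≠ 0 →
      deriv (deriv u) τ = geodesicAcceleration (chartMetric h x₀) (u τ, deriv u τ) := by
    filter_upwards [(hc.and hcsrc).eventually_nhds] with τ hτ hXτ
    have hτ0 := hτ.self_of_nhds
    have huτ : ContDiffAt ℝ ∞ u τ := hτ0.1.contMDiffAt.contDiffAt_chart hτ0.2
    have e1 : HasDerivAt (fun σ => chartMetric h x₀ (u σ) (deriv u σ) (deriv u σ)) 0 τ := by
      refine (hasDerivAt_const τ (1 : ℝ)).congr_of_eventuallyEq ?_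
      filter_upwards [hτ] with σ hσ
      exact (hσ.1.chart hσ.2).1
    have e2 : HasDerivAt (fun σ => chartMetric h x₀ (u σ) (deriv u σ)
        (chartField X x₀ (u σ))) 0 τ := by
      refine (hasDerivAt_const τ (0 : ℝ)).congr_of_eventuallyEq ?_
      filter_upwards [hτ] with σ hσ
      exact (hσ.1.chart hσ.2).2
    exact hK.acceleration_eq hg finrank_plane ((𝔢 x₀).map_source hτ0.2)
      (huτ.differentiableAt (by simp)).hasDerivAt
      ((huτ.contDiffAt_deriv).differentiableAt (by simp)).hasDerivAt e1 e2
      (hτ0.1.deriv_chart_ne_zero hτ0.2) (fun h0 => hXτ ((chartField_eq_zero_iff X hτ0.2).1 h0))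
      (hτ0.1.chart hτ0.2).2
  have hacc : ContinuousAt (fun τ => geodesicAcceleration (chartMetric h x₀) (u τ, deriv u τ)) s := by
    have h1 : ContDiffAt ℝ ∞ (geodesicAcceleration (chartMetric h x₀)) (u s, deriv u s) :=
      hg.contDiffOn_geodesicAcceleration.contDiffAt
        (((isOpen_chart_target x₀).prod isOpen_univ).mem_nhds ⟨hut, mem_univ _⟩)
    exact ContinuousAt.comp (f := fun τ => (u τ, deriv u τ)) h1.continuousAt
      (hus.continuousAt.prodMk hd1.continuousAt)
  have hev : ∀ᶠ τ in 𝓝[≠] s, deriv (deriv u) τ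
      = geodesicAcceleration (chartMetric h x₀) (u τ, deriv u τ) := by
    filter_upwards [nhdsWithin_le_nhds hgen, hcs.eventually_field_ne_zero hX hne] with τ h1 h2
    exact h1 h2
  -- At a zero of `X` the frame argument breaks down, but zeros are isolated along the curve and
  -- both sides are continuous.
  have hlim : deriv (deriv u) s = geodesicAcceleration (chartMetric h x₀) (u s, deriv u s) :=
    tendsto_nhds_unique (hd2.continuousAt.tendsto.mono_left nhdsWithin_le_nhds)
      ((hacc.tendsto.mono_left nhdsWithin_le_nhds).congr' (hev.mono fun _ h => h.symm))
  rw [← hlim]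
  exact (hd1.differentiableAt (by simp)).hasDerivAt

end Normal

/-! ### Uniqueness of normal curves and their invariance under the flow -/

section NormalCurves

variable {M : Type*} [TopologicalSpace M] [ChartedSpace (EuclideanSpace ℝ (Fin 2)) M]
  [IsManifold (𝓡 2) ∞ M]

local notation "E₂" => EuclideanSpace ℝ (Fin 2)
local notation "𝔢" => extChartAt (𝓡 2)

variable {h : SurfaceMetric M} {X : (x : M) → TangentSpace (𝓡 2) x}

/-- The first-order form of the geodesic equation. -/
noncomputable def geodesicField {E : Type} [NormedAddCommGroup E] [NormedSpace ℝ E]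
    (g : E → E →L[ℝ] E →L[ℝ] ℝ) (p : E × E) : E × E := (p.2, geodesicAcceleration g p)

lemma SmoothMetricOn.contDiffOn_geodesicField {E : Type} [NormedAddCommGroup E] [NormedSpace ℝ E]
    [FiniteDimensional ℝ E] {g : E → E →L[ℝ] E →L[ℝ] ℝ} {U : Set E} (hg : SmoothMetricOn g U) :
    ContDiffOn ℝ ∞ (geodesicField g) (U ×ˢ univ) :=
  contDiffOn_snd.prodMk hg.contDiffOn_geodesicAcceleration

lemma eq_of_chartCoframe_eq {x₀ x : M} (hx : x ∈ (𝔢 x₀).source) {v w : E₂}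
    (hvw : chartCoframe x₀ x v = chartCoframe x₀ x w) : v = w := by
  rw [← chartFrame_coframe hx v, hvw, chartFrame_coframe hx w]

section Uniqueness

variable [PreconnectedSpace M] (hX : IsKillingField h X) (hne : ∃ x, X x ≠ 0)
include hX hne

/-- In a chart both curves solve the geodesic system, which is locally Lipschitz, with the same
initial data. The equation `orth` alone would not give uniqueness at a zero of `X`. -/
lemma IsNormalAt.eventuallyEq {c c' : ℝ → M} {s : ℝ} (hc : ∀ᶠ τ in 𝓝 s, IsNormalAt h X c τ)
    (hc' : ∀ᶠ τ in 𝓝 s, IsNormalAt h X c' τ) (h0 : c s = c' s)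
    (h1 : velocity c s = velocity c' s) : c =ᶠ[𝓝 s] c' := by
  obtain ⟨x₀, hx₀⟩ : ∃ x₀, x₀ = c s := ⟨_, rfl⟩
  have hs : c s ∈ (𝔢 x₀).source := hx₀ ▸ mem_extChartAt_source _
  have hs' : c' s ∈ (𝔢 x₀).source := h0 ▸ hs
  have hg := smoothMetricOn_chartMetric h x₀
  have hsrc : ∀ {c : ℝ → M}, (∀ᶠ τ in 𝓝 s, IsNormalAt h X c τ) → c s ∈ (𝔢 x₀).source →
      ∀ᶠ τ in 𝓝 s, c τ ∈ (𝔢 x₀).source := fun hc hs =>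
    hc.self_of_nhds.contMDiffAt.continuousAt.eventually (chartSource_mem_nhds hs)
  have hode : ∀ {c : ℝ → M}, (∀ᶠ τ in 𝓝 s, IsNormalAt h X c τ) → c s ∈ (𝔢 x₀).source →
      ∀ᶠ τ in 𝓝 s, HasDerivAt (fun τ => (𝔢 x₀ (c τ), deriv (fun τ => 𝔢 x₀ (c τ)) τ))
        (geodesicField (chartMetric h x₀) (𝔢 x₀ (c τ), deriv (fun τ => 𝔢 x₀ (c τ)) τ)) τ := by
    intro c hc hs
    filter_upwards [(hc.and (hsrc hc hs)).eventually_nhds] with τ hτ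
    have hτ0 := hτ.self_of_nhds
    exact ((hτ0.1.contMDiffAt.contDiffAt_chart hτ0.2).differentiableAt (by simp)).hasDerivAt.prodMk
      (IsNormalAt.hasDerivAt_deriv hX hne (hτ.mono fun _ h => h.1) hτ0.2)
  have hcont : ∀ {c : ℝ → M}, IsNormalAt h X c s → c s ∈ (𝔢 x₀).source →
      ContinuousAt (fun τ => (𝔢 x₀ (c τ), deriv (fun τ => 𝔢 x₀ (c τ)) τ)) s := by
    intro c hc hs
    have := hc.contMDiffAt.contDiffAt_chart hs
    exact this.continuousAt.prodMk this.contDiffAt_deriv.continuousAt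
  have hinit : (𝔢 x₀ (c s), deriv (fun τ => 𝔢 x₀ (c τ)) s)
      = (𝔢 x₀ (c' s), deriv (fun τ => 𝔢 x₀ (c' τ)) s) := by
    rw [hc.self_of_nhds.contMDiffAt.deriv_chart hs, hc'.self_of_nhds.contMDiffAt.deriv_chart hs',
      h0, h1]
  have hG : ContDiffAt ℝ ∞ (geodesicField (chartMetric h x₀))
      (𝔢 x₀ (c s), deriv (fun τ => 𝔢 x₀ (c τ)) s) :=
    hg.contDiffOn_geodesicField.contDiffAt (((isOpen_chart_target x₀).prod isOpen_univ).mem_nhds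
      ⟨(𝔢 x₀).map_source hs, mem_univ _⟩)
  obtain ⟨K, T, hT, hL⟩ := (hG.of_le (m := 1) ENat.LEInfty.out).exists_lipschitzOnWith
  have hT' := hT
  rw [hinit] at hT'
  have heq := ODE_solution_unique_of_eventually (v := fun _ => geodesicField (chartMetric h x₀))
    (s := fun _ => T) (Filter.Eventually.of_forall fun _ => hL)
    ((hode hc hs).and ((hcont hc.self_of_nhds hs).eventually hT))
    ((hode hc' hs').and ((hcont hc'.self_of_nhds hs').eventually hT')) hinit
  filter_upwards [heq, hsrc hc hs, hsrc hc' hs'] with τ h1 h2 h3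
  exact (𝔢 x₀).injOn h2 h3 (congrArg Prod.fst h1)

/-- The set near whose points the curves agree is open by definition and closed in `S`, since
positions and velocities agree at limit points and local uniqueness applies there. -/
lemma eqOn_of_isNormalAt [T2Space M] {c c' : ℝ → M} {S : Set ℝ} (hS : IsPreconnected S)
    (hSo : IsOpen S) (hc : ∀ s ∈ S, IsNormalAt h X c s) (hc' : ∀ s ∈ S, IsNormalAt h X c' s)
    {s₀ : ℝ} (hs₀ : s₀ ∈ S) (h0 : c s₀ = c' s₀) (h1 : velocity c s₀ = velocity c' s₀) :
    EqOn c c' S := by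
  have hev : ∀ {c : ℝ → M}, (∀ s ∈ S, IsNormalAt h X c s) → ∀ s ∈ S,
      ∀ᶠ τ in 𝓝 s, IsNormalAt h X c τ := fun hc s hs =>
    Filter.Eventually.mono (hSo.mem_nhds hs) fun τ hτ => hc τ hτ
  have hsub : S ⊆ {s | c =ᶠ[𝓝 s] c'} := by
    refine hS.subset_of_closure_inter_subset isOpen_setOfPred_eventually_nhds
      ⟨s₀, hs₀, IsNormalAt.eventuallyEq hX hne (hev hc _ hs₀) (hev hc' _ hs₀) h0 h1⟩ ?_
    rintro s ⟨hs, hsS⟩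
    have hfreq := mem_closure_iff_frequently.1 hs
    have hcs := hc s hsS
    have hcs' := hc' s hsS
    have e0 : c s = c' s := by
      refine isClosed_diagonal.mem_of_frequently_of_tendsto (x := (c s, c' s))
        (f := fun τ => (c τ, c' τ)) ?_ (hcs.contMDiffAt.continuousAt.prodMk hcs'.contMDiffAt.continuousAt)
      exact hfreq.mono fun τ hτ => hτ.eq_of_nhds
    obtain ⟨x₀, hx₀⟩ : ∃ x₀, x₀ = c s := ⟨_, rfl⟩
    have hs1 : c s ∈ (𝔢 x₀).source := hx₀ ▸ mem_extChartAt_source _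
    have hs2 : c' s ∈ (𝔢 x₀).source := e0 ▸ hs1
    have e1 : deriv (fun τ => 𝔢 x₀ (c τ)) s = deriv (fun τ => 𝔢 x₀ (c' τ)) s := by
      refine isClosed_diagonal.mem_of_frequently_of_tendsto
        (x := (deriv (fun τ => 𝔢 x₀ (c τ)) s, deriv (fun τ => 𝔢 x₀ (c' τ)) s))
        (f := fun τ => (deriv (fun τ => 𝔢 x₀ (c τ)) τ, deriv (fun τ => 𝔢 x₀ (c' τ)) τ)) ?_
        ((hcs.contMDiffAt.contDiffAt_chart hs1).contDiffAt_deriv.continuousAt.prodMk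
          (hcs'.contMDiffAt.contDiffAt_chart hs2).contDiffAt_deriv.continuousAt)
      refine hfreq.mono fun τ hτ => ?_
      exact (hτ.fun_comp (𝔢 x₀)).deriv_eq
    rw [hcs.contMDiffAt.deriv_chart hs1, hcs'.contMDiffAt.deriv_chart hs2, ← e0] at e1
    exact IsNormalAt.eventuallyEq hX hne (hev hc s hsS) (hev hc' s hsS) e0
      (eq_of_chartCoframe_eq hs1 e1)
  exact fun s hs => (hsub hs).eq_of_nhds

end Uniqueness

section Flow

variable {Fl : ℝ → M → M}

lemma contMDiffAt_flow_curve (hF : IsFlow X Fl) {c : ℝ → M} {s : ℝ}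
    (hc : ContMDiffAt 𝓘(ℝ, ℝ) (𝓡 2) ∞ c s) (t : ℝ) :
    ContMDiffAt 𝓘(ℝ, ℝ × ℝ) (𝓡 2) ∞ (fun p : ℝ × ℝ => Fl p.2 (c p.1)) (s, t) := by
  rw [modelWithCornersSelf_prod, ← chartedSpaceSelf_prod]
  exact hF.contMDiff.contMDiffAt.comp (s, t)
    (contMDiffAt_snd.prodMk (hc.comp (s, t) contMDiffAt_fst))

lemma contMDiffAt_flow_curve_left (hF : IsFlow X Fl) {c : ℝ → M} {s : ℝ}
    (hc : ContMDiffAt 𝓘(ℝ, ℝ) (𝓡 2) ∞ c s) (t : ℝ) :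
    ContMDiffAt 𝓘(ℝ, ℝ) (𝓡 2) ∞ (fun s => Fl t (c s)) s :=
  (hF.contMDiff_time t).contMDiffAt.comp s hc

/-- The variational equation along a flow line, in coordinates. -/
lemma hasDerivAt_flow_variation (hX : IsKillingField h X) (hF : IsFlow X Fl) {c : ℝ → M} {s t : ℝ}
    (hc : ContMDiffAt 𝓘(ℝ, ℝ) (𝓡 2) ∞ c s) {x₀ : M} (hs : Fl t (c s) ∈ (𝔢 x₀).source) :
    HasDerivAt (fun t => deriv (fun s => 𝔢 x₀ (Fl t (c s))) s)
      (fderiv ℝ (chartField X x₀) (𝔢 x₀ (Fl t (c s)))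
        (deriv (fun s => 𝔢 x₀ (Fl t (c s))) s)) t := by
  have hu : ContMDiffAt 𝓘(ℝ, ℝ × ℝ) 𝓘(ℝ, E₂) ∞ (fun p : ℝ × ℝ => 𝔢 x₀ (Fl p.2 (c p.1))) (s, t) :=
    (contMDiffAt_chart (x := Fl t (c s)) hs).comp (s, t) (contMDiffAt_flow_curve hF hc t)
  refine hasDerivAt_variation (u := fun p => 𝔢 x₀ (Fl p.2 (c p.1)))
    (contMDiffAt_iff_contDiffAt.1 hu)
    (((hX.killingFieldOn x₀).contDiffAt (smoothMetricOn_chartMetric h x₀)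
      ((𝔢 x₀).map_source hs)).differentiableAt (by simp)) ?_
  filter_upwards [(contMDiffAt_flow_curve hF hc t).continuousAt.eventually
    (chartSource_mem_nhds (x := Fl t (c s)) hs)] with p hp
  exact (hF.integral (c p.1)).hasDerivAt_chart hp

/-- The flow of a Killing field preserves normal curves. -/
theorem IsNormalAt.flow (hX : IsKillingField h X) (hF : IsFlow X Fl) {c : ℝ → M} {s : ℝ}
    (hc : IsNormalAt h X c s) (t : ℝ) : IsNormalAt h X (fun s => Fl t (c s)) s := by
  set P : ℝ → ℝ := fun t => innerAt h (Fl t (c s)) (velocity (fun s => Fl t (c s)) s)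
    (velocity (fun s => Fl t (c s)) s) with hP
  set Q : ℝ → ℝ := fun t => innerAt h (Fl t (c s)) (velocity (fun s => Fl t (c s)) s)
    (fieldAt X (Fl t (c s))) with hQ
  -- The velocity of the transported curve is a variation field of the flow, so Killing's equation
  -- makes both its length and its product with `X` constant in `t`.
  have key : ∀ t, HasDerivAt P 0 t ∧ HasDerivAt Q 0 t := by
    intro t₁
    obtain ⟨x₀, hx₀⟩ : ∃ x₀, x₀ = Fl t₁ (c s) := ⟨_, rfl⟩
    have hs : Fl t₁ (c s) ∈ (𝔢 x₀).source := hx₀ ▸ mem_extChartAt_source _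
    have hg := smoothMetricOn_chartMetric h x₀
    have hJ := hasDerivAt_flow_variation hX hF hc.contMDiffAt hs
    have hu := (hF.integral (c s)).hasDerivAt_chart hs
    have hut := (𝔢 x₀).map_source hs
    have hev : ∀ᶠ t in 𝓝 t₁, Fl t (c s) ∈ (𝔢 x₀).source :=
      (hF.integral (c s)).continuous.continuousAt.eventually (chartSource_mem_nhds hs)
    constructor
    · refine ((hX.killingFieldOn x₀).hasDerivAt_variation_self hg hut hu hJ).congr_of_eventuallyEq ?_
      filter_upwards [hev] with t ht
      rw [hP]
      simp only
      rw [(contMDiffAt_flow_curve_left hF hc.contMDiffAt t).deriv_chart ht,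
        chartMetric_coframe h ht]
    · refine ((hX.killingFieldOn x₀).hasDerivAt_variation_field hg hut hu
        hJ).congr_of_eventuallyEq ?_
      filter_upwards [hev] with t ht
      rw [hQ]
      simp only
      rw [(contMDiffAt_flow_curve_left hF hc.contMDiffAt t).deriv_chart ht,
        chartField_eq_coframe X ht, chartMetric_coframe h ht]
  have hP0 : P t = P 0 := is_const_of_deriv_eq_zero (fun t => (key t).1.differentiableAt)
    (fun t => (key t).1.deriv) t 0
  have hQ0 : Q t = Q 0 := is_const_of_deriv_eq_zero (fun t => (key t).2.differentiableAt)
    (fun t => (key t).2.deriv) t 0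
  refine ⟨contMDiffAt_flow_curve_left hF hc.contMDiffAt t, hP0.trans ?_, hQ0.trans ?_⟩
  · rw [hP]; simp only [hF.zero]; exact hc.unit
  · rw [hQ]; simp only [hF.zero]; exact hc.orth

end Flow

end NormalCurves

/-! ### Existence of normal curves for all time -/

section NormalCurveExistence

variable {M : Type*} [TopologicalSpace M] [ChartedSpace (EuclideanSpace ℝ (Fin 2)) M]
  [IsManifold (𝓡 2) ∞ M]

local notation "E₂" => EuclideanSpace ℝ (Fin 2)
local notation "𝔢" => extChartAt (𝓡 2)

variable {h : SurfaceMetric M} {X : (x : M) → TangentSpace (𝓡 2) x}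

lemma velocity_comp {c : ℝ → M} {f : ℝ → ℝ} {f' s : ℝ} (hf : HasDerivAt f f' s)
    (hc : MDifferentiableAt 𝓘(ℝ, ℝ) (𝓡 2) c (f s)) :
    velocity (fun τ => c (f τ)) s = f' • velocity c (f s) := by
  have h1 := hc.hasMFDerivAt.comp s hf.hasFDerivAt.hasMFDerivAt
  refine h1.velocity_eq.trans ?_
  have h2 : (mfderiv 𝓘(ℝ, ℝ) (𝓡 2) c (f s) : ℝ →L[ℝ] E₂) (f' • (1 : ℝ)) = f' • velocity c (f s) :=
    map_smul _ _ _
  have h3 : ContinuousLinearMap.toSpanSingleton ℝ f' (1 : ℝ) = f' • (1 : ℝ) := by simp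
  exact (congrArg (mfderiv 𝓘(ℝ, ℝ) (𝓡 2) c (f s) : ℝ →L[ℝ] E₂) h3).trans h2

lemma IsNormalAt.comp_add {c : ℝ → M} {s a : ℝ} (hc : IsNormalAt h X c (s + a)) :
    IsNormalAt h X (fun τ => c (τ + a)) s := by
  have hv : velocity (fun τ => c (τ + a)) s = velocity c (s + a) := by
    rw [velocity_comp (f := fun τ => τ + a) ((hasDerivAt_id s).add_const a)
      (hc.contMDiffAt.mdifferentiableAt (by simp)), one_smul]
  have hf : ContMDiffAt 𝓘(ℝ, ℝ) 𝓘(ℝ, ℝ) ∞ (fun τ : ℝ => τ + a) s :=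
    (contDiffAt_id.add contDiffAt_const).contMDiffAt
  refine ⟨ContMDiffAt.comp (g := c) (f := fun τ : ℝ => τ + a) s hc.contMDiffAt hf, ?_, ?_⟩
  · rw [hv]; exact hc.unit
  · rw [hv]; exact hc.orth

/-- Normal curves are produced as geodesics: constancy of the speed and Clairaut's relation preserve
the two initial conditions. The lifetime is uniform in the base point near `x₀` and in the unit
vector. -/
lemma exists_local_normal (hX : IsKillingField h X) (x₀ : M) : ∃ δ > 0, ∃ W ∈ 𝓝 x₀, ∀ y ∈ W,
    ∀ v, innerAt h y v v = 1 → innerAt h y v (fieldAt X y) = 0 →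
      ∃ c : ℝ → M, (∀ s ∈ Ioo (-δ) δ, IsNormalAt h X c s) ∧ c 0 = y ∧ velocity c 0 = v := by
  have hg := smoothMetricOn_chartMetric h x₀
  have hK := hX.killingFieldOn x₀
  have hx₀ : x₀ ∈ (𝔢 x₀).source := mem_extChartAt_source x₀
  have ht₀ : 𝔢 x₀ x₀ ∈ (𝔢 x₀).target := mem_extChartAt_target x₀
  have hOpen : IsOpen ((𝔢 x₀).target ×ˢ (univ : Set E₂)) :=
    (isOpen_chart_target x₀).prod isOpen_univ
  have hmem : (𝔢 x₀ x₀, (0 : E₂)) ∈ (𝔢 x₀).target ×ˢ (univ : Set E₂) := ⟨ht₀, mem_univ _⟩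
  obtain ⟨r, hr, φ, hφ, hφ'⟩ := exists_local_flow hOpen hg.contDiffOn_geodesicField hmem
    (hOpen.mem_nhds hmem)
  obtain ⟨m, hm, hge⟩ := hg.eventually_ge ht₀
  -- The local geodesic flow accepts only velocities of norm less than `r`. A unit vector has
  -- coordinate norm at most `1 / √m`, so scaling by `l` brings it within `r / 2`; time is then
  -- rescaled by `l⁻¹`.
  set l : ℝ := r / 2 * √m with hl
  have hsm : 0 < √m := Real.sqrt_pos.2 hm
  have hl0 : 0 < l := by positivity
  refine ⟨l * r, by positivity, _, Filter.inter_mem (chartSource_mem_nhds hx₀)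
    (Filter.inter_mem ((continuousAt_chart hx₀).preimage_mem_nhds (Metric.ball_mem_nhds _ hr))
      (eventually_of_chart hx₀ hge)), ?_⟩
  rintro y ⟨hy, hyb, hym⟩ v hv1 hv2
  have hyt := (𝔢 x₀).map_source hy
  set a : E₂ := chartCoframe x₀ y v with ha
  have ha1 : chartMetric h x₀ (𝔢 x₀ y) a a = 1 := by rw [ha, chartMetric_coframe h hy, hv1]
  have ha2 : chartMetric h x₀ (𝔢 x₀ y) a (chartField X x₀ (𝔢 x₀ y)) = 0 := by
    rw [ha, chartField_eq_coframe X hy, chartMetric_coframe h hy, hv2]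
  have hla : ‖l • a‖ < r := by
    have h1 : m * ‖a‖ ^ 2 ≤ 1 := ha1 ▸ hym a
    have h2 : √m * ‖a‖ ≤ 1 := by
      refine abs_le_of_sq_le_sq' (a := √m * ‖a‖) ?_ zero_le_one |>.2
      rw [mul_pow, Real.sq_sqrt hm.le, one_pow]
      exact h1
    rw [norm_smul, Real.norm_of_nonneg hl0.le, hl, mul_assoc]
    nlinarith
  have hp : (𝔢 x₀ y, l • a) ∈ Metric.ball (𝔢 x₀ x₀, (0 : E₂)) r := by
    rw [← ball_prod_same]
    exact ⟨hyb, by simpa using hla⟩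
  obtain ⟨hw0, hw⟩ := hφ' _ hp
  set w : ℝ → E₂ × E₂ := fun σ => φ σ (𝔢 x₀ y, l • a) with hwdef
  have hw0' : w 0 = (𝔢 x₀ y, l • a) := hw0
  have hw1 : ∀ σ ∈ Ioo (-r) r, HasDerivAt (fun σ => (w σ).1) (w σ).2 σ := fun σ hσ => by
    exact (ContinuousLinearMap.fst ℝ E₂ E₂).hasFDerivAt.comp_hasDerivAt σ (hw σ hσ).2
  have hw2 : ∀ σ ∈ Ioo (-r) r, HasDerivAt (fun σ => (w σ).2)
      (geodesicAcceleration (chartMetric h x₀) ((w σ).1, (w σ).2)) σ := fun σ hσ => by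
    exact (ContinuousLinearMap.snd ℝ E₂ E₂).hasFDerivAt.comp_hasDerivAt σ (hw σ hσ).2
  have h0r : (0 : ℝ) ∈ Ioo (-r) r := ⟨by linarith, hr⟩
  have hconst : ∀ P : ℝ → ℝ, (∀ σ ∈ Ioo (-r) r, HasDerivAt P 0 σ) →
      ∀ σ ∈ Ioo (-r) r, P σ = P 0 := by
    intro P hP σ hσ
    exact isOpen_Ioo.is_const_of_deriv_eq_zero isPreconnected_Ioo
      (fun τ hτ => (hP τ hτ).differentiableAt.differentiableWithinAt)
      (fun τ hτ => (hP τ hτ).deriv) hσ h0r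
  have hspeed : ∀ σ ∈ Ioo (-r) r, chartMetric h x₀ (w σ).1 (w σ).2 (w σ).2 = l ^ 2 := by
    intro σ hσ
    rw [hconst (fun σ => chartMetric h x₀ (w σ).1 (w σ).2 (w σ).2) (fun τ hτ =>
      hg.hasDerivAt_speed (u := fun τ => (w τ).1) (v := fun τ => (w τ).2) (hw τ hτ).1.1
        (hw1 τ hτ) (hw2 τ hτ)) σ hσ, hw0']
    simp only [map_smul, smul_apply, smul_eq_mul, ha1]
    ring
  have hmom : ∀ σ ∈ Ioo (-r) r, chartMetric h x₀ (w σ).1 (w σ).2 (chartField X x₀ (w σ).1) = 0 := by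
    intro σ hσ
    rw [hconst (fun σ => chartMetric h x₀ (w σ).1 (w σ).2 (chartField X x₀ (w σ).1)) (fun τ hτ =>
      hK.hasDerivAt_momentum hg (u := fun τ => (w τ).1) (v := fun τ => (w τ).2) (hw τ hτ).1.1
        (hw1 τ hτ) (hw2 τ hτ)) σ hσ, hw0']
    simp only [map_smul, smul_apply, smul_eq_mul, ha2, mul_zero]
  have hdiv : ∀ s ∈ Ioo (-(l * r)) (l * r), l⁻¹ * s ∈ Ioo (-r) r := by
    rintro s ⟨h1, h2⟩
    rw [inv_mul_eq_div]
    exact ⟨by rw [lt_div_iff₀ hl0]; linarith, by rw [div_lt_iff₀ hl0]; linarith⟩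
  have hu : ∀ s ∈ Ioo (-(l * r)) (l * r),
      HasDerivAt (fun s => (w (l⁻¹ * s)).1) (l⁻¹ • (w (l⁻¹ * s)).2) s := by
    intro s hs
    have := (hw1 _ (hdiv s hs)).scomp s ((hasDerivAt_id s).const_mul l⁻¹)
    simpa [Function.comp_def] using this
  have hus : ∀ s ∈ Ioo (-(l * r)) (l * r), ContDiffAt ℝ ∞ (fun s => (w (l⁻¹ * s)).1) s := by
    intro s hs
    have h1 : ContDiffAt ℝ ∞ (Function.uncurry φ) (l⁻¹ * s, (𝔢 x₀ y, l • a)) :=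
      hφ.contDiffAt ((isOpen_Ioo.prod Metric.isOpen_ball).mem_nhds ⟨hdiv s hs, hp⟩)
    exact (h1.comp s (f := fun s => (l⁻¹ * s, (𝔢 x₀ y, l • a)))
      ((contDiffAt_const.mul contDiffAt_id).prodMk contDiffAt_const)).fst
  have h0lr : (0 : ℝ) ∈ Ioo (-(l * r)) (l * r) := ⟨by nlinarith, by positivity⟩
  refine ⟨fun s => (𝔢 x₀).symm (w (l⁻¹ * s)).1, ?_, ?_, ?_⟩
  · intro s hs
    refine isNormalAt_chart_symm (hus s hs) (hw _ (hdiv s hs)).1.1 ?_ ?_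
    · rw [(hu s hs).deriv]
      simp only [map_smul, smul_apply, smul_eq_mul, hspeed _ (hdiv s hs)]
      field_simp
    · rw [(hu s hs).deriv]
      simp only [map_smul, smul_apply, smul_eq_mul, hmom _ (hdiv s hs), mul_zero]
  · simp only [mul_zero, hw0']
    exact (𝔢 x₀).left_inv hy
  · rw [((hu 0 h0lr).hasMFDerivAt_chart_symm (hw _ (hdiv 0 h0lr)).1.1).velocity_eq, lineMap_one]
    simp only [mul_zero, hw0']
    rw [smul_smul, inv_mul_cancel₀ hl0.ne', one_smul, ha, chartFrame_coframe hy]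

variable [CompactSpace M] [T2Space M]

lemma exists_uniform_local_normal (hX : IsKillingField h X) : ∃ ε > 0, ∀ y : M,
    ∀ v, innerAt h y v v = 1 → innerAt h y v (fieldAt X y) = 0 →
      ∃ c : ℝ → M, (∀ s ∈ Ioo (-ε) ε, IsNormalAt h X c s) ∧ c 0 = y ∧ velocity c 0 = v := by
  classical
  choose δ hδ W hW hc using exists_local_normal hX
  obtain ⟨F, hF⟩ := isCompact_univ.elim_nhds_subcover W (fun x _ => hW x)
  have hε : ∃ ε > 0, ∀ x ∈ F, ε ≤ δ x := by
    clear hF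
    induction F using Finset.induction_on with
    | empty => exact ⟨1, one_pos, by simp⟩
    | insert a F _ ih =>
      obtain ⟨ε, h1, h2⟩ := ih
      refine ⟨min ε (δ a), lt_min h1 (hδ a), fun x hx => ?_⟩
      rcases Finset.mem_insert.1 hx with rfl | hx
      · exact min_le_right _ _
      · exact (min_le_left _ _).trans (h2 x hx)
  obtain ⟨ε, hε, hle⟩ := hε
  refine ⟨ε, hε, fun y v h1 h2 => ?_⟩
  obtain ⟨x, hx, hyx⟩ := mem_iUnion₂.1 (hF.2 (mem_univ y))
  obtain ⟨c, hcn, hc0, hcv⟩ := hc x y hyx v h1 h2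
  exact ⟨c, fun s hs => hcn s ⟨by linarith [hs.1, hle x hx], by linarith [hs.2, hle x hx]⟩, hc0, hcv⟩

variable [PreconnectedSpace M]

lemma exists_normal_extend (hX : IsKillingField h X) (hne : ∃ x, X x ≠ 0) {ε : ℝ} (hε : 0 < ε)
    (hloc : ∀ y : M, ∀ v, innerAt h y v v = 1 → innerAt h y v (fieldAt X y) = 0 →
      ∃ c : ℝ → M, (∀ s ∈ Ioo (-ε) ε, IsNormalAt h X c s) ∧ c 0 = y ∧ velocity c 0 = v)
    {a : ℝ} (ha : ε ≤ a) {c : ℝ → M} (hc : ∀ s ∈ Ioo (-a) a, IsNormalAt h X c s) :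
    ∃ c' : ℝ → M, (∀ s ∈ Ioo (-(a + ε / 2)) (a + ε / 2), IsNormalAt h X c' s) ∧ c' =ᶠ[𝓝 0] c := by
  -- Local curves of lifetime `ε` started at `±b` reach `±(a + ε / 2)`, and by uniqueness they agree
  -- with `c` near `±b`, where the pieces are joined.
  set b := a - ε / 2 with hb
  have hb0 : 0 < b := by linarith
  have hglue : ∀ b ∈ Ioo (-a) a, ∃ d : ℝ → M, (∀ s ∈ Ioo (b - ε) (b + ε), IsNormalAt h X d s) ∧
      d =ᶠ[𝓝 b] c := by
    intro b hbm
    obtain ⟨d, hd, hd0, hdv⟩ := hloc (c b) (velocity c b) (hc b hbm).unit (hc b hbm).orth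
    have hd' : ∀ s ∈ Ioo (b - ε) (b + ε), IsNormalAt h X (fun τ => d (τ + -b)) s := fun s hs =>
      (hd (s + -b) ⟨by linarith [hs.1], by linarith [hs.2]⟩).comp_add
    refine ⟨_, hd', ?_⟩
    have hdd : MDifferentiableAt 𝓘(ℝ, ℝ) (𝓡 2) d (b + -b) := by
      rw [add_neg_cancel]
      exact (hd 0 ⟨by linarith, hε⟩).contMDiffAt.mdifferentiableAt (by simp)
    refine IsNormalAt.eventuallyEq hX hne
      (Filter.Eventually.mono (isOpen_Ioo.mem_nhds ⟨by linarith, by linarith⟩) hd')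
      (Filter.Eventually.mono (isOpen_Ioo.mem_nhds hbm) hc) ?_ ?_
    · simp [hd0]
    · rw [velocity_comp (f := fun τ => τ + -b) ((hasDerivAt_id b).add_const (-b)) hdd, one_smul]
      simp [hdv]
  obtain ⟨d₁, hd₁, he₁⟩ := hglue b ⟨by linarith, by linarith⟩
  obtain ⟨d₂, hd₂, he₂⟩ := hglue (-b) ⟨by linarith, by linarith⟩
  have hmid : ∀ s ∈ Ioo (-b) b, (fun s => if b < s then d₁ s else if s < -b then d₂ s else c s)
      =ᶠ[𝓝 s] c := by
    intro s hs
    filter_upwards [isOpen_Ioo.mem_nhds hs] with τ hτ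
    rw [if_neg hτ.2.not_gt, if_neg hτ.1.not_gt]
  refine ⟨fun s => if b < s then d₁ s else if s < -b then d₂ s else c s, ?_,
    hmid 0 ⟨by linarith, hb0⟩⟩
  rintro s ⟨hs1, hs2⟩
  rcases lt_trichotomy b s with hbs | rfl | hbs
  · refine (hd₁ s ⟨by linarith, by linarith⟩).congr ?_
    filter_upwards [isOpen_Ioi.mem_nhds hbs] with τ hτ
    exact if_pos hτ
  · refine (hc b ⟨by linarith, by linarith⟩).congr ?_
    filter_upwards [he₁, isOpen_Ioi.mem_nhds (show -b < b by linarith)] with τ hτ hτ'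
    by_cases hbτ : b < τ
    · rw [if_pos hbτ, hτ]
    · rw [if_neg hbτ, if_neg (not_lt.2 (le_of_lt hτ'))]
  · rcases lt_trichotomy s (-b) with hbs' | rfl | hbs'
    · refine (hd₂ s ⟨by linarith, by linarith⟩).congr ?_
      filter_upwards [isOpen_Iio.mem_nhds hbs'] with τ hτ
      rw [if_neg (not_lt.2 (le_of_lt (lt_trans hτ (by linarith)))), if_pos (mem_Iio.1 hτ)]
    · refine (hc (-b) ⟨by linarith, by linarith⟩).congr ?_
      filter_upwards [he₂, isOpen_Iio.mem_nhds (show -b < b by linarith)] with τ hτ hτ'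
      rw [if_neg (not_lt.2 (le_of_lt hτ'))]
      by_cases hbτ : τ < -b
      · rw [if_pos hbτ, hτ]
      · rw [if_neg hbτ]
    · exact (hc s ⟨by linarith, by linarith⟩).congr (hmid s ⟨hbs', hbs⟩)

theorem exists_normal (hX : IsKillingField h X) (hne : ∃ x, X x ≠ 0) (y : M) (v : E₂)
    (h1 : innerAt h y v v = 1) (h2 : innerAt h y v (fieldAt X y) = 0) :
    ∃ c : ℝ → M, (∀ s, IsNormalAt h X c s) ∧ c 0 = y ∧ velocity c 0 = v := by
  obtain ⟨ε, hε, hloc⟩ := exists_uniform_local_normal hX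
  have hn : ∀ n : ℕ, ∃ c : ℝ → M,
      (∀ s ∈ Ioo (-(ε + n * (ε / 2))) (ε + n * (ε / 2)), IsNormalAt h X c s) ∧ c 0 = y ∧
      velocity c 0 = v := by
    intro n
    induction n with
    | zero => simpa using hloc y v h1 h2
    | succ n ih =>
      obtain ⟨c, hc, hc0, hcv⟩ := ih
      obtain ⟨c', hc', he⟩ := exists_normal_extend hX hne hε hloc
        (le_add_of_nonneg_right (by positivity)) hc
      refine ⟨c', fun s hs => hc' s ?_, he.eq_of_nhds.trans hc0, (velocity_congr he).trans hcv⟩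
      push_cast at hs
      exact ⟨by linarith [hs.1], by linarith [hs.2]⟩
  choose c hc hc0 hcv using hn
  have hmono : ∀ n m : ℕ, n ≤ m → EqOn (c n) (c m) (Ioo (-(ε + n * (ε / 2))) (ε + n * (ε / 2))) := by
    intro n m hnm
    have hle : ε + n * (ε / 2) ≤ ε + m * (ε / 2) := by
      have : (n : ℝ) ≤ m := by exact_mod_cast hnm
      gcongr
    have hp : 0 < ε + n * (ε / 2) := by positivity
    exact eqOn_of_isNormalAt hX hne isPreconnected_Ioo isOpen_Ioo (hc n)
      (fun s hs => hc m s ⟨by linarith [hs.1], by linarith [hs.2]⟩) (s₀ := 0) ⟨by linarith, hp⟩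
      ((hc0 n).trans (hc0 m).symm) ((hcv n).trans (hcv m).symm)
  have hex : ∀ s : ℝ, ∃ n : ℕ, s ∈ Ioo (-(ε + n * (ε / 2))) (ε + n * (ε / 2)) := by
    intro s
    obtain ⟨n, hn⟩ := exists_nat_gt (|s| / (ε / 2))
    rw [div_lt_iff₀ (by positivity)] at hn
    exact ⟨n, abs_lt.1 (by linarith)⟩
  choose N hN using hex
  have hloc' : ∀ s, (fun s => c (N s) s) =ᶠ[𝓝 s] c (N s) := by
    intro s
    filter_upwards [isOpen_Ioo.mem_nhds (hN s)] with τ hτ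
    rcases le_total (N τ) (N s) with hle | hle
    · exact hmono _ _ hle (hN τ)
    · exact (hmono _ _ hle hτ).symm
  refine ⟨fun s => c (N s) s, fun s => (hc (N s) s (hN s)).congr (hloc' s), hc0 _, ?_⟩
  rw [velocity_congr (hloc' 0), hcv]

end NormalCurveExistence

/-! ### The Hamiltonian of a Killing field -/

section Hamiltonian

variable {M : Type*} [TopologicalSpace M] [ChartedSpace (EuclideanSpace ℝ (Fin 2)) M]
  [IsManifold (𝓡 2) ∞ M]

local notation "E₂" => EuclideanSpace ℝ (Fin 2)
local notation "𝔢" => extChartAt (𝓡 2)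

variable {h : SurfaceMetric M} {X : (x : M) → TangentSpace (𝓡 2) x}

/-- The differential of a function on a surface. -/
noncomputable def differentialAt (H : M → ℝ) (x : M) : E₂ →L[ℝ] ℝ := mfderiv (𝓡 2) 𝓘(ℝ, ℝ) H x

lemma HasMFDerivAt.hasDerivAt_comp {H : M → ℝ} {c : ℝ → M} {s : ℝ} {L : ℝ →L[ℝ] E₂}
    (hc : HasMFDerivAt 𝓘(ℝ, ℝ) (𝓡 2) c s L) (hH : ContMDiffAt (𝓡 2) 𝓘(ℝ, ℝ) ∞ H (c s)) :
    HasDerivAt (fun τ => H (c τ)) (differentialAt H (c s) (L 1)) s := by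
  have h1 := (hH.mdifferentiableAt (by simp)).hasMFDerivAt.comp s hc
  have h2 : HasFDerivAt (fun τ => H (c τ)) ((differentialAt H (c s)).comp L) s :=
    hasMFDerivAt_iff_hasFDerivAt.1 h1
  exact h2.hasDerivAt

lemma ContMDiffAt.hasFDerivAt_chart_symm {H : M → ℝ} {x₀ : M} {y : E₂} (hy : y ∈ (𝔢 x₀).target)
    (hH : ContMDiffAt (𝓡 2) 𝓘(ℝ, ℝ) ∞ H ((𝔢 x₀).symm y)) :
    ContDiffAt ℝ ∞ (fun y => H ((𝔢 x₀).symm y)) y ∧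
    HasFDerivAt (fun y => H ((𝔢 x₀).symm y))
      ((differentialAt H ((𝔢 x₀).symm y)).comp (chartFrame x₀ y)) y := by
  have h0 := contMDiffAt_chart_symm hy
  refine ⟨contMDiffAt_iff_contDiffAt.1 (hH.comp y h0), ?_⟩
  exact hasMFDerivAt_iff_hasFDerivAt.1 ((hH.mdifferentiableAt (by simp)).hasMFDerivAt.comp y
    (h0.mdifferentiableAt (by simp)).hasMFDerivAt)

lemma ContDiffAt.differentialAt_comp_chart {f : E₂ → ℝ} {x₀ x : M} (hx : x ∈ (𝔢 x₀).source)
    (hf : ContDiffAt ℝ ∞ f (𝔢 x₀ x)) :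
    ContMDiffAt (𝓡 2) 𝓘(ℝ, ℝ) ∞ (fun x => f (𝔢 x₀ x)) x ∧
    differentialAt (fun x => f (𝔢 x₀ x)) x = (fderiv ℝ f (𝔢 x₀ x)).comp (chartCoframe x₀ x) := by
  have h0 := contMDiffAt_chart hx
  refine ⟨hf.contMDiffAt.comp x h0, ?_⟩
  exact ((hf.differentiableAt (by simp)).hasFDerivAt.hasMFDerivAt.comp x
    (h0.mdifferentiableAt (by simp)).hasMFDerivAt).mfderiv

variable (h X) in
/-- `H` is smooth at `x`, and its differential is, up to sign, the contraction of the area form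
with `X`. -/
structure IsHamiltonianAt (H : M → ℝ) (x : M) : Prop where
  contMDiffAt : ContMDiffAt (𝓡 2) 𝓘(ℝ, ℝ) ∞ H x
  sq_eq : ∀ v, differentialAt H x v ^ 2 = innerAt h x (fieldAt X x) (fieldAt X x) * innerAt h x v v
    - innerAt h x (fieldAt X x) v ^ 2

lemma IsHamiltonianAt.congr {H H' : M → ℝ} {x : M} (hH : IsHamiltonianAt h X H x)
    (he : H' =ᶠ[𝓝 x] H) : IsHamiltonianAt h X H' x := by
  refine ⟨hH.contMDiffAt.congr_of_eventuallyEq he, fun v => ?_⟩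
  have : differentialAt H' x = differentialAt H x := by
    rw [differentialAt, differentialAt, he.mfderiv_eq]
  rw [this]
  exact hH.sq_eq v

lemma IsHamiltonianAt.chart {H : M → ℝ} {x₀ : M} {y : E₂} (hy : y ∈ (𝔢 x₀).target)
    (hH : IsHamiltonianAt h X H ((𝔢 x₀).symm y)) (w : E₂) :
    fderiv ℝ (fun y => H ((𝔢 x₀).symm y)) y w ^ 2
      = chartMetric h x₀ y (chartField X x₀ y) (chartField X x₀ y) * chartMetric h x₀ y w w
        - chartMetric h x₀ y (chartField X x₀ y) w ^ 2 := by
  rw [(hH.contMDiffAt.hasFDerivAt_chart_symm hy).2.fderiv, ContinuousLinearMap.comp_apply,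
    hH.sq_eq, chartMetric_apply, chartMetric_apply, chartMetric_apply, chartFrame_field X hy]

lemma isHamiltonianAt_comp_chart {f : E₂ → ℝ} {x₀ x : M} (hx : x ∈ (𝔢 x₀).source)
    (hf : ContDiffAt ℝ ∞ f (𝔢 x₀ x))
    (hsq : ∀ w, fderiv ℝ f (𝔢 x₀ x) w ^ 2 = chartMetric h x₀ (𝔢 x₀ x) (chartField X x₀ (𝔢 x₀ x))
      (chartField X x₀ (𝔢 x₀ x)) * chartMetric h x₀ (𝔢 x₀ x) w w
        - chartMetric h x₀ (𝔢 x₀ x) (chartField X x₀ (𝔢 x₀ x)) w ^ 2) :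
    IsHamiltonianAt h X (fun x => f (𝔢 x₀ x)) x := by
  refine ⟨(hf.differentialAt_comp_chart hx).1, fun v => ?_⟩
  rw [(hf.differentialAt_comp_chart hx).2, ContinuousLinearMap.comp_apply, hsq,
    chartField_eq_coframe X hx, chartMetric_coframe h hx, chartMetric_coframe h hx,
    chartMetric_coframe h hx]

lemma exists_local_hamiltonian (hX : IsKillingField h X) (x₀ : M) :
    ∃ U, IsOpen U ∧ x₀ ∈ U ∧ ∃ H, ∀ x ∈ U, IsHamiltonianAt h X H x := by
  have hx₀ : x₀ ∈ (𝔢 x₀).source := mem_extChartAt_source x₀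
  obtain ⟨r, hr, hsub⟩ := Metric.isOpen_iff.1 (isOpen_chart_target x₀) _ (mem_extChartAt_target x₀)
  obtain ⟨f, hf, hf'⟩ := (hX.killingFieldOn x₀).exists_hamiltonian (smoothMetricOn_chartMetric h x₀)
    (convex_ball (𝔢 x₀ x₀) r) Metric.isOpen_ball hsub
  refine ⟨(𝔢 x₀).source ∩ 𝔢 x₀ ⁻¹' Metric.ball (𝔢 x₀ x₀) r,
    (continuousOn_extChartAt x₀).isOpen_inter_preimage (isOpen_extChartAt_source x₀)
      Metric.isOpen_ball, ⟨hx₀, Metric.mem_ball_self hr⟩, fun x => f (𝔢 x₀ x), ?_⟩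
  rintro x ⟨hx, hxb⟩
  exact isHamiltonianAt_comp_chart hx (hf.contDiffAt (Metric.isOpen_ball.mem_nhds hxb)) (hf' _ hxb)

lemma IsHamiltonianAt.neg_add_const {H : M → ℝ} {x : M} (hH : IsHamiltonianAt h X H x) {ε : ℝ}
    (hε : ε = 1 ∨ ε = -1) (k : ℝ) : IsHamiltonianAt h X (fun x => ε * H x + k) x := by
  have hd : differentialAt (fun x => ε * H x + k) x = ε • differentialAt H x := by
    have h1 : HasFDerivAt (fun y : ℝ => ε * y + k) (ε • ContinuousLinearMap.id ℝ ℝ) (H x) :=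
      ((hasFDerivAt_id (H x)).const_mul ε).add_const k
    have h2 := (h1.hasMFDerivAt.comp x
      (hH.contMDiffAt.mdifferentiableAt (by simp)).hasMFDerivAt).mfderiv
    refine Eq.trans h2 ?_
    ext v
    rfl
  refine ⟨?_, fun v => ?_⟩
  · have : ContMDiff 𝓘(ℝ, ℝ) 𝓘(ℝ, ℝ) ∞ (fun y : ℝ => ε * y + k) :=
      ((contDiff_const.mul contDiff_id).add contDiff_const).contMDiff
    exact this.contMDiffAt.comp x hH.contMDiffAt
  · rw [hd, smul_apply, smul_eq_mul, mul_pow, hH.sq_eq]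
    rcases hε with rfl | rfl <;> ring

/-- A vector space is not the union of the two proper subspaces where `f = g` and where `f = -g`;
the sum of a vector off the first and one off the second gives the contradiction. -/
lemma ContinuousLinearMap.eq_or_eq_neg_of_sq_eq {E : Type*} [NormedAddCommGroup E]
    [NormedSpace ℝ E] {f g : E →L[ℝ] ℝ} (hfg : ∀ v, f v ^ 2 = g v ^ 2) : f = g ∨ f = -g := by
  by_contra hcon
  push Not at hcon
  obtain ⟨v, hv⟩ : ∃ v, f v ≠ g v := by
    by_contra hall; push Not at hall; exact hcon.1 (ContinuousLinearMap.ext hall)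
  obtain ⟨w, hw⟩ : ∃ w, f w ≠ -g w := by
    by_contra hall; push Not at hall; exact hcon.2 (ContinuousLinearMap.ext hall)
  have h1 : f v = - g v := (sq_eq_sq_iff_eq_or_eq_neg.1 (hfg v)).resolve_left hv
  have h2 : f w = g w := (sq_eq_sq_iff_eq_or_eq_neg.1 (hfg w)).resolve_right hw
  have h3 := hfg (v + w)
  rw [map_add, map_add, h1, h2] at h3
  have h4 : g v * g w = 0 := by nlinarith
  rcases mul_eq_zero.1 h4 with h5 | h5
  · exact hv (by rw [h1, h5, neg_zero])
  · exact hw (by rw [h2, h5, neg_zero])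

/-- Polar coordinates, using that the circle is connected. This lets arguments that hold off the
zeros of `X` be carried out around an isolated zero. -/
lemma isPreconnected_punctured_ball (x : E₂) {r : ℝ} :
    IsPreconnected (Metric.ball x r \ {x}) := by
  have hrank : 1 < Module.rank ℝ E₂ := by
    rw [← Module.finrank_eq_rank ℝ E₂, finrank_plane]; norm_num
  have h1 : IsPreconnected (Ioo (0 : ℝ) r ×ˢ Metric.sphere (0 : E₂) 1) :=
    isPreconnected_Ioo.prod (isPreconnected_sphere hrank 0 1)
  have h2 := h1.image (fun p => x + p.1 • p.2) (by fun_prop)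
  convert h2 using 1
  ext y
  simp only [mem_sdiff, Metric.mem_ball, mem_singleton_iff, mem_image, mem_prod, Prod.exists,
    mem_Ioo, mem_sphere_zero_iff_norm]
  constructor
  · rintro ⟨hy, hne⟩
    have hpos : 0 < ‖y - x‖ := norm_pos_iff.2 (sub_ne_zero.2 hne)
    refine ⟨‖y - x‖, ‖y - x‖⁻¹ • (y - x), ⟨⟨hpos, by rwa [← dist_eq_norm]⟩, ?_⟩, ?_⟩
    · rw [norm_smul, norm_inv, norm_norm, inv_mul_cancel₀ hpos.ne']
    · rw [smul_smul, mul_inv_cancel₀ hpos.ne', one_smul]; abel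
  · rintro ⟨ρ, w, ⟨⟨hρ, hρr⟩, hw⟩, rfl⟩
    refine ⟨by rw [dist_eq_norm, add_sub_cancel_left, norm_smul, hw, mul_one,
      Real.norm_of_nonneg hρ.le]; exact hρr, fun he => ?_⟩
    have : ρ • w = 0 := by simpa using he
    have h3 := congrArg norm this
    rw [norm_smul, hw, norm_zero, mul_one, Real.norm_of_nonneg hρ.le] at h3
    exact hρ.ne' h3

lemma exists_unit_orthogonal (h : SurfaceMetric M) (x : M) (w : E₂) :
    ∃ v, innerAt h x v v = 1 ∧ innerAt h x v w = 0 := by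
  have hpos : ∀ v : E₂, v ≠ 0 → 0 < innerAt h x v v := fun v hv => h.pos x v hv
  obtain ⟨v, hv, hvw⟩ : ∃ v : E₂, v ≠ 0 ∧ innerAt h x w v = 0 := by
    by_contra hcon
    push Not at hcon
    have hinj : Function.Injective (innerAt h x w) :=
      (injective_iff_map_eq_zero _).2 fun v hv => by
        by_contra hne
        exact hcon v hne hv
    have := LinearMap.finrank_le_finrank_of_injective (f := (innerAt h x w : E₂ →ₗ[ℝ] ℝ)) hinj
    rw [finrank_plane, Module.finrank_self] at this
    omega
  have hp := hpos v hv
  refine ⟨(√(innerAt h x v v))⁻¹ • v, ?_, ?_⟩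
  · simp only [map_smul, smul_apply, smul_eq_mul]
    rw [← mul_assoc, ← mul_inv, Real.mul_self_sqrt hp.le, inv_mul_cancel₀ hp.ne']
  · have hsymm : innerAt h x v w = innerAt h x w v := h.symm x v w
    simp only [map_smul, smul_apply, smul_eq_mul, hsymm, hvw, mul_zero]

lemma IsHamiltonianAt.differentialAt_ne_zero {H : M → ℝ} {x : M} (hH : IsHamiltonianAt h X H x)
    (hx : X x ≠ 0) : differentialAt H x ≠ 0 := by
  intro h0
  obtain ⟨v, hv, hvw⟩ := exists_unit_orthogonal h x (fieldAt X x)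
  have h1 := hH.sq_eq v
  have hsymm : innerAt h x (fieldAt X x) v = innerAt h x v (fieldAt X x) := h.symm x _ _
  rw [h0, hsymm, hvw, hv] at h1
  have : 0 < innerAt h x (fieldAt X x) (fieldAt X x) := h.pos x _ hx
  simp at h1
  exact this.ne h1

section

variable [PreconnectedSpace M] (hX : IsKillingField h X) (hne : ∃ x, X x ≠ 0)
include hX hne

/-- Two Hamiltonians have differentials equal up to sign at each point, and the sign is locally
constant where they do not vanish. Zeros of `X` are isolated and a punctured disc is connected, so
one sign works around `x`; the center follows by continuity. -/
lemma IsHamiltonianAt.eventually_eq {H H' : M → ℝ} {x : M}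
    (hH : ∀ᶠ y in 𝓝 x, IsHamiltonianAt h X H y) (hH' : ∀ᶠ y in 𝓝 x, IsHamiltonianAt h X H' y) :
    ∃ ε : ℝ, (ε = 1 ∨ ε = -1) ∧ ∀ᶠ y in 𝓝 x, H y - ε * H' y = H x - ε * H' x := by
  have hx : x ∈ (𝔢 x).source := mem_extChartAt_source x
  have hz : ∀ᶠ y in 𝓝 x, y ≠ x → X y ≠ 0 :=
    eventually_nhdsWithin_iff.1 (hX.eventually_ne_zero hne x)
  have hev := eventually_chart_of hx (hH.and (hH'.and hz))
  obtain ⟨r, hr, hball⟩ := Metric.eventually_nhds_iff_ball.1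
    (hev.and ((isOpen_chart_target x).mem_nhds (mem_extChartAt_target x)))
  set f : E₂ → ℝ := fun y => H ((𝔢 x).symm y) with hf
  set f' : E₂ → ℝ := fun y => H' ((𝔢 x).symm y) with hf'
  set B := Metric.ball (𝔢 x x) r with hB
  have hfd : ∀ y ∈ B, ContDiffAt ℝ ∞ f y := fun y hy =>
    ((hball y hy).1.1.contMDiffAt.hasFDerivAt_chart_symm (hball y hy).2).1
  have hfd' : ∀ y ∈ B, ContDiffAt ℝ ∞ f' y := fun y hy =>
    ((hball y hy).1.2.1.contMDiffAt.hasFDerivAt_chart_symm (hball y hy).2).1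
  have hc : ContinuousOn (fderiv ℝ f) B := fun y hy =>
    ((hfd y hy).fderiv_right (m := ∞) le_rfl).continuousAt.continuousWithinAt
  have hc' : ContinuousOn (fderiv ℝ f') B := fun y hy =>
    ((hfd' y hy).fderiv_right (m := ∞) le_rfl).continuousAt.continuousWithinAt
  have hor : ∀ y ∈ B, fderiv ℝ f y = fderiv ℝ f' y ∨ fderiv ℝ f y = - fderiv ℝ f' y := by
    intro y hy
    refine ContinuousLinearMap.eq_or_eq_neg_of_sq_eq fun v => ?_
    rw [(hball y hy).1.1.chart (hball y hy).2, (hball y hy).1.2.1.chart (hball y hy).2]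
  have hnz : ∀ y ∈ B \ {𝔢 x x}, fderiv ℝ f y ≠ 0 := by
    rintro y ⟨hy, hyx⟩ h0
    have ht := (hball y hy).2
    have hXy : X ((𝔢 x).symm y) ≠ 0 := (hball y hy).1.2.2 fun he =>
      hyx ((𝔢 x).right_inv ht ▸ congrArg (𝔢 x) he)
    refine (hball y hy).1.1.differentialAt_ne_zero hXy ?_
    ext1 v
    have h1 := ((hball y hy).1.1.contMDiffAt.hasFDerivAt_chart_symm ht).2.fderiv
    have h2 := congrArg (fun L : E₂ →L[ℝ] ℝ => L (chartCoframe x ((𝔢 x).symm y) v)) h1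
    have h3 := chartFrame_coframe ((𝔢 x).map_target ht) v
    rw [(𝔢 x).right_inv ht] at h3
    simp only [ContinuousLinearMap.comp_apply] at h2
    rw [h3] at h2
    rw [← h2, ← hf, h0]
    simp
  have hcover : ∃ ε : ℝ, (ε = 1 ∨ ε = -1) ∧ ∀ y ∈ B \ {𝔢 x x},
      fderiv ℝ f y = ε • fderiv ℝ f' y := by
    have hu : IsOpen (B ∩ (fun y => fderiv ℝ f y + fderiv ℝ f' y) ⁻¹' {0}ᶜ) :=
      (hc.add hc').isOpen_inter_preimage Metric.isOpen_ball isOpen_compl_singleton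
    have hv : IsOpen (B ∩ (fun y => fderiv ℝ f y - fderiv ℝ f' y) ⁻¹' {0}ᶜ) :=
      (hc.sub hc').isOpen_inter_preimage Metric.isOpen_ball isOpen_compl_singleton
    have hdisj : Disjoint (B ∩ (fun y => fderiv ℝ f y + fderiv ℝ f' y) ⁻¹' {0}ᶜ)
        (B ∩ (fun y => fderiv ℝ f y - fderiv ℝ f' y) ⁻¹' {0}ᶜ) := by
      rw [Set.disjoint_left]
      rintro y ⟨hy, h1⟩ ⟨-, h2⟩
      rcases hor y hy with he | he
      · exact h2 (by simp [he])
      · exact h1 (by simp [he])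
    have hcov : B \ {𝔢 x x} ⊆ (B ∩ (fun y => fderiv ℝ f y + fderiv ℝ f' y) ⁻¹' {0}ᶜ) ∪
        (B ∩ (fun y => fderiv ℝ f y - fderiv ℝ f' y) ⁻¹' {0}ᶜ) := by
      intro y hy
      by_cases h1 : fderiv ℝ f y + fderiv ℝ f' y = 0
      · right
        refine ⟨hy.1, fun h2 => hnz y hy ?_⟩
        have h3 : fderiv ℝ f y = fderiv ℝ f' y := sub_eq_zero.1 h2
        rw [← h3] at h1
        rw [← two_smul ℝ] at h1
        exact (smul_eq_zero.1 h1).resolve_left two_ne_zero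
      · exact Or.inl ⟨hy.1, h1⟩
    rcases (isPreconnected_punctured_ball (𝔢 x x) (r := r)).subset_or_subset hu hv hdisj hcov with
      hs | hs
    · refine ⟨1, Or.inl rfl, fun y hy => ?_⟩
      rw [one_smul]
      exact (hor y hy.1).resolve_right fun he => (hs hy).2 (by simp [he])
    · refine ⟨-1, Or.inr rfl, fun y hy => ?_⟩
      rw [neg_one_smul]
      exact (hor y hy.1).resolve_left fun he => (hs hy).2 (by simp [he])
  obtain ⟨ε, hε, hfε⟩ := hcover
  refine ⟨ε, hε, ?_⟩
  have hcenter : 𝔢 x x ∈ B := Metric.mem_ball_self hr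
  have hall : ∀ y ∈ B, fderiv ℝ f y = ε • fderiv ℝ f' y := by
    intro y hy
    by_cases hyx : y = 𝔢 x x
    · subst hyx
      have hB' : B ∈ 𝓝 (𝔢 x x) := Metric.isOpen_ball.mem_nhds hcenter
      have t1 := ((hc.continuousAt hB').tendsto).mono_left (nhdsWithin_le_nhds (s := {𝔢 x x}ᶜ))
      have t2 := (((hc'.continuousAt hB').const_smul ε).tendsto).mono_left
        (nhdsWithin_le_nhds (s := {𝔢 x x}ᶜ))
      refine tendsto_nhds_unique t1 (t2.congr' ?_)
      filter_upwards [nhdsWithin_le_nhds hB', self_mem_nhdsWithin] with z hz hz'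
      exact (hfε z ⟨hz, hz'⟩).symm
    · exact hfε y ⟨hy, hyx⟩
  have hconst : ∀ y ∈ B, f y - ε * f' y = f (𝔢 x x) - ε * f' (𝔢 x x) := by
    intro y hy
    refine Metric.isOpen_ball.is_const_of_fderiv_eq_zero (𝕜 := ℝ) (f := fun y => f y - ε * f' y)
      (convex_ball _ _).isPreconnected ?_ ?_ hy hcenter
    · intro z hz
      exact (((hfd z hz).differentiableAt (by simp)).sub
        (((hfd' z hz).differentiableAt (by simp)).const_mul ε)).differentiableWithinAt
    · intro z hz
      rw [fderiv_fun_sub ((hfd z hz).differentiableAt (by simp))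
        (((hfd' z hz).differentiableAt (by simp)).const_mul ε),
        fderiv_const_mul ((hfd' z hz).differentiableAt (by simp)), hall z hz, sub_self]
      rfl
  have hBn : ∀ᶠ y in 𝓝 x, 𝔢 x y ∈ B :=
    eventually_of_chart hx (Metric.isOpen_ball.mem_nhds hcenter)
  filter_upwards [hBn, chartSource_mem_nhds hx] with y hy hys
  have := hconst _ hy
  simp only [hf, hf', (𝔢 x).left_inv hys, (𝔢 x).left_inv hx] at this
  exact this

lemma IsHamiltonianAt.not_eventually_const {H : M → ℝ} {x : M}
    (hH : ∀ᶠ y in 𝓝 x, IsHamiltonianAt h X H y) {k : ℝ} (hk : ∀ᶠ y in 𝓝 x, H y = k) : False := by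
  have : (𝓝[≠] x).NeBot := by
    have hx : x ∈ (𝔢 x).source := mem_extChartAt_source x
    have ht := mem_extChartAt_target (I := 𝓡 2) x
    have hcs := (contMDiffAt_chart_symm ht).continuousAt
    have h1 : Filter.Tendsto (𝔢 x).symm (𝓝[≠] (𝔢 x x)) (𝓝[≠] x) := by
      rw [ContinuousAt, (𝔢 x).left_inv hx] at hcs
      refine tendsto_nhdsWithin_iff.2 ⟨hcs.mono_left nhdsWithin_le_nhds, ?_⟩
      filter_upwards [self_mem_nhdsWithin,
        nhdsWithin_le_nhds ((isOpen_chart_target x).mem_nhds ht)] with y hy hyt he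
      exact hy (by rw [mem_singleton_iff, ← (𝔢 x).right_inv hyt, he])
    exact h1.neBot
  obtain ⟨y, hy, hyX⟩ := (Filter.Eventually.and (Filter.Eventually.filter_mono nhdsWithin_le_nhds
    (hH.and hk.eventually_nhds)) (hX.eventually_ne_zero hne x)).exists
  refine hy.1.differentialAt_ne_zero hyX ?_
  have h1 : H =ᶠ[𝓝 y] fun _ => k := hy.2
  rw [differentialAt, h1.mfderiv_eq, mfderiv_const]
  rfl

/-- Hamiltonians are unique up to sign and an additive constant. -/
lemma IsHamiltonianAt.eqOn {H H' : M → ℝ} {S : Set M} (hS : IsPreconnected S) (hSo : IsOpen S)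
    (hH : ∀ x ∈ S, IsHamiltonianAt h X H x) (hH' : ∀ x ∈ S, IsHamiltonianAt h X H' x) :
    ∃ ε k : ℝ, (ε = 1 ∨ ε = -1) ∧ ∀ x ∈ S, H x = ε * H' x + k := by
  have hev : ∀ {H : M → ℝ}, (∀ x ∈ S, IsHamiltonianAt h X H x) → ∀ x ∈ S,
      ∀ᶠ y in 𝓝 x, IsHamiltonianAt h X H y := fun hH x hx =>
    Filter.Eventually.mono (hSo.mem_nhds hx) hH
  set A : ℝ → Set M := fun ε => {x | ∃ k, ∀ᶠ y in 𝓝 x, H y - ε * H' y = k} with hA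
  have hAo : ∀ ε, IsOpen (S ∩ A ε) := by
    refine fun ε => hSo.inter (isOpen_iff_mem_nhds.2 ?_)
    rintro x ⟨k, hk⟩
    filter_upwards [hk.eventually_nhds] with y hy
    exact ⟨k, hy⟩
  have hcov : S ⊆ (S ∩ A 1) ∪ (S ∩ A (-1)) := by
    intro x hx
    obtain ⟨ε, hε, he⟩ := IsHamiltonianAt.eventually_eq hX hne (hev hH x hx) (hev hH' x hx)
    rcases hε with rfl | rfl
    · exact Or.inl ⟨hx, _, he⟩
    · exact Or.inr ⟨hx, _, he⟩
  -- If both signs were admissible at a point, then `H - H'` and `H + H'` would be constant nearby,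
  -- hence so would `H`, which is impossible.
  have hdisj : Disjoint (S ∩ A 1) (S ∩ A (-1)) := by
    rw [Set.disjoint_left]
    rintro x ⟨hx, k, hk⟩ ⟨-, k', hk'⟩
    refine IsHamiltonianAt.not_eventually_const hX hne (hev hH x hx) (k := (k + k') / 2) ?_
    filter_upwards [hk, hk'] with y h1 h2
    linarith
  have hmain : ∃ ε : ℝ, (ε = 1 ∨ ε = -1) ∧ S ⊆ A ε := by
    rcases hS.subset_or_subset (hAo 1) (hAo (-1)) hdisj hcov with hs | hs
    · exact ⟨1, Or.inl rfl, fun x hx => (hs hx).2⟩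
    · exact ⟨-1, Or.inr rfl, fun x hx => (hs hx).2⟩
  obtain ⟨ε, hε, hsub⟩ := hmain
  rcases S.eq_empty_or_nonempty with rfl | ⟨x₁, hx₁⟩
  · exact ⟨1, 0, Or.inl rfl, by simp⟩
  refine ⟨ε, H x₁ - ε * H' x₁, hε, fun x hx => ?_⟩
  have hconn : S ⊆ {x | ∀ᶠ y in 𝓝 x, H y - ε * H' y = H x₁ - ε * H' x₁} := by
    obtain ⟨k₁, hk₁⟩ := hsub hx₁
    refine hS.subset_of_closure_inter_subset isOpen_setOfPred_eventually_nhds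
      ⟨x₁, hx₁, hk₁.mono fun y hy => hy.trans hk₁.self_of_nhds.symm⟩ ?_
    rintro y ⟨hy, hyS⟩
    obtain ⟨k, hk⟩ := hsub hyS
    obtain ⟨z, hz, hzk⟩ := ((mem_closure_iff_frequently.1 hy).and_eventually hk).exists
    have hz' : H z - ε * H' z = H x₁ - ε * H' x₁ :=
      Filter.Eventually.self_of_nhds (p := fun z => H z - ε * H' z = H x₁ - ε * H' x₁) hz
    exact hk.mono fun w hw => hw.trans (hzk.symm.trans hz')
  have := Filter.Eventually.self_of_nhds (p := fun z => H z - ε * H' z = H x₁ - ε * H' x₁)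
    (hconn hx)
  linarith

/-- Over a connected overlap the second function can be corrected by one sign and one constant to
agree with the first. This is where connectedness of overlaps replaces a cohomological argument. -/
lemma isGluable_hamiltonian :
    IsGluable fun U : Set M => ∃ H, ∀ x ∈ U, IsHamiltonianAt h X H x where
  mono U V _ _ hUV := fun ⟨H, hH⟩ => ⟨H, fun x hx => hH x (hUV hx)⟩
  locally_holds x := exists_local_hamiltonian hX x
  glue U V hU hV hUV := by
    classical
    rintro ⟨H, hH⟩ ⟨H', hH'⟩
    obtain ⟨ε, k, hε, he⟩ := IsHamiltonianAt.eqOn hX hne hUV (hU.inter hV)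
      (fun x hx => hH x hx.1) (fun x hx => hH' x hx.2)
    refine ⟨fun x => if x ∈ U then H x else ε * H' x + k, ?_⟩
    rintro x (hx | hx)
    · refine (hH x hx).congr ?_
      filter_upwards [hU.mem_nhds hx] with y hy
      exact if_pos hy
    · refine ((hH' x hx).neg_add_const hε k).congr ?_
      filter_upwards [hV.mem_nhds hx] with y hy
      by_cases hyU : y ∈ U
      · rw [if_pos hyU, he y ⟨hyU, hy⟩]
      · rw [if_neg hyU]

end

theorem exists_hamiltonian (hM : Nonempty (M ≃ₜ Metric.sphere (0 : EuclideanSpace ℝ (Fin 3)) 1))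
    [PreconnectedSpace M] (hX : IsKillingField h X) (hne : ∃ x, X x ≠ 0) :
    ∃ H, ∀ x, IsHamiltonianAt h X H x := by
  obtain ⟨e⟩ := hM
  obtain ⟨H, hH⟩ := ((isGluable_hamiltonian hX hne).homeomorph e).sphere
  exact ⟨H, fun x => hH x (mem_univ _)⟩

/-- The defining identity with `v = X` gives `dH(X)² = |X|⁴ - |X|⁴ = 0`. -/
lemma IsHamiltonianAt.flow_eq {H : M → ℝ} (hH : ∀ x, IsHamiltonianAt h X H x) {Fl : ℝ → M → M}
    (hF : IsFlow X Fl) (t : ℝ) (x : M) : H (Fl t x) = H x := by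
  have hd : ∀ s, HasDerivAt (fun s => H (Fl s x)) 0 s := by
    intro s
    have h1 := HasMFDerivAt.hasDerivAt_comp (hF.integral x s) (hH (Fl s x)).contMDiffAt
    refine h1.congr_deriv ?_
    have h2 := (hH (Fl s x)).sq_eq (fieldAt X (Fl s x))
    rw [← sq, sub_self] at h2
    have h3 : ((1 : ℝ →L[ℝ] ℝ).smulRight (X (Fl s x)) : ℝ →L[ℝ] E₂) 1 = fieldAt X (Fl s x) :=
      one_smul ℝ (X (Fl s x) : E₂)
    exact (congrArg _ h3).trans (pow_eq_zero_iff two_ne_zero |>.1 h2)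
  have := is_const_of_deriv_eq_zero (fun s => (hd s).differentiableAt) (fun s => (hd s).deriv) t 0
  simpa [hF.zero] using this

end Hamiltonian

/-! ### Normal curves and the flow of a Killing field -/

section Rotation

variable {M : Type*} [TopologicalSpace M] [ChartedSpace (EuclideanSpace ℝ (Fin 2)) M]
  [IsManifold (𝓡 2) ∞ M]

local notation "E₂" => EuclideanSpace ℝ (Fin 2)
local notation "𝔢" => extChartAt (𝓡 2)

variable {h : SurfaceMetric M} {X : (x : M) → TangentSpace (𝓡 2) x}

variable (h X) in
/-- A nonzero Killing field `X` together with its flow and its Hamiltonian. -/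
structure KillingData (Fl : ℝ → M → M) (H : M → ℝ) : Prop where
  killing : IsKillingField h X
  nonzero : ∃ x, X x ≠ 0
  flow : IsFlow X Fl
  hamiltonian : ∀ x, IsHamiltonianAt h X H x

variable (h X) in
/-- The squared length of a vector field. -/
noncomputable def normSq (x : M) : ℝ := innerAt h x (fieldAt X x) (fieldAt X x)

variable (h X) in
/-- A unit speed curve orthogonal to `X`, defined for all times. -/
def IsNormal (c : ℝ → M) : Prop := ∀ s, IsNormalAt h X c s

lemma innerAt_comm (h : SurfaceMetric M) (x : M) (v w : E₂) : innerAt h x v w = innerAt h x w v :=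
  h.symm x v w

lemma innerAt_pos (h : SurfaceMetric M) (x : M) {v : E₂} (hv : v ≠ 0) : 0 < innerAt h x v v :=
  h.pos x v hv

lemma normSq_pos {x : M} (hx : X x ≠ 0) : 0 < normSq h X x := innerAt_pos h x hx

lemma normSq_eq_zero_iff {x : M} : normSq h X x = 0 ↔ X x = 0 := by
  constructor
  · intro h0
    by_contra hx
    exact (normSq_pos hx).ne' h0
  · intro h0
    have : fieldAt X x = 0 := h0
    rw [normSq, this, map_zero]

lemma eq_or_eq_neg_of_orthogonal {x : M} {v v' w : E₂} (hv : innerAt h x v v = 1)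
    (hv' : innerAt h x v' v' = 1) (hw : w ≠ 0) (hvw : innerAt h x v w = 0)
    (hvw' : innerAt h x v' w = 0) : v' = v ∨ v' = -v := by
  have hx : x ∈ (𝔢 x).source := mem_extChartAt_source x
  have hco : ∀ {u : E₂}, u ≠ 0 → chartCoframe x x u ≠ 0 := fun {u} hu h0 =>
    hu (eq_of_chartCoframe_eq hx (h0.trans (map_zero _).symm))
  have hv0 : v ≠ 0 := by rintro rfl; simp at hv
  obtain ⟨r, s, hrs⟩ := (smoothMetricOn_chartMetric h x).exists_eq_add finrank_plane
    ((𝔢 x).map_source hx) (hco hv0) (hco hw) (by rw [chartMetric_coframe h hx, hvw])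
    (chartCoframe x x v')
  have hv2 : v' = r • v + s • w := by
    refine eq_of_chartCoframe_eq hx ?_
    rw [hrs, map_add, map_smul, map_smul]
  subst hv2
  have hs : s = 0 := by
    simp only [map_add, map_smul, add_apply, smul_apply, smul_eq_mul, hvw, mul_zero,
      zero_add] at hvw'
    exact (mul_eq_zero.1 hvw').resolve_right (innerAt_pos h x hw).ne'
  subst hs
  simp only [zero_smul, add_zero, map_smul, smul_apply, smul_eq_mul, hv, mul_one] at hv'
  rcases mul_self_eq_one_iff.1 hv' with rfl | rfl
  · exact Or.inl (by simp)
  · exact Or.inr (by simp)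

lemma IsNormalAt.comp_sub_left {c : ℝ → M} {s a : ℝ} (hc : IsNormalAt h X c (a - s)) :
    IsNormalAt h X (fun τ => c (a - τ)) s ∧
      velocity (fun τ => c (a - τ)) s = -velocity c (a - s) := by
  have hv : velocity (fun τ => c (a - τ)) s = -velocity c (a - s) := by
    rw [velocity_comp (f := fun τ => a - τ) ((hasDerivAt_id s).const_sub a)
      (hc.contMDiffAt.mdifferentiableAt (by simp)), neg_one_smul]
  have hf : ContMDiffAt 𝓘(ℝ, ℝ) 𝓘(ℝ, ℝ) ∞ (fun τ : ℝ => a - τ) s :=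
    (contDiffAt_const.sub contDiffAt_id).contMDiffAt
  refine ⟨⟨ContMDiffAt.comp (g := c) (f := fun τ : ℝ => a - τ) s hc.contMDiffAt hf, ?_, ?_⟩, hv⟩
  · rw [hv]; simp only [map_neg, neg_apply, neg_neg]; exact hc.unit
  · rw [hv]; simp only [map_neg, neg_apply, neg_eq_zero]; exact hc.orth

lemma velocity_comp_add {c : ℝ → M} (hc : IsNormal h X c) (a s : ℝ) :
    velocity (fun τ => c (τ + a)) s = velocity c (s + a) := by
  rw [velocity_comp (f := fun τ => τ + a) ((hasDerivAt_id s).add_const a)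
    ((hc _).contMDiffAt.mdifferentiableAt (by simp)), one_smul]

lemma IsNormal.comp_add {c : ℝ → M} (hc : IsNormal h X c) (a : ℝ) :
    IsNormal h X (fun s => c (s + a)) := fun _ => (hc _).comp_add

lemma IsNormal.comp_sub_left {c : ℝ → M} (hc : IsNormal h X c) (a : ℝ) :
    IsNormal h X (fun s => c (a - s)) := fun _ => (hc _).comp_sub_left.1

lemma IsNormal.contMDiff {c : ℝ → M} (hc : IsNormal h X c) : ContMDiff 𝓘(ℝ, ℝ) (𝓡 2) ∞ c :=
  fun s => (hc s).contMDiffAt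

lemma IsNormal.continuous {c : ℝ → M} (hc : IsNormal h X c) : Continuous c :=
  hc.contMDiff.continuous

namespace KillingData

variable [CompactSpace M] [T2Space M] [PreconnectedSpace M] {Fl : ℝ → M → M} {H : M → ℝ}

lemma flow_zero (K : KillingData h X Fl H) (x : M) : Fl 0 x = x := K.flow.zero x

lemma flow_add (K : KillingData h X Fl H) (s t : ℝ) (x : M) : Fl (s + t) x = Fl s (Fl t x) :=
  K.flow.add K.killing.smooth s t x

lemma flow_neg (K : KillingData h X Fl H) (t : ℝ) (x : M) : Fl (-t) (Fl t x) = x := by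
  rw [← K.flow_add, neg_add_cancel, K.flow_zero]

lemma hamiltonian_flow (K : KillingData h X Fl H) (t : ℝ) (x : M) : H (Fl t x) = H x :=
  IsHamiltonianAt.flow_eq K.hamiltonian K.flow t x

lemma flow_eq_of_eq_zero (K : KillingData h X Fl H) {x : M} (hx : X x = 0) (t : ℝ) : Fl t x = x :=
  K.flow.eq_self_of_eq_zero K.killing.smooth hx t

lemma normal_flow (K : KillingData h X Fl H) {c : ℝ → M} (hc : IsNormal h X c) (t : ℝ) :
    IsNormal h X (fun s => Fl t (c s)) := fun s => (hc s).flow K.killing K.flow t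

lemma normal_ext (K : KillingData h X Fl H) {c c' : ℝ → M} (hc : IsNormal h X c)
    (hc' : IsNormal h X c') {s₀ : ℝ} (h0 : c s₀ = c' s₀)
    (h1 : velocity c s₀ = velocity c' s₀) (s : ℝ) : c s = c' s :=
  eqOn_of_isNormalAt K.killing K.nonzero isPreconnected_univ isOpen_univ (fun s _ => hc s)
    (fun s _ => hc' s) (mem_univ s₀) h0 h1 (mem_univ s)

lemma hasDerivAt_hamiltonian (K : KillingData h X Fl H) {c : ℝ → M} (hc : IsNormal h X c) (s : ℝ) :
    HasDerivAt (fun s => H (c s)) (differentialAt H (c s) (velocity c s)) s :=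
  ((hc s).contMDiffAt.mdifferentiableAt (by simp)).hasMFDerivAt.hasDerivAt_comp
    (K.hamiltonian (c s)).contMDiffAt

lemma contDiff_hamiltonian (K : KillingData h X Fl H) {c : ℝ → M} (hc : IsNormal h X c) :
    ContDiff ℝ ∞ (fun s => H (c s)) := by
  refine contMDiff_iff_contDiff.1 fun s => ?_
  exact (K.hamiltonian (c s)).contMDiffAt.comp s (hc s).contMDiffAt

/-- The velocity is a unit vector orthogonal to `X`, so the Gram determinant is `|X|²`. This turns
the zeros of `X` on a normal curve into critical points of a real function. -/
lemma deriv_hamiltonian_sq (K : KillingData h X Fl H) {c : ℝ → M} (hc : IsNormal h X c) (s : ℝ) :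
    deriv (fun s => H (c s)) s ^ 2 = normSq h X (c s) := by
  rw [(K.hasDerivAt_hamiltonian hc s).deriv, (K.hamiltonian (c s)).sq_eq, (hc s).unit,
    innerAt_comm, innerAt_comm h _ _ (velocity c s), (hc s).orth, normSq]
  ring

lemma deriv_hamiltonian_eq_zero_iff (K : KillingData h X Fl H) {c : ℝ → M} (hc : IsNormal h X c)
    {s : ℝ} : deriv (fun s => H (c s)) s = 0 ↔ X (c s) = 0 := by
  rw [← normSq_eq_zero_iff (h := h), ← K.deriv_hamiltonian_sq hc, sq_eq_zero_iff]

/-- A normal curve and its image under the flow see the same values of `H`, hence the same squared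
derivative. -/
lemma normSq_flow (K : KillingData h X Fl H) {c : ℝ → M} (hc : IsNormal h X c) (t s : ℝ) :
    normSq h X (Fl t (c s)) = normSq h X (c s) := by
  rw [← K.deriv_hamiltonian_sq hc, ← K.deriv_hamiltonian_sq (K.normal_flow hc t)]
  simp only [K.hamiltonian_flow]

lemma field_flow_ne_zero (K : KillingData h X Fl H) {x : M} (hx : X x ≠ 0) (t : ℝ) :
    X (Fl t x) ≠ 0 := by
  intro h0
  have h1 := K.flow_eq_of_eq_zero h0 (-t)
  rw [K.flow_neg] at h1
  rw [← h1] at h0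
  exact hx h0

/-- Two normal curves through a common point that is not a zero of `X` have the same trace. -/
lemma normal_match (K : KillingData h X Fl H) {c c' : ℝ → M} (hc : IsNormal h X c)
    (hc' : IsNormal h X c') {s s' : ℝ} (h0 : c s = c' s') (hX : X (c s) ≠ 0) :
    (∀ τ, c (s + τ) = c' (s' + τ)) ∨ ∀ τ, c (s + τ) = c' (s' - τ) := by
  have hc's : innerAt h (c s) (velocity c' s') (velocity c' s') = 1 ∧
      innerAt h (c s) (velocity c' s') (fieldAt X (c s)) = 0 := by
    rw [h0]; exact ⟨(hc' s').unit, (hc' s').orth⟩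
  rcases eq_or_eq_neg_of_orthogonal (hc s).unit hc's.1 hX (hc s).orth hc's.2 with hv | hv
  · left
    intro τ
    have := K.normal_ext (hc.comp_add s) (hc'.comp_add s') (s₀ := 0)
      (by simpa using h0) (by rw [velocity_comp_add hc, velocity_comp_add hc', zero_add, zero_add,
        hv]) τ
    simpa [add_comm] using this
  · right
    intro τ
    have := K.normal_ext (hc.comp_add s) (hc'.comp_sub_left s') (s₀ := 0)
      (by simpa using h0) (by rw [velocity_comp_add hc, zero_add, (hc' _).comp_sub_left.2,
        sub_zero, hv, neg_neg]) τ
    simpa [add_comm] using this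

/-- If the flow fixes a regular point of a normal curve then it fixes the curve. -/
lemma flow_normal_eq (K : KillingData h X Fl H) {c : ℝ → M} (hc : IsNormal h X c) {s t : ℝ}
    (h0 : Fl t (c s) = c s) (hX : X (c s) ≠ 0) (τ : ℝ) : Fl t (c τ) = c τ := by
  have hX' : X (Fl t (c s)) ≠ 0 := h0.symm ▸ hX
  have hd : deriv (fun s => H (c s)) s ≠ 0 := fun hz =>
    hX ((K.deriv_hamiltonian_eq_zero_iff hc).1 hz)
  rcases K.normal_match (K.normal_flow hc t) hc h0 hX' with hm | hm
  · have := hm (τ - s)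
    simpa using this
  · exfalso
    -- If the flow reversed the curve, `H ∘ c` would be symmetric about `s` and so critical there,
    -- contradicting that `c s` is regular.
    have h1 : ∀ σ, H (c (s + σ)) = H (c (s - σ)) := fun σ => by
      rw [← hm σ, K.hamiltonian_flow]
    have hD := (K.contDiff_hamiltonian hc).differentiable (by simp) s
    have e1 : HasDerivAt (fun σ => H (c (s + σ))) (deriv (fun s => H (c s)) s) 0 := by
      have := HasDerivAt.comp_const_add (f := fun s => H (c s)) s 0
        (f' := deriv (fun s => H (c s)) s) (by simpa using hD.hasDerivAt)
      simpa using this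
    have e2 : HasDerivAt (fun σ => H (c (s - σ))) (-deriv (fun s => H (c s)) s) 0 := by
      have := HasDerivAt.comp_const_sub (f := fun s => H (c s)) s 0
        (f' := deriv (fun s => H (c s)) s) (by simpa using hD.hasDerivAt)
      simpa using this
    simp only [h1] at e1
    have := e1.unique e2
    exact hd (by linarith)

end KillingData

lemma eq_cos_add_sin {E : Type*} [NormedAddCommGroup E] [NormedSpace ℝ E] {A : E →L[ℝ] E} {a : E}
    {l : ℝ} (hl : l ≠ 0) (hA : A (A a) = -(l ^ 2) • a) {J : ℝ → E} (hJ0 : J 0 = a)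
    (hJ : ∀ t, HasDerivAt J (A (J t)) t) (t : ℝ) :
    J t = Real.cos (l * t) • a + (l⁻¹ * Real.sin (l * t)) • A a := by
  have hK : ∀ t, HasDerivAt (fun t => Real.cos (l * t) • a + (l⁻¹ * Real.sin (l * t)) • A a)
      (A (Real.cos (l * t) • a + (l⁻¹ * Real.sin (l * t)) • A a)) t := by
    intro t
    have h0 : HasDerivAt (fun t : ℝ => l * t) l t := by
      simpa using (hasDerivAt_id t).const_mul l
    have h1 := h0.cos.smul_const a
    have h2 := (h0.sin.const_mul l⁻¹).smul_const (A a)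
    refine (h1.add h2).congr_deriv ?_
    rw [map_add, map_smul, map_smul, hA, smul_smul, add_comm]
    congr 1
    · congr 1
      field_simp
    · congr 1
      field_simp
  have := ODE_solution_unique_univ (v := fun _ x => A x) (s := fun _ => univ) (K := ‖A‖₊)
    (t₀ := 0) (fun _ => A.lipschitz.lipschitzOnWith) (fun t => ⟨hJ t, mem_univ _⟩)
    (fun t => ⟨hK t, mem_univ _⟩) (by simp [hJ0])
  exact congrFun this t

namespace KillingData

variable [CompactSpace M] [T2Space M] [PreconnectedSpace M] {Fl : ℝ → M → M} {H : M → ℝ}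

/-- The flow of `X` rotates the normal curves that start at a zero of `X`. -/
theorem exists_rotation (K : KillingData h X Fl H) {c : ℝ → M} (hc : IsNormal h X c)
    (h0 : X (c 0) = 0) : ∃ l > 0,
      (∀ t, (∀ s, Fl t (c s) = c s) ↔ ∃ k : ℤ, t = k * (2 * Real.pi / l)) ∧
      Filter.Tendsto (fun s => normSq h X (c s) / s ^ 2) (𝓝[≠] 0) (𝓝 (l ^ 2)) := by
  obtain ⟨p, hp⟩ : ∃ p, p = c 0 := ⟨_, rfl⟩
  have hs : c 0 ∈ (𝔢 p).source := hp ▸ mem_extChartAt_source _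
  have hg := smoothMetricOn_chartMetric h p
  have hV := K.killing.killingFieldOn p
  have hpt := (𝔢 p).map_source hs
  have hV0 : chartField X p (𝔢 p (c 0)) = 0 := (chartField_eq_zero_iff X hs).2 h0
  set A := fderiv ℝ (chartField X p) (𝔢 p (c 0)) with hA
  set a := deriv (fun s => 𝔢 p (c s)) 0 with ha
  have ha1 : chartMetric h p (𝔢 p (c 0)) a a = 1 := ((hc 0).chart hs).1
  obtain ⟨l, hl, hl1, hl2⟩ := hV.fderiv_fderiv_eq hg finrank_plane hpt hV0
    (K.killing.fderiv_chartField_ne_zero K.nonzero hs h0) ha1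
  have hskew : chartMetric h p (𝔢 p (c 0)) a (A a) = 0 := by
    have h1 := hV.killing _ hpt a a
    rw [hV0, map_zero, zero_apply, zero_apply, hg.symm _ hpt, ← hA] at h1
    linarith
  set J : ℝ → E₂ := fun t => deriv (fun s => 𝔢 p (Fl t (c s))) 0 with hJ
  have hfix : ∀ t, Fl t (c 0) = c 0 := fun t => K.flow_eq_of_eq_zero h0 t
  -- The flow fixes `c 0`, so the variational equation for the image of the initial velocity has the
  -- constant coefficient matrix `A`; its solution is a rotation of angular speed `l`.
  have hJd : ∀ t, HasDerivAt J (A (J t)) t := by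
    intro t
    have := hasDerivAt_flow_variation K.killing K.flow (hc 0).contMDiffAt (t := t) (x₀ := p)
      ((hfix t).symm ▸ hs)
    rw [hfix t] at this
    exact this
  have hJ0 : J 0 = a := by simp only [hJ, ha, K.flow_zero]
  have hJt := eq_cos_add_sin hl.ne' hl2 hJ0 hJd
  have hiff : ∀ t, (∀ s, Fl t (c s) = c s) ↔ J t = a := by
    intro t
    constructor
    · intro hall
      simp only [hJ, ha, hall]
    · intro hJa
      refine K.normal_ext (K.normal_flow hc t) hc (s₀ := 0) (hfix t) ?_
      refine eq_of_chartCoframe_eq hs ?_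
      have e1 := (K.normal_flow hc t 0).contMDiffAt.deriv_chart (x₀ := p) ((hfix t).symm ▸ hs)
      have e2 := (hc 0).contMDiffAt.deriv_chart hs
      rw [hfix t] at e1
      rw [← e1, ← e2]
      exact hJa
  refine ⟨l, hl, fun t => (hiff t).trans ?_, ?_⟩
  · rw [hJt t]
    constructor
    · intro he
      -- Pairing with `a` removes the sine term, since `A a` is orthogonal to `a`, and leaves `cos
      -- (l * t) = 1`.
      have h1 := congrArg (chartMetric h p (𝔢 p (c 0)) a) he
      rw [map_add, map_smul, map_smul, ha1, hskew, smul_zero, add_zero, smul_eq_mul, mul_one] at h1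
      obtain ⟨k, hk⟩ := (Real.cos_eq_one_iff _).1 h1
      refine ⟨k, ?_⟩
      field_simp
      linarith
    · rintro ⟨k, rfl⟩
      have h1 : l * (k * (2 * Real.pi / l)) = k * (2 * Real.pi) := by field_simp
      have h2 : Real.sin (k * (2 * Real.pi)) = 0 := by
        have := Real.sin_add_int_mul_two_pi 0 k
        simpa using this
      rw [h1, Real.cos_int_mul_two_pi, h2, mul_zero, zero_smul, one_smul, add_zero]
  · have hu : HasDerivAt (fun s => 𝔢 p (c s)) a 0 :=
      (((hc 0).contMDiffAt.contDiffAt_chart hs).differentiableAt (by simp)).hasDerivAt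
    have hVu : HasDerivAt (fun s => chartField X p (𝔢 p (c s))) (A a) 0 :=
      HasFDerivAt.comp_hasDerivAt (l := chartField X p) (f := fun s => 𝔢 p (c s)) 0
        (hV.hasFDerivAt hg hpt) hu
    -- The difference quotient of the field along the curve tends to `A a`, so its squared length
    -- tends to `g (A a, A a) = l ^ 2`.
    have hslope := hasDerivAt_iff_tendsto_slope_zero.1 hVu
    have hgc : Filter.Tendsto (fun s => chartMetric h p (𝔢 p (c s))) (𝓝[≠] 0)
        (𝓝 (chartMetric h p (𝔢 p (c 0)))) :=
      (ContinuousAt.comp (f := fun s => 𝔢 p (c s)) (hg.contDiffAt hpt).continuousAt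
        hu.continuousAt).tendsto.mono_left nhdsWithin_le_nhds
    have happ : ∀ {F : Type} [NormedAddCommGroup F] [NormedSpace ℝ F] {f : ℝ → E₂ →L[ℝ] F}
        {w : ℝ → E₂} {f₀ : E₂ →L[ℝ] F} {w₀ : E₂}, Filter.Tendsto f (𝓝[≠] 0) (𝓝 f₀) →
        Filter.Tendsto w (𝓝[≠] 0) (𝓝 w₀) →
        Filter.Tendsto (fun s => f s (w s)) (𝓝[≠] 0) (𝓝 (f₀ w₀)) := fun hf hw =>
      (isBoundedBilinearMap_apply.continuous.tendsto _).comp (hf.prodMk_nhds hw)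
    have hlim := happ (happ hgc hslope) hslope
    rw [hl1] at hlim
    refine hlim.congr' ?_
    have hev : ∀ᶠ s in 𝓝[≠] (0 : ℝ), c s ∈ (𝔢 p).source :=
      nhdsWithin_le_nhds ((hc 0).contMDiffAt.continuousAt.eventually (chartSource_mem_nhds hs))
    filter_upwards [hev, self_mem_nhdsWithin] with s hs' hne
    have hne' : s ≠ 0 := hne
    simp only [zero_add, hV0, sub_zero, map_smul, smul_apply, smul_eq_mul]
    rw [chartField_eq_coframe X hs', chartMetric_coframe h hs', ← normSq]
    field_simp

end KillingData

end Rotation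

/-! ### Polar coordinates given by a normal curve and the flow -/

section Polar

variable {M : Type*} [TopologicalSpace M] [ChartedSpace (EuclideanSpace ℝ (Fin 2)) M]
  [IsManifold (𝓡 2) ∞ M]

local notation "E₂" => EuclideanSpace ℝ (Fin 2)
local notation "𝔢" => extChartAt (𝓡 2)

variable {h : SurfaceMetric M} {X : (x : M) → TangentSpace (𝓡 2) x}

namespace KillingData

variable [CompactSpace M] [T2Space M] [PreconnectedSpace M] {Fl : ℝ → M → M} {H : M → ℝ}

lemma continuous_flow_curve (K : KillingData h X Fl H) {c : ℝ → M} (hc : IsNormal h X c) :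
    Continuous (fun p : ℝ × ℝ => Fl p.2 (c p.1)) :=
  K.flow.contMDiff.continuous.comp (continuous_snd.prodMk (hc.continuous.comp continuous_fst))

lemma hasFDerivAt_flow_curve_chart (K : KillingData h X Fl H) {c : ℝ → M} (hc : IsNormal h X c)
    {s t : ℝ} {x₀ : M} (hs : Fl t (c s) ∈ (𝔢 x₀).source) :
    ∃ D : ℝ × ℝ →L[ℝ] E₂,
      HasFDerivAt (fun p : ℝ × ℝ => 𝔢 x₀ (Fl p.2 (c p.1))) D (s, t) ∧
      ∀ a b : ℝ, D (a, b) = chartCoframe x₀ (Fl t (c s))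
        (a • velocity (fun s => Fl t (c s)) s + b • fieldAt X (Fl t (c s))) := by
  have hu : ContMDiffAt 𝓘(ℝ, ℝ × ℝ) 𝓘(ℝ, E₂) ∞ (fun p : ℝ × ℝ => 𝔢 x₀ (Fl p.2 (c p.1))) (s, t) :=
    (contMDiffAt_chart (x := Fl t (c s)) hs).comp (s, t)
      (contMDiffAt_flow_curve K.flow (hc s).contMDiffAt t)
  have hD := ((contMDiffAt_iff_contDiffAt.1 hu).differentiableAt (by simp)).hasFDerivAt
  refine ⟨_, hD, fun a b => ?_⟩
  set D := fderiv ℝ (fun p : ℝ × ℝ => 𝔢 x₀ (Fl p.2 (c p.1))) (s, t) with hDd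
  have e1 : HasDerivAt (fun τ => 𝔢 x₀ (Fl t (c τ))) (D (1, 0)) s :=
    HasFDerivAt.comp_hasDerivAt (l := fun p : ℝ × ℝ => 𝔢 x₀ (Fl p.2 (c p.1)))
      (f := fun τ => (τ, t)) s hD ((hasDerivAt_id s).prodMk (hasDerivAt_const s t))
  have e2 : HasDerivAt (fun τ => 𝔢 x₀ (Fl τ (c s))) (D (0, 1)) t :=
    HasFDerivAt.comp_hasDerivAt (l := fun p : ℝ × ℝ => 𝔢 x₀ (Fl p.2 (c p.1)))
      (f := fun τ => (s, τ)) t hD ((hasDerivAt_const t s).prodMk (hasDerivAt_id t))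
  have f1 := e1.unique (hasDerivAt_chart
    ((K.normal_flow hc t s).contMDiffAt.mdifferentiableAt (by simp)) hs)
  have f2 := e2.unique ((K.flow.integral (c s)).hasDerivAt_chart hs)
  rw [chartField_eq_coframe X hs] at f2
  have : ((a, b) : ℝ × ℝ) = a • ((1, 0) : ℝ × ℝ) + b • ((0, 1) : ℝ × ℝ) := by simp
  rw [this, map_add, map_smul, map_smul, f1, f2, map_add, map_smul, map_smul]

/-- Away from the zeros of `X`, the map `(s, t) ↦ Fl t (c s)` is a local diffeomorphism. -/
theorem exists_local_inverse (K : KillingData h X Fl H) {c : ℝ → M} (hc : IsNormal h X c)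
    {s₀ : ℝ} (hX : X (c s₀) ≠ 0) (t₀ : ℝ) :
    ∃ G : M → ℝ × ℝ, ContMDiffAt (𝓡 2) 𝓘(ℝ, ℝ × ℝ) ∞ G (Fl t₀ (c s₀)) ∧
      G (Fl t₀ (c s₀)) = (s₀, t₀) ∧ (∀ᶠ p in 𝓝 (s₀, t₀), G (Fl p.2 (c p.1)) = p) ∧
      ∀ᶠ x in 𝓝 (Fl t₀ (c s₀)), Fl (G x).2 (c (G x).1) = x := by
  set x₀ := Fl t₀ (c s₀) with hx₀
  have hs : Fl t₀ (c s₀) ∈ (𝔢 x₀).source := mem_extChartAt_source _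
  obtain ⟨D, hD, hDab⟩ := K.hasFDerivAt_flow_curve_chart hc hs
  -- The two columns of the differential are the velocity of the transported curve and `X`, which
  -- are orthogonal and nonzero.
  have hinj : Function.Injective D := by
    rw [injective_iff_map_eq_zero]
    rintro ⟨a, b⟩ hab
    rw [hDab] at hab
    have h0 := eq_of_chartCoframe_eq hs (hab.trans (map_zero _).symm)
    have hN := K.normal_flow hc t₀ s₀
    have hX' : fieldAt X (Fl t₀ (c s₀)) ≠ 0 := K.field_flow_ne_zero hX t₀
    have ha : a = 0 := by
      have := congrArg (innerAt h (Fl t₀ (c s₀)) (velocity (fun s => Fl t₀ (c s)) s₀)) h0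
      rw [map_add, map_smul, map_smul, hN.unit, hN.orth, map_zero] at this
      simpa using this
    subst ha
    rw [zero_smul, zero_add] at h0
    rw [(smul_eq_zero.1 h0).resolve_right hX']
    rfl
  have hfr : Module.finrank ℝ (ℝ × ℝ) = Module.finrank ℝ E₂ := by simp
  let e' : (ℝ × ℝ) ≃L[ℝ] E₂ :=
    (LinearMap.linearEquivOfInjective (D : ℝ × ℝ →ₗ[ℝ] E₂) hinj hfr).toContinuousLinearEquiv
  have he' : (e' : ℝ × ℝ →L[ℝ] E₂) = D := by
    refine ContinuousLinearMap.ext fun p => rfl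
  have hcont := K.continuous_flow_curve hc
  obtain ⟨e, he1, he2, he3, he4⟩ := exists_openPartialHomeomorph_contDiffOn (f' := e')
    (f := fun p : ℝ × ℝ => 𝔢 x₀ (Fl p.2 (c p.1)))
    ((isOpen_extChartAt_source x₀).preimage hcont) (a := (s₀, t₀))
    (by
      rintro ⟨s, t⟩ hp
      refine ContDiffAt.contDiffWithinAt (contMDiffAt_iff_contDiffAt.1 ?_)
      exact (contMDiffAt_chart (x := Fl t (c s)) hp).comp (s, t)
        (contMDiffAt_flow_curve K.flow (hc s).contMDiffAt t)) hs (by rw [he']; exact hD)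
  have hval : ∀ p, e p = 𝔢 x₀ (Fl p.2 (c p.1)) := fun p => congrFun he3 p
  have htgt : 𝔢 x₀ (Fl t₀ (c s₀)) ∈ e.target := by
    have := e.map_source he1
    rwa [hval] at this
  refine ⟨fun x => e.symm (𝔢 x₀ x), ?_, ?_, ?_, ?_⟩
  · exact (ContDiffAt.contMDiffAt (he4.contDiffAt (e.open_target.mem_nhds htgt))).comp _
      (contMDiffAt_chart hs)
  · have := e.left_inv he1
    rwa [hval] at this
  · refine Filter.Eventually.mono (e.open_source.mem_nhds he1) fun p hp => ?_
    have := e.left_inv hp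
    rwa [hval] at this
  · filter_upwards [(continuousAt_chart hs).eventually (e.open_target.mem_nhds htgt),
      chartSource_mem_nhds hs] with x hx hxs
    have h1 := e.right_inv hx
    rw [hval] at h1
    exact (𝔢 x₀).injOn (he2 (e.map_target hx)) hxs h1

/-- The points `Fl t (c s)` with `s` close to a regular parameter form a neighbourhood. -/
lemma eventually_mem_flow_curve (K : KillingData h X Fl H) {c : ℝ → M} (hc : IsNormal h X c)
    {s₀ : ℝ} (hX : X (c s₀) ≠ 0) (t₀ : ℝ) {S : Set ℝ} (hS : S ∈ 𝓝 s₀) :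
    ∀ᶠ x in 𝓝 (Fl t₀ (c s₀)), ∃ s ∈ S, ∃ t, Fl t (c s) = x := by
  obtain ⟨G, hG, hG0, -, hG1⟩ := K.exists_local_inverse hc hX t₀
  have h1 : ContinuousAt (fun x => (G x).1) (Fl t₀ (c s₀)) := hG.continuousAt.fst
  have h2 : ∀ᶠ x in 𝓝 (Fl t₀ (c s₀)), (G x).1 ∈ S := by
    refine h1.eventually (p := (· ∈ S)) ?_
    simp only [hG0]
    exact hS
  filter_upwards [h2, hG1] with x h2 h3
  exact ⟨_, h2, _, h3⟩

lemma isOpen_flow_curve (K : KillingData h X Fl H) {c : ℝ → M} (hc : IsNormal h X c)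
    {S : Set ℝ} (hS : IsOpen S) (hX : ∀ s ∈ S, X (c s) ≠ 0) :
    IsOpen {x | ∃ s ∈ S, ∃ t, Fl t (c s) = x} := by
  rw [isOpen_iff_mem_nhds]
  rintro _ ⟨s, hs, t, rfl⟩
  exact K.eventually_mem_flow_curve hc (hX s hs) t (hS.mem_nhds hs)

lemma flow_add_period (K : KillingData h X Fl H) {c : ℝ → M} {T : ℝ}
    (hT : ∀ t, (∀ s, Fl t (c s) = c s) ↔ ∃ k : ℤ, t = k * T) (t : ℝ) (k : ℤ) (s : ℝ) :
    Fl (t + k * T) (c s) = Fl t (c s) := by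
  rw [K.flow_add, (hT (k * T)).2 ⟨k, rfl⟩]

/-- By periodicity a time interval of length `T` already sweeps out the whole set. -/
lemma isCompact_flow_curve (K : KillingData h X Fl H) {c : ℝ → M} (hc : IsNormal h X c) {T : ℝ}
    (hT0 : 0 < T) (hT : ∀ t, (∀ s, Fl t (c s) = c s) ↔ ∃ k : ℤ, t = k * T)
    {S : Set ℝ} (hS : IsCompact S) : IsCompact {x | ∃ s ∈ S, ∃ t, Fl t (c s) = x} := by
  have : {x | ∃ s ∈ S, ∃ t, Fl t (c s) = x}
      = (fun p : ℝ × ℝ => Fl p.2 (c p.1)) '' (S ×ˢ Icc 0 T) := by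
    ext x
    constructor
    · rintro ⟨s, hs, t, rfl⟩
      have hm := toIcoMod_mem_Ico hT0 0 t
      rw [zero_add] at hm
      refine ⟨(s, toIcoMod hT0 0 t), ⟨hs, hm.1, hm.2.le⟩, ?_⟩
      have h1 := toIcoMod_add_toIcoDiv_zsmul hT0 0 t
      conv_rhs => rw [← h1, zsmul_eq_mul]
      exact (K.flow_add_period hT _ _ s).symm
    · rintro ⟨⟨s, t⟩, ⟨hs, -⟩, rfl⟩
      exact ⟨s, hs, t, rfl⟩
  rw [this]
  exact (hS.prod isCompact_Icc).image (K.continuous_flow_curve hc)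

/-- Near a zero of `X` every point lies on the orbit of a point of a normal curve starting there. -/
theorem eventually_polar (K : KillingData h X Fl H) {c : ℝ → M} (hc : IsNormal h X c)
    (h0 : X (c 0) = 0) {L : ℝ} (hL : 0 < L) (hX : ∀ s ∈ Ioo 0 L, X (c s) ≠ 0) :
    ∀ᶠ x in 𝓝 (c 0), x = c 0 ∨ ∃ s ∈ Ioo 0 L, ∃ t, Fl t (c s) = x := by
  obtain ⟨l, hl, hT, -⟩ := K.exists_rotation hc h0
  set T := 2 * Real.pi / l with hTd
  have hT0 : 0 < T := by positivity
  obtain ⟨p, hp⟩ : ∃ p, p = c 0 := ⟨_, rfl⟩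
  -- `R` is an open punctured neighbourhood swept by the curve, `Q` a compact set containing it and
  -- `C` the outer orbit. A punctured ball around the zero that avoids `C` is connected, meets `R`
  -- and is covered by the disjoint open sets `R` and `Qᶜ`; so it lies in `R`.
  set R : Set M := {x | ∃ s ∈ Ioo 0 (L / 2), ∃ t, Fl t (c s) = x} with hR
  set Q : Set M := {x | ∃ s ∈ Icc 0 (L / 2), ∃ t, Fl t (c s) = x} with hQ
  set C : Set M := {x | ∃ s ∈ ({L / 2} : Set ℝ), ∃ t, Fl t (c s) = x} with hC
  have hRo : IsOpen R := K.isOpen_flow_curve hc isOpen_Ioo fun s hs =>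
    hX s ⟨hs.1, hs.2.trans (by linarith)⟩
  have hQc : IsClosed Q := (K.isCompact_flow_curve hc hT0 hT isCompact_Icc).isClosed
  have hCc : IsClosed C := (K.isCompact_flow_curve hc hT0 hT isCompact_singleton).isClosed
  have hpC : p ∈ Cᶜ := by
    rintro ⟨s, rfl, t, ht⟩
    refine K.field_flow_ne_zero (hX (L / 2) ⟨by linarith, by linarith⟩) t ?_
    rw [ht, hp, h0]
  have hps : p ∈ (𝔢 p).source := mem_extChartAt_source p
  obtain ⟨r, hr, hball⟩ := Metric.eventually_nhds_iff_ball.1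
    ((eventually_chart_of hps (hCc.isOpen_compl.mem_nhds hpC)).and
      ((isOpen_chart_target p).mem_nhds ((𝔢 p).map_source hps)))
  set B : Set M := (𝔢 p).symm '' (Metric.ball (𝔢 p p) r \ {𝔢 p p}) with hB
  have hBpre : IsPreconnected B := by
    refine (isPreconnected_punctured_ball _).image _ fun y hy => ?_
    exact ((contMDiffAt_chart_symm (hball y hy.1).2).continuousAt).continuousWithinAt
  have hnear : ∀ᶠ x in 𝓝 p, x = p ∨ x ∈ B := by
    filter_upwards [(continuousAt_chart hps).eventually (Metric.ball_mem_nhds _ hr),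
      chartSource_mem_nhds hps] with x hx hxs
    refine or_iff_not_imp_left.2 fun hne => ⟨𝔢 p x, ⟨hx, fun he => hne ?_⟩, (𝔢 p).left_inv hxs⟩
    exact (𝔢 p).injOn hxs hps he
  have hsub : B ⊆ R ∪ Qᶜ := by
    rintro _ ⟨y, hy, rfl⟩
    by_cases hyQ : (𝔢 p).symm y ∈ Q
    · left
      obtain ⟨s, hs, t, ht⟩ := hyQ
      refine ⟨s, ⟨hs.1.lt_of_ne ?_, hs.2.lt_of_ne ?_⟩, t, ht⟩
      · rintro rfl
        rw [K.flow_eq_of_eq_zero h0, ← hp] at ht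
        have := congrArg (𝔢 p) ht
        rw [(𝔢 p).right_inv (hball y hy.1).2] at this
        exact hy.2 this.symm
      · rintro rfl
        exact (hball y hy.1).1 ⟨_, rfl, t, ht⟩
    · exact Or.inr hyQ
  have hdisj : Disjoint R Qᶜ := by
    rw [disjoint_compl_right_iff_subset]
    rintro x ⟨s, hs, t, ht⟩
    exact ⟨s, ⟨hs.1.le, hs.2.le⟩, t, ht⟩
  have hne : (B ∩ R).Nonempty := by
    have h3 : ∀ᶠ s in 𝓝 (0 : ℝ), c s = p ∨ c s ∈ B :=
      (hc.continuous.continuousAt (x := 0)).eventually (p := fun x => x = p ∨ x ∈ B) (hp ▸ hnear)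
    have h1 : ∀ᶠ s in 𝓝[>] (0 : ℝ), c s = p ∨ c s ∈ B :=
      nhdsWithin_le_nhds h3
    have h2 : ∀ᶠ s in 𝓝[>] (0 : ℝ), s ∈ Ioo 0 (L / 2) := Ioo_mem_nhdsGT (by linarith)
    obtain ⟨s, h1, h2⟩ := (h1.and h2).exists
    refine ⟨c s, h1.resolve_left fun he => ?_, s, h2, 0, K.flow_zero _⟩
    refine hX s ⟨h2.1, h2.2.trans (by linarith)⟩ ?_
    rw [he, hp, h0]
  have hBR := hBpre.subset_left_of_subset_union hRo hQc.isOpen_compl hdisj hsub hne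
  rw [← hp]
  filter_upwards [hnear] with x hx
  refine hx.imp_right fun hx => ?_
  obtain ⟨s, hs, t, ht⟩ := hBR hx
  exact ⟨s, ⟨hs.1, hs.2.trans (by linarith)⟩, t, ht⟩

end KillingData

end Polar

/-! ### A meridian joining the two zeros of a Killing field on a closed surface -/

section Meridian

variable {M : Type*} [TopologicalSpace M] [ChartedSpace (EuclideanSpace ℝ (Fin 2)) M]
  [IsManifold (𝓡 2) ∞ M]

local notation "E₂" => EuclideanSpace ℝ (Fin 2)
local notation "𝔢" => extChartAt (𝓡 2)

variable {h : SurfaceMetric M} {X : (x : M) → TangentSpace (𝓡 2) x}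

namespace KillingData

variable [CompactSpace M] [T2Space M] [PreconnectedSpace M] {Fl : ℝ → M → M} {H : M → ℝ}

lemma exists_isNormal (K : KillingData h X Fl H) (y : M) : ∃ c, IsNormal h X c ∧ c 0 = y := by
  obtain ⟨v, h1, h2⟩ := exists_unit_orthogonal h y (fieldAt X y)
  obtain ⟨c, hc, h0, -⟩ := exists_normal K.killing K.nonzero y v h1 h2
  exact ⟨c, hc, h0⟩

lemma exists_Ioo_field_ne_zero (K : KillingData h X Fl H) {c : ℝ → M} (hc : IsNormal h X c) :
    ∃ L > 0, ∀ s ∈ Ioo 0 L, X (c s) ≠ 0 := by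
  have h1 := (hc 0).eventually_field_ne_zero K.killing K.nonzero
  have h2 : ∀ᶠ s in 𝓝[>] (0 : ℝ), X (c s) ≠ 0 :=
    h1.filter_mono (nhdsWithin_mono (0 : ℝ) fun s (hs : 0 < s) => hs.ne')
  obtain ⟨L, hL, hL'⟩ := mem_nhdsGT_iff_exists_Ioo_subset.1 h2
  exact ⟨L, hL, fun s hs => hL' hs⟩

/-- At a minimum the derivative of `H` vanishes along any normal curve through it, and there that
derivative squares to `|X|²`. -/
lemma exists_minimum (K : KillingData h X Fl H) : ∃ p, X p = 0 ∧ ∀ x, H p ≤ H x := by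
  obtain ⟨x₁, -⟩ := K.nonzero
  have hH : Continuous H :=
    continuous_iff_continuousAt.2 fun x => (K.hamiltonian x).contMDiffAt.continuousAt
  obtain ⟨p, -, hp⟩ := isCompact_univ.exists_isMinOn ⟨x₁, mem_univ x₁⟩ hH.continuousOn
  refine ⟨p, ?_, fun x => hp (mem_univ x)⟩
  by_contra hX
  obtain ⟨c, hc, h0⟩ := K.exists_isNormal p
  refine (K.deriv_hamiltonian_eq_zero_iff hc (s := 0)).not.2 (h0 ▸ hX) ?_
  refine IsLocalMin.deriv_eq_zero (Filter.Eventually.of_forall fun s => ?_)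
  simp only [h0]
  exact hp (mem_univ _)

/-- A derivative without zeros has constant sign by Darboux's theorem, and starting at a minimum
excludes the negative sign. -/
lemma deriv_hamiltonian_pos (K : KillingData h X Fl H) {c : ℝ → M} (hc : IsNormal h X c)
    (hmin : ∀ x, H (c 0) ≤ H x) {b : ℝ} (hb : 0 < b) (hX : ∀ s ∈ Ioo 0 b, X (c s) ≠ 0) :
    ∀ s ∈ Ioo 0 b, 0 < deriv (fun s => H (c s)) s := by
  have hD := (K.contDiff_hamiltonian hc).differentiable (by simp)
  refine (hasDerivWithinAt_forall_lt_or_forall_gt_of_forall_ne (convex_Ioo 0 b) (m := 0)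
    (fun s _ => (hD s).hasDerivAt.hasDerivWithinAt) fun s hs =>
    (K.deriv_hamiltonian_eq_zero_iff hc).not.2 (hX s hs)).resolve_left fun hneg => ?_
  have := strictAntiOn_of_deriv_neg (convex_Icc 0 b) (f := fun s => H (c s))
    hD.continuous.continuousOn (by rwa [interior_Icc])
  have := this (left_mem_Icc.2 hb.le) (right_mem_Icc.2 hb.le) hb
  exact absurd (hmin (c b)) (not_le.2 this)

lemma strictMonoOn_hamiltonian (K : KillingData h X Fl H) {c : ℝ → M} (hc : IsNormal h X c)
    (hmin : ∀ x, H (c 0) ≤ H x) {b : ℝ} (hX : ∀ s ∈ Ioo 0 b, X (c s) ≠ 0) :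
    StrictMonoOn (fun s => H (c s)) (Icc 0 b) := by
  have hD := (K.contDiff_hamiltonian hc).differentiable (by simp)
  refine strictMonoOn_of_deriv_pos (convex_Icc 0 b) hD.continuous.continuousOn ?_
  rw [interior_Icc]
  rcases lt_or_ge 0 b with hb | hb
  · exact K.deriv_hamiltonian_pos hc hmin hb hX
  · simp [Ioo_eq_empty (not_lt.2 hb)]

/-- A normal curve that starts at a minimum of the Hamiltonian meets another zero of `X`. -/
theorem exists_zero (K : KillingData h X Fl H) {c : ℝ → M} (hc : IsNormal h X c)
    (hmin : ∀ x, H (c 0) ≤ H x) : ∃ s > 0, X (c s) = 0 := by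
  by_contra! hX
  have hmono : ∀ {s s' : ℝ}, 0 ≤ s → s < s' → H (c s) < H (c s') := fun {s s'} hs hss =>
    K.strictMonoOn_hamiltonian hc hmin (b := s') (fun τ hτ => hX τ hτ.1) ⟨hs, hss.le⟩
      ⟨hs.trans hss.le, le_rfl⟩ hss
  -- The ray accumulates at some `y`, and monotonicity puts every value of `H` along it strictly
  -- below `H y`.
  obtain ⟨y, hy⟩ := exists_clusterPt_of_compactSpace (Filter.map c Filter.atTop)
  have hfreq : ∀ {P : M → Prop}, (∀ᶠ x in 𝓝 y, P x) → ∃ᶠ s in Filter.atTop, P (c s) :=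
    fun hP => hy.frequently hP
  have hlt : ∀ s, 0 < s → H (c s) < H y := by
    intro s hs
    refine (hmono hs.le (lt_add_one s)).trans_le ?_
    by_contra! hlt
    have hHy : ContinuousAt H y := (K.hamiltonian y).contMDiffAt.continuousAt
    obtain ⟨s', h1, h2⟩ := ((hfreq (hHy.eventually (gt_mem_nhds hlt))).and_eventually
      (Filter.eventually_ge_atTop (s + 2))).exists
    exact absurd (hmono (by linarith : 0 ≤ s + 1) (by linarith : s + 1 < s')) (not_lt.2 h1.le)
  obtain ⟨d, hd, hd0⟩ := K.exists_isNormal y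
  -- a point of the ray on the orbit of `d σ` is followed or preceded by points on that of `d σ'`
  have hhit : ∀ {s σ t : ℝ}, 0 < s → Fl t (d σ) = c s → ∀ σ', |σ' - σ| < s →
      ∃ s' > 0, Fl t (d σ') = c s' := by
    intro s σ t hs he σ' hσ
    rw [abs_lt] at hσ
    rcases K.normal_match hc (K.normal_flow hd t) he.symm (hX s hs) with hm | hm
    · refine ⟨s + (σ' - σ), by linarith, ?_⟩
      rw [hm]
      congr 2
      ring
    · refine ⟨s + (σ - σ'), by linarith, ?_⟩
      rw [hm]
      congr 2
      ring
  by_cases hy0 : X y = 0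
  -- If `y` is a zero, a late point of the ray lies on a transported normal curve through `y`, at
  -- distance less than `L` from it. Following the ray by that amount reaches `y`, while staying at
  -- positive parameters because the point was later than `L`.
  · obtain ⟨L, hL, hLX⟩ := K.exists_Ioo_field_ne_zero hd
    have hpol := K.eventually_polar hd (hd0 ▸ hy0) hL hLX
    rw [hd0] at hpol
    obtain ⟨s, h1, h2⟩ := ((hfreq hpol).and_eventually
      (Filter.eventually_gt_atTop L)).exists
    have hs : 0 < s := hL.trans h2
    rcases h1 with h1 | ⟨σ, hσ, t, ht⟩
    · exact hX s hs (h1 ▸ hy0)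
    · obtain ⟨s', hs', he⟩ := hhit hs ht 0 (by
        rw [zero_sub, abs_neg, abs_of_pos hσ.1]
        exact hσ.2.trans h2)
      refine hX s' hs' ?_
      rw [← he, hd0, K.flow_eq_of_eq_zero hy0]
      exact hy0
  -- If `y` is regular, the normal curve `d` through it takes a value of `H` above `H y`. A late
  -- point of the ray lies on a transported copy of `d`, and moving by less than `2` along it
  -- reaches the orbit of that higher point.
  · have hex : ∃ σ ∈ Ioo (-1 : ℝ) 1, H y < H (d σ) := by
      by_contra! hle
      refine (K.deriv_hamiltonian_eq_zero_iff hd (s := 0)).not.2 (hd0 ▸ hy0) ?_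
      refine IsLocalMax.deriv_eq_zero ?_
      filter_upwards [Ioo_mem_nhds (by norm_num : (-1 : ℝ) < 0) one_pos] with s hs
      rw [hd0]
      exact hle s hs
    obtain ⟨σ', hσ', hHσ⟩ := hex
    have hcov := K.eventually_mem_flow_curve hd (s₀ := 0) (hd0 ▸ hy0) 0
      (Ioo_mem_nhds (by norm_num : (-1 : ℝ) < 0) one_pos)
    rw [K.flow_zero, hd0] at hcov
    obtain ⟨s, ⟨σ, hσ, t, ht⟩, h2⟩ := ((hfreq hcov).and_eventually
      (Filter.eventually_gt_atTop 2)).exists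
    obtain ⟨s', hs', he⟩ := hhit (by linarith) ht σ' (by
      rw [abs_lt]
      constructor <;> linarith [hσ.1, hσ.2, hσ'.1, hσ'.2])
    have := hlt s' hs'
    rw [← he, K.hamiltonian_flow] at this
    exact lt_asymm this hHσ

lemma exists_first_zero (K : KillingData h X Fl H) {c : ℝ → M} (hc : IsNormal h X c)
    (hmin : ∀ x, H (c 0) ≤ H x) :
    ∃ ℓ > 0, X (c ℓ) = 0 ∧ ∀ s ∈ Ioo 0 ℓ, X (c s) ≠ 0 := by
  obtain ⟨L, hL, hLX⟩ := K.exists_Ioo_field_ne_zero hc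
  obtain ⟨s₁, hs₁, hXs₁⟩ := K.exists_zero hc hmin
  set S : Set ℝ := {s | L ≤ s ∧ X (c s) = 0} with hS
  have hcl : IsClosed S := by
    have : S = Ici L ∩ (deriv fun s => H (c s)) ⁻¹' {0} := by
      ext s
      simp only [hS, mem_ofPred_eq, mem_inter_iff, mem_Ici, mem_preimage, mem_singleton_iff,
        K.deriv_hamiltonian_eq_zero_iff hc]
    rw [this]
    exact isClosed_Ici.inter (isClosed_singleton.preimage
      ((K.contDiff_hamiltonian hc).continuous_deriv (by simp)))
  have hmem : ∀ s, 0 < s → X (c s) = 0 → s ∈ S := fun s hs h0 =>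
    ⟨not_lt.1 fun hlt => hLX s ⟨hs, hlt⟩ h0, h0⟩
  have hbdd : BddBelow S := ⟨L, fun s hs => hs.1⟩
  have hinf := hcl.csInf_mem ⟨s₁, hmem s₁ hs₁ hXs₁⟩ hbdd
  refine ⟨sInf S, hL.trans_le hinf.1, hinf.2, fun s hs h0 => ?_⟩
  exact absurd (csInf_le hbdd (hmem s hs.1 h0)) (not_le.2 hs.2)

end KillingData

variable (h X) in
/-- A normal curve `c` whose restriction to `[0, ℓ]` is a meridian from the minimum to the maximum
of `H`, together with the period `T` of the flow. -/
structure IsMeridian (Fl : ℝ → M → M) (H : M → ℝ) (c : ℝ → M) (ℓ T : ℝ) : Prop where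
  normal : IsNormal h X c
  length_pos : 0 < ℓ
  period_pos : 0 < T
  left : X (c 0) = 0
  right : X (c ℓ) = 0
  deriv_pos : ∀ s ∈ Ioo 0 ℓ, 0 < deriv (fun s => H (c s)) s
  strictMonoOn : StrictMonoOn (fun s => H (c s)) (Icc 0 ℓ)
  fixed_iff : ∀ t, (∀ s, Fl t (c s) = c s) ↔ ∃ k : ℤ, t = k * T
  surj : ∀ x, ∃ s ∈ Icc 0 ℓ, ∃ t, Fl t (c s) = x
  tendsto_left : Filter.Tendsto (fun s => normSq h X (c s) / s ^ 2) (𝓝[≠] 0)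
    (𝓝 ((2 * Real.pi / T) ^ 2))
  tendsto_right : Filter.Tendsto (fun s => normSq h X (c (ℓ - s)) / s ^ 2) (𝓝[≠] 0)
    (𝓝 ((2 * Real.pi / T) ^ 2))

lemma eq_of_int_multiples {a b : ℝ} (ha : 0 < a) (hb : 0 < b)
    (hab : ∀ t : ℝ, (∃ k : ℤ, t = k * a) ↔ ∃ k : ℤ, t = k * b) : a = b := by
  have key : ∀ {a b : ℝ}, 0 < a → 0 < b → (∃ k : ℤ, a = k * b) → b ≤ a := by
    rintro a b ha hb ⟨k, rfl⟩
    have hk : 0 < k := by exact_mod_cast pos_of_mul_pos_left ha hb.le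
    have : (1 : ℝ) ≤ k := by exact_mod_cast hk
    nlinarith
  exact le_antisymm (key hb ha ((hab b).2 ⟨1, by simp⟩)) (key ha hb ((hab a).1 ⟨1, by simp⟩))

variable [CompactSpace M] [T2Space M] [PreconnectedSpace M] {Fl : ℝ → M → M} {H : M → ℝ}

theorem KillingData.exists_isMeridian (K : KillingData h X Fl H) :
    ∃ c ℓ T, IsMeridian h X Fl H c ℓ T := by
  obtain ⟨p, hp, hmin⟩ := K.exists_minimum
  obtain ⟨c, hc, rfl⟩ := K.exists_isNormal p
  obtain ⟨ℓ, hℓ, hXℓ, hXs⟩ := K.exists_first_zero hc hmin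
  obtain ⟨l, hl, hfix, hlim⟩ := K.exists_rotation hc hp
  have hc' : IsNormal h X fun s => c (ℓ - s) := hc.comp_sub_left ℓ
  obtain ⟨l', hl', hfix', hlim'⟩ := K.exists_rotation hc' (by rwa [sub_zero])
  have hT0 : 0 < 2 * Real.pi / l := by positivity
  -- The flow fixes the curve pointwise exactly when it fixes the reversed curve, so both ends
  -- determine the same group of times.
  have hT : 2 * Real.pi / l = 2 * Real.pi / l' := by
    refine eq_of_int_multiples hT0 (by positivity) fun t => ?_
    rw [← hfix, ← hfix']
    exact ⟨fun h s => h _, fun h s => by simpa using h (ℓ - s)⟩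
  have hl2 : 2 * Real.pi / (2 * Real.pi / l) = l := by field_simp
  have hl2' : 2 * Real.pi / (2 * Real.pi / l) = l' := by rw [hT]; field_simp
  refine ⟨c, ℓ, 2 * Real.pi / l, hc, hℓ, hT0, hp, hXℓ,
    K.deriv_hamiltonian_pos hc hmin hℓ hXs, K.strictMonoOn_hamiltonian hc hmin hXs, hfix, ?_,
    by rwa [hl2], by rwa [hl2']⟩
  set Q : Set M := {x | ∃ s ∈ Icc 0 ℓ, ∃ t, Fl t (c s) = x} with hQ
  have hQc : IsClosed Q := (K.isCompact_flow_curve hc hT0 hfix isCompact_Icc).isClosed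
  -- Three kinds of points: the two ends have polar neighbourhoods, the second one through the
  -- reversed curve, and interior points are covered by the local diffeomorphism.
  have hQo : IsOpen Q := by
    rw [isOpen_iff_mem_nhds]
    rintro _ ⟨s, hs, t, rfl⟩
    rcases eq_or_lt_of_le hs.1 with rfl | hs0
    · rw [K.flow_eq_of_eq_zero hp]
      filter_upwards [K.eventually_polar hc hp hℓ hXs] with x hx
      rcases hx with rfl | ⟨s, hs, t, rfl⟩
      · exact ⟨0, left_mem_Icc.2 hℓ.le, 0, K.flow_zero _⟩
      · exact ⟨s, Ioo_subset_Icc_self hs, t, rfl⟩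
    · rcases eq_or_lt_of_le hs.2 with rfl | hsℓ
      · rw [K.flow_eq_of_eq_zero hXℓ]
        have := K.eventually_polar hc' (by rwa [sub_zero]) hℓ fun σ hσ =>
          hXs (s - σ) ⟨by linarith [hσ.2], by linarith [hσ.1]⟩
        rw [sub_zero] at this
        filter_upwards [this] with x hx
        rcases hx with rfl | ⟨σ, hσ, t, rfl⟩
        · exact ⟨s, right_mem_Icc.2 hℓ.le, 0, K.flow_zero _⟩
        · exact ⟨s - σ, ⟨by linarith [hσ.2], by linarith [hσ.1]⟩, t, rfl⟩
      · filter_upwards [K.eventually_mem_flow_curve hc (hXs s ⟨hs0, hsℓ⟩) t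
          (Icc_mem_nhds hs0 hsℓ)] with x hx
        exact hx
  have hQu := IsClopen.eq_univ ⟨hQc, hQo⟩ ⟨c 0, 0, left_mem_Icc.2 hℓ.le, 0, K.flow_zero _⟩
  intro x
  have : x ∈ Q := hQu ▸ mem_univ x
  exact this

namespace IsMeridian

variable {c : ℝ → M} {ℓ T : ℝ}

lemma field_ne_zero (K : KillingData h X Fl H) (hc : IsMeridian h X Fl H c ℓ T) {s : ℝ}
    (hs : s ∈ Ioo 0 ℓ) : X (c s) ≠ 0 := fun h0 =>
  (hc.deriv_pos s hs).ne' ((K.deriv_hamiltonian_eq_zero_iff hc.normal).2 h0)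

lemma poles_ne (hc : IsMeridian h X Fl H c ℓ T) : c 0 ≠ c ℓ := fun he =>
  (hc.strictMonoOn (left_mem_Icc.2 hc.length_pos.le) (right_mem_Icc.2 hc.length_pos.le)
    hc.length_pos).ne (congrArg H he)

lemma flow_period (K : KillingData h X Fl H) (hc : IsMeridian h X Fl H c ℓ T) (x : M) :
    Fl T x = x := by
  obtain ⟨s, -, t, rfl⟩ := hc.surj x
  rw [← K.flow_add, add_comm, K.flow_add, (hc.fixed_iff T).2 ⟨1, by simp⟩]

/-- `H` is constant on orbits and strictly increasing on the meridian, so it recovers `s`. A time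
fixing one regular point of the meridian fixes all of it, so the times agree modulo `T`. -/
lemma flow_eq_iff (K : KillingData h X Fl H) (hc : IsMeridian h X Fl H c ℓ T) {s s' t t' : ℝ}
    (hs : s ∈ Ioo 0 ℓ) (hs' : s' ∈ Ioo 0 ℓ) :
    Fl t (c s) = Fl t' (c s') ↔ s = s' ∧ ∃ k : ℤ, t = t' + k * T := by
  constructor
  · intro he
    have h1 : s = s' := by
      refine hc.strictMonoOn.injOn (Ioo_subset_Icc_self hs) (Ioo_subset_Icc_self hs') ?_
      have := congrArg H he
      rwa [K.hamiltonian_flow, K.hamiltonian_flow] at this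
    subst h1
    refine ⟨rfl, ?_⟩
    have h2 : Fl (-t' + t) (c s) = c s := by rw [K.flow_add, he, K.flow_neg]
    obtain ⟨k, hk⟩ := (hc.fixed_iff _).1 (K.flow_normal_eq hc.normal h2 (hc.field_ne_zero K hs))
    exact ⟨k, by linarith⟩
  · rintro ⟨rfl, k, rfl⟩
    exact K.flow_add_period hc.fixed_iff _ _ _

/-- Every regular point lies on the orbit of an interior point of the meridian. -/
lemma exists_of_ne (K : KillingData h X Fl H) (hc : IsMeridian h X Fl H c ℓ T) {x : M}
    (h0 : x ≠ c 0) (h1 : x ≠ c ℓ) : ∃ s ∈ Ioo 0 ℓ, ∃ t, Fl t (c s) = x := by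
  obtain ⟨s, hs, t, rfl⟩ := hc.surj x
  refine ⟨s, ⟨hs.1.lt_of_ne ?_, hs.2.lt_of_ne ?_⟩, t, rfl⟩
  · rintro rfl
    exact h0 (K.flow_eq_of_eq_zero hc.left t)
  · rintro rfl
    exact h1 (K.flow_eq_of_eq_zero hc.right t)

lemma period_le (K : KillingData h X Fl H) (hc : IsMeridian h X Fl H c ℓ T) {x : M}
    (hx : X x ≠ 0) {t : ℝ} (ht : 0 < t) (he : Fl t x = x) : T ≤ t := by
  obtain ⟨s, hs, t', rfl⟩ := hc.exists_of_ne K (x := x) (fun h0 => hx (h0 ▸ hc.left))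
    (fun h0 => hx (h0 ▸ hc.right))
  rw [← K.flow_add, hc.flow_eq_iff K hs hs] at he
  obtain ⟨-, k, hk⟩ := he
  have hkT : t = k * T := by linarith
  have hk0 : 0 < k := by
    exact_mod_cast pos_of_mul_pos_left (hkT ▸ ht) hc.period_pos.le
  have : (1 : ℝ) ≤ k := by exact_mod_cast hk0
  nlinarith [hc.period_pos]

end IsMeridian

end Meridian

/-! ### Angles on the unit circle -/

section Angle

/-- The branch of the angle on the unit circle that is smooth near `Circle.exp θ` and takes the
value `θ` there. -/
noncomputable def angleNear (θ : ℝ) (z : Circle) : ℝ :=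
  θ + Complex.arg ((z * (Circle.exp θ)⁻¹ : Circle) : ℂ)

lemma exp_angleNear (θ : ℝ) (z : Circle) : Circle.exp (angleNear θ z) = z := by
  rw [angleNear, Circle.exp_add, Circle.exp_arg, mul_comm, inv_mul_cancel_right]

lemma angleNear_exp (θ : ℝ) : angleNear θ (Circle.exp θ) = θ := by
  rw [angleNear, mul_inv_cancel, Circle.coe_one, Complex.arg_one, add_zero]

lemma contMDiff_circle_coe : ContMDiff (𝓡 1) 𝓘(ℝ, ℂ) ∞ (fun z : Circle => (z : ℂ)) :=
  have : Fact (Module.finrank ℝ ℂ = 1 + 1) := ⟨Complex.finrank_real_complex⟩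
  contMDiff_coe_sphere (E := ℂ) (n := 1)

lemma contDiffAt_arg {z : ℂ} (hz : z ∈ Complex.slitPlane) : ContDiffAt ℝ ∞ Complex.arg z := by
  have h1 : ContDiffAt ℝ ∞ Complex.log z := (Complex.contDiffAt_log hz).restrict_scalars ℝ
  have h2 := Complex.imCLM.contDiff.contDiffAt.comp z h1
  refine h2.congr_of_eventuallyEq (Filter.Eventually.of_forall fun w => ?_)
  exact (Complex.log_im w).symm

lemma contMDiffAt_angleNear (θ : ℝ) :
    ContMDiffAt (𝓡 1) 𝓘(ℝ, ℝ) ∞ (angleNear θ) (Circle.exp θ) := by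
  have h1 : ContMDiffAt (𝓡 1) 𝓘(ℝ, ℂ) ∞
      (fun z : Circle => ((z * (Circle.exp θ)⁻¹ : Circle) : ℂ)) (Circle.exp θ) :=
    (contMDiff_circle_coe.comp (contMDiff_id.mul contMDiff_const)).contMDiffAt
  have h2 : ContDiffAt ℝ ∞ (fun w : ℂ => θ + Complex.arg w)
      (((Circle.exp θ) * (Circle.exp θ)⁻¹ : Circle) : ℂ) := by
    rw [mul_inv_cancel, Circle.coe_one]
    exact contDiffAt_const.add (contDiffAt_arg Complex.one_mem_slitPlane)
  exact ContMDiffAt.comp (g := fun w : ℂ => θ + Complex.arg w)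
    (f := fun z : Circle => ((z * (Circle.exp θ)⁻¹ : Circle) : ℂ)) (Circle.exp θ) h2.contMDiffAt h1

/-- The differential of the angle. -/
noncomputable def angleForm (θ : ℝ) : EuclideanSpace ℝ (Fin 1) →L[ℝ] ℝ :=
  mfderiv (𝓡 1) 𝓘(ℝ, ℝ) (angleNear θ) (Circle.exp θ)

lemma hasMFDerivAt_angleNear (θ : ℝ) :
    HasMFDerivAt (𝓡 1) 𝓘(ℝ, ℝ) (angleNear θ) (Circle.exp θ) (angleForm θ) :=
  ((contMDiffAt_angleNear θ).mdifferentiableAt (by simp)).hasMFDerivAt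

/-- The inclusion into `ℂ` factors as `s ↦ e^{is}` after a branch of the angle, and the former has
unit speed; thus `dσ² = dθ²`. -/
lemma circleMetric_exp (θ : ℝ) (v w : EuclideanSpace ℝ (Fin 1)) :
    circleMetric (Circle.exp θ) v w = angleForm θ v * angleForm θ w := by
  have h1 : HasDerivAt (fun s : ℝ => Complex.exp (s * Complex.I))
      (Complex.exp (θ * Complex.I) * Complex.I) θ := by
    have := ((Complex.ofRealCLM.hasDerivAt (x := θ)).mul_const Complex.I).cexp
    simpa using this
  have h2 : HasMFDerivAt 𝓘(ℝ, ℝ) 𝓘(ℝ, ℂ) (fun s : ℝ => Complex.exp (s * Complex.I))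
      (angleNear θ (Circle.exp θ)) (ContinuousLinearMap.toSpanSingleton ℝ
        (Complex.exp (θ * Complex.I) * Complex.I)) := by
    rw [angleNear_exp]
    exact h1.hasFDerivAt.hasMFDerivAt
  have h3 := h2.comp (Circle.exp θ) (hasMFDerivAt_angleNear θ)
  have h4 : (fun s : ℝ => Complex.exp (s * Complex.I)) ∘ angleNear θ
      = fun z : Circle => (z : ℂ) := by
    funext z
    rw [Function.comp_apply, ← Circle.coe_exp, exp_angleNear]
  rw [h4] at h3
  have h5 : ∀ u : EuclideanSpace ℝ (Fin 1),
      mfderiv (𝓡 1) 𝓘(ℝ, ℂ) (fun y : Circle => (y : ℂ)) (Circle.exp θ) u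
        = (angleForm θ u • (Complex.exp (θ * Complex.I) * Complex.I) : ℂ) := by
    intro u
    rw [h3.mfderiv]
    rfl
  have h6 : ‖Complex.exp (θ * Complex.I) * Complex.I‖ = 1 := by
    rw [norm_mul, Complex.norm_exp_ofReal_mul_I, Complex.norm_I, one_mul]
  unfold circleMetric
  refine (congrArg₂ (inner ℝ (E := ℂ)) (h5 v) (h5 w)).trans ?_
  rw [real_inner_smul_left, real_inner_smul_right, real_inner_self_eq_norm_sq, h6]
  ring

end Angle

/-! ### Polar coordinates and the pulled back metric -/

section WarpedProduct

variable {M : Type*} [TopologicalSpace M] [ChartedSpace (EuclideanSpace ℝ (Fin 2)) M]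
  [IsManifold (𝓡 2) ∞ M]

local notation "E₂" => EuclideanSpace ℝ (Fin 2)
local notation "𝔢" => extChartAt (𝓡 2)

variable {h : SurfaceMetric M} {X : (x : M) → TangentSpace (𝓡 2) x}

/-- Polar coordinates: the meridian `c` rotated by the flow. -/
noncomputable def polarMap (Fl : ℝ → M → M) (c : ℝ → M) (T : ℝ) (x : ℝ × Circle) : M :=
  Fl (T / (2 * Real.pi) * Complex.arg (x.2 : ℂ)) (c x.1)

/-- The warping function of polar coordinates. -/
noncomputable def warpFunction (H : M → ℝ) (c : ℝ → M) (T : ℝ) (r : ℝ) : ℝ :=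
  T / (2 * Real.pi) * deriv (fun s => H (c s)) r

/-- The limit determines only `d ^ 2`; positivity of `f` to the right of `0` selects the sign. -/
lemma eq_one_of_hasDerivAt {f : ℝ → ℝ} {d ℓ : ℝ} (hd : HasDerivAt f d 0) (h0 : f 0 = 0)
    (hℓ : 0 < ℓ) (hpos : ∀ s ∈ Ioo 0 ℓ, 0 < f s)
    (hlim : Filter.Tendsto (fun s => f s ^ 2 / s ^ 2) (𝓝[≠] 0) (𝓝 1)) : d = 1 := by
  have h1 := hasDerivAt_iff_tendsto_slope_zero.1 hd
  have h2 : Filter.Tendsto (fun s => f s ^ 2 / s ^ 2) (𝓝[≠] 0) (𝓝 (d ^ 2)) := by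
    refine (h1.pow 2).congr fun s => ?_
    simp only [zero_add, h0, sub_zero, smul_eq_mul]
    ring
  have h3 : d ^ 2 = 1 := tendsto_nhds_unique h2 hlim
  have h4 : 0 ≤ d := by
    refine ge_of_tendsto (h1.mono_left (nhdsWithin_mono (0 : ℝ)
      fun s (hs : s ∈ Ioi (0 : ℝ)) => (ne_of_gt hs : s ≠ 0))) ?_
    filter_upwards [Ioo_mem_nhdsGT hℓ] with s hs
    simp only [zero_add, h0, sub_zero, smul_eq_mul]
    exact (mul_pos (inv_pos.2 hs.1) (hpos s hs)).le
  nlinarith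

variable [CompactSpace M] [T2Space M] [PreconnectedSpace M] {Fl : ℝ → M → M} {H : M → ℝ}

namespace IsMeridian

variable {c : ℝ → M} {ℓ T : ℝ}

lemma polarMap_exp (K : KillingData h X Fl H) (hc : IsMeridian h X Fl H c ℓ T) (r θ : ℝ) :
    polarMap Fl c T (r, Circle.exp θ) = Fl (T / (2 * Real.pi) * θ) (c r) := by
  obtain ⟨k, hk⟩ := Circle.exp_eq_exp.1 (Circle.exp_arg (Circle.exp θ))
  have h1 : T / (2 * Real.pi) * Complex.arg (Circle.exp θ : ℂ)
      = T / (2 * Real.pi) * θ + k * T := by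
    rw [hk]
    field_simp
  simp only [polarMap]
  rw [h1, K.flow_add_period hc.fixed_iff]

/-- The jump of the principal argument by `2π` changes the flow time by `T`, which the meridian does
not see. Replacing it by a branch smooth near `θ` exhibits smoothness there. -/
lemma polarMap_eq (K : KillingData h X Fl H) (hc : IsMeridian h X Fl H c ℓ T) (θ : ℝ) :
    polarMap Fl c T = (fun p : ℝ × ℝ => Fl p.2 (c p.1)) ∘
      fun x : ℝ × Circle => (x.1, T / (2 * Real.pi) * angleNear θ x.2) := by
  funext x
  have := hc.polarMap_exp K x.1 (angleNear θ x.2)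
  rwa [exp_angleNear] at this

lemma contMDiff_polarMap (K : KillingData h X Fl H) (hc : IsMeridian h X Fl H c ℓ T) :
    ContMDiff (𝓘(ℝ, ℝ).prod (𝓡 1)) (𝓡 2) ∞ (polarMap Fl c T) := by
  rintro ⟨r, z⟩
  obtain ⟨θ, rfl⟩ : ∃ θ, z = Circle.exp θ := ⟨_, (Circle.exp_arg z).symm⟩
  rw [hc.polarMap_eq K θ]
  have h1 : ContMDiffAt (𝓘(ℝ, ℝ).prod (𝓡 1)) 𝓘(ℝ, ℝ) ∞
      (fun x : ℝ × Circle => T / (2 * Real.pi) * angleNear θ x.2) (r, Circle.exp θ) := by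
    have h2 : ContMDiffAt (𝓘(ℝ, ℝ).prod (𝓡 1)) 𝓘(ℝ, ℝ) ∞
      (fun x : ℝ × Circle => angleNear θ x.2) (r, Circle.exp θ) :=
      ContMDiffAt.comp (g := angleNear θ) (r, Circle.exp θ) (contMDiffAt_angleNear θ) contMDiffAt_snd
    have h3 : ContMDiff 𝓘(ℝ, ℝ) 𝓘(ℝ, ℝ) ∞ (fun s : ℝ => T / (2 * Real.pi) * s) :=
      (contDiff_const.mul contDiff_id).contMDiff
    exact h3.contMDiffAt.comp _ h2
  refine ContMDiffAt.comp (r, Circle.exp θ) (contMDiffAt_flow_curve K.flow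
    (hc.normal r).contMDiffAt _) ?_
  exact contMDiffAt_fst.prodMk_space h1

/-- The radial direction follows the rotated meridian, and the angular one follows `X` at rate `T /
(2 * π)`. The identity is verified in a chart, whose differential is injective. -/
lemma mfderiv_polarMap (K : KillingData h X Fl H) (hc : IsMeridian h X Fl H c ℓ T) (r θ : ℝ)
    (u : ℝ × EuclideanSpace ℝ (Fin 1)) :
    mfderiv (𝓘(ℝ, ℝ).prod (𝓡 1)) (𝓡 2) (polarMap Fl c T) (r, Circle.exp θ) u
      = (u.1 • velocity (fun s => Fl (T / (2 * Real.pi) * θ) (c s)) r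
        + (T / (2 * Real.pi) * angleForm θ u.2) •
          fieldAt X (Fl (T / (2 * Real.pi) * θ) (c r)) : E₂) := by
  set t := T / (2 * Real.pi) * θ with ht
  set y := Fl t (c r) with hy
  have hxy : polarMap Fl c T (r, Circle.exp θ) = y := hc.polarMap_exp K r θ
  have hs : y ∈ (𝔢 y).source := mem_extChartAt_source y
  obtain ⟨D, hD, hDab⟩ := K.hasFDerivAt_flow_curve_chart hc.normal hs
  have hΦ : HasMFDerivAt (𝓘(ℝ, ℝ).prod (𝓡 1)) (𝓡 2) (polarMap Fl c T) (r, Circle.exp θ)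
      (mfderiv (𝓘(ℝ, ℝ).prod (𝓡 1)) (𝓡 2) (polarMap Fl c T) (r, Circle.exp θ)) :=
    ((hc.contMDiff_polarMap K _).mdifferentiableAt (by simp)).hasMFDerivAt
  have hchart : HasMFDerivAt (𝓡 2) 𝓘(ℝ, E₂) (𝔢 y) (polarMap Fl c T (r, Circle.exp θ))
      (chartCoframe y y) := by
    rw [hxy]
    exact ((contMDiffAt_chart hs).mdifferentiableAt (by simp)).hasMFDerivAt
  have e1 := hchart.comp (r, Circle.exp θ) hΦ
  have hA : HasMFDerivAt (𝓘(ℝ, ℝ).prod (𝓡 1)) 𝓘(ℝ, ℝ)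
      (fun x : ℝ × Circle => T / (2 * Real.pi) * angleNear θ x.2) (r, Circle.exp θ)
      (((T / (2 * Real.pi)) • angleForm θ).comp
        (ContinuousLinearMap.snd ℝ ℝ (EuclideanSpace ℝ (Fin 1)))) := by
    have h2 : HasMFDerivAt (𝓘(ℝ, ℝ).prod (𝓡 1)) (𝓡 1) (Prod.snd : ℝ × Circle → Circle)
        (r, Circle.exp θ) (ContinuousLinearMap.snd ℝ ℝ (EuclideanSpace ℝ (Fin 1))) :=
      hasMFDerivAt_snd _
    have h3 : HasMFDerivAt 𝓘(ℝ, ℝ) 𝓘(ℝ, ℝ) (fun s : ℝ => T / (2 * Real.pi) * s)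
        (angleNear θ (Circle.exp θ)) ((T / (2 * Real.pi)) • ContinuousLinearMap.id ℝ ℝ) :=
      ((ContinuousLinearMap.id ℝ ℝ).hasFDerivAt.const_mul _).hasMFDerivAt
    have h4 := h3.comp (Circle.exp θ) (hasMFDerivAt_angleNear θ)
    exact HasMFDerivAt.comp (g := fun z => T / (2 * Real.pi) * angleNear θ z)
      (f := (Prod.snd : ℝ × Circle → Circle)) (r, Circle.exp θ) h4 h2
  have h1 : HasMFDerivAt (𝓘(ℝ, ℝ).prod (𝓡 1)) 𝓘(ℝ, ℝ) (Prod.fst : ℝ × Circle → ℝ)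
        (r, Circle.exp θ) (ContinuousLinearMap.fst ℝ ℝ (EuclideanSpace ℝ (Fin 1))) :=
      hasMFDerivAt_fst _
  have hg : HasMFDerivAt (𝓘(ℝ, ℝ).prod (𝓡 1)) 𝓘(ℝ, ℝ × ℝ)
      (fun x : ℝ × Circle => (x.1, T / (2 * Real.pi) * angleNear θ x.2)) (r, Circle.exp θ)
      ((ContinuousLinearMap.fst ℝ ℝ (EuclideanSpace ℝ (Fin 1))).prod
        (((T / (2 * Real.pi)) • angleForm θ).comp
        (ContinuousLinearMap.snd ℝ ℝ (EuclideanSpace ℝ (Fin 1))))) := by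
    rw [modelWithCornersSelf_prod, ← chartedSpaceSelf_prod]
    exact h1.prodMk hA
  have hD' : HasMFDerivAt 𝓘(ℝ, ℝ × ℝ) 𝓘(ℝ, E₂) (fun p : ℝ × ℝ => 𝔢 y (Fl p.2 (c p.1)))
      (((r, Circle.exp θ) : ℝ × Circle).1,
        T / (2 * Real.pi) * angleNear θ ((r, Circle.exp θ) : ℝ × Circle).2) D := by
    simp only
    rw [angleNear_exp]
    exact hD.hasMFDerivAt
  have e2 := hD'.comp (r, Circle.exp θ) hg
  have he : (fun p : ℝ × ℝ => 𝔢 y (Fl p.2 (c p.1))) ∘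
      (fun x : ℝ × Circle => (x.1, T / (2 * Real.pi) * angleNear θ x.2))
      = 𝔢 y ∘ polarMap Fl c T := by
    rw [hc.polarMap_eq K θ]
    rfl
  rw [he] at e2
  have e3 := hasMFDerivAt_unique e1 e2
  refine eq_of_chartCoframe_eq hs ?_
  have e4 := DFunLike.congr_fun e3 u
  refine e4.trans ?_
  exact hDab _ _

lemma warpFunction_sq (K : KillingData h X Fl H) (hc : IsMeridian h X Fl H c ℓ T) (r : ℝ) :
    warpFunction H c T r ^ 2 = (T / (2 * Real.pi)) ^ 2 * normSq h X (c r) := by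
  rw [warpFunction, mul_pow, K.deriv_hamiltonian_sq hc.normal]

/-- The cross terms vanish because rotated meridians stay orthogonal to `X`; the angular coefficient
is `(T / 2π)² |X|²`, independent of the angle since the flow preserves `|X|`. -/
lemma isometry_polarMap (K : KillingData h X Fl H) (hc : IsMeridian h X Fl H c ℓ T)
    (x : ℝ × Circle) (u v : TangentSpace (𝓘(ℝ, ℝ).prod (𝓡 1)) x) :
    h.inner (polarMap Fl c T x) (mfderiv (𝓘(ℝ, ℝ).prod (𝓡 1)) (𝓡 2) (polarMap Fl c T) x u)
      (mfderiv (𝓘(ℝ, ℝ).prod (𝓡 1)) (𝓡 2) (polarMap Fl c T) x v)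
      = warpedForm (warpFunction H c T) x u v := by
  obtain ⟨r, z⟩ := x
  obtain ⟨θ, rfl⟩ : ∃ θ, z = Circle.exp θ := ⟨_, (Circle.exp_arg z).symm⟩
  have e1 := hc.mfderiv_polarMap K r θ u
  have e2 := hc.mfderiv_polarMap K r θ v
  have hxy := hc.polarMap_exp K r θ
  set t := T / (2 * Real.pi) * θ with ht
  have hN := K.normal_flow hc.normal t r
  have key : innerAt h (polarMap Fl c T (r, Circle.exp θ))
      (mfderiv (𝓘(ℝ, ℝ).prod (𝓡 1)) (𝓡 2) (polarMap Fl c T) (r, Circle.exp θ) u : E₂)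
      (mfderiv (𝓘(ℝ, ℝ).prod (𝓡 1)) (𝓡 2) (polarMap Fl c T) (r, Circle.exp θ) v : E₂)
      = warpedForm (warpFunction H c T) (r, Circle.exp θ) u v := by
    refine (congrArg₂ (fun a b : E₂ => innerAt h (polarMap Fl c T (r, Circle.exp θ)) a b)
      e1 e2).trans ?_
    simp only [hxy]
    simp only [map_add, map_smul, add_apply, smul_apply, smul_eq_mul, hN.unit, hN.orth]
    rw [innerAt_comm h _ (fieldAt X _) (velocity _ _), hN.orth, ← normSq,
      K.normSq_flow hc.normal]
    unfold warpedForm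
    rw [hc.warpFunction_sq K, circleMetric_exp]
    ring
  exact key

end IsMeridian

end WarpedProduct

/-! ### Boundary behaviour of the warping function, global inverse and conclusion -/

section Assembly

variable {M : Type*} [TopologicalSpace M] [ChartedSpace (EuclideanSpace ℝ (Fin 2)) M]
  [IsManifold (𝓡 2) ∞ M]

variable {h : SurfaceMetric M} {X : (x : M) → TangentSpace (𝓡 2) x}

variable [CompactSpace M] [T2Space M] [PreconnectedSpace M] {Fl : ℝ → M → M} {H : M → ℝ}

namespace IsMeridian

variable {c : ℝ → M} {ℓ T : ℝ}

lemma warpFunction_pos (hc : IsMeridian h X Fl H c ℓ T) {r : ℝ} (hr : r ∈ Ioo 0 ℓ) :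
    0 < warpFunction H c T r := by
  have := hc.period_pos
  exact mul_pos (by positivity) (hc.deriv_pos r hr)

lemma contDiff_warpFunction (K : KillingData h X Fl H) (hc : IsMeridian h X Fl H c ℓ T) :
    ContDiff ℝ ∞ (warpFunction H c T) := by
  have h1 : ContDiff ℝ ∞ (deriv fun s => H (c s)) :=
    (contDiff_infty_iff_deriv.1 (K.contDiff_hamiltonian hc.normal)).2
  exact contDiff_const.mul h1

lemma warpFunction_eq_zero (K : KillingData h X Fl H) (hc : IsMeridian h X Fl H c ℓ T) {r : ℝ}
    (hr : X (c r) = 0) : warpFunction H c T r = 0 := by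
  rw [warpFunction, (K.deriv_hamiltonian_eq_zero_iff hc.normal).2 hr, mul_zero]

lemma period_sq_mul (hc : IsMeridian h X Fl H c ℓ T) :
    (T / (2 * Real.pi)) ^ 2 * (2 * Real.pi / T) ^ 2 = 1 := by
  have := hc.period_pos
  have := Real.pi_pos
  field_simp

lemma hasDerivAt_warpFunction_left (K : KillingData h X Fl H) (hc : IsMeridian h X Fl H c ℓ T) :
    HasDerivAt (warpFunction H c T) 1 0 := by
  have hd := ((hc.contDiff_warpFunction K).differentiable (by simp) 0).hasDerivAt
  have hlim := hc.tendsto_left.const_mul ((T / (2 * Real.pi)) ^ 2)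
  rw [hc.period_sq_mul] at hlim
  have := eq_one_of_hasDerivAt hd (hc.warpFunction_eq_zero K hc.left) hc.length_pos
    (fun s hs => hc.warpFunction_pos hs) (hlim.congr fun s => by
      rw [hc.warpFunction_sq K, mul_div_assoc])
  rwa [this] at hd

lemma hasDerivAt_warpFunction_right (K : KillingData h X Fl H) (hc : IsMeridian h X Fl H c ℓ T) :
    HasDerivAt (warpFunction H c T) (-1) ℓ := by
  have hd := ((hc.contDiff_warpFunction K).differentiable (by simp) ℓ).hasDerivAt
  have hd' : HasDerivAt (fun s => warpFunction H c T (ℓ - s))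
      (-deriv (warpFunction H c T) ℓ) 0 :=
    HasDerivAt.comp_const_sub (f := warpFunction H c T) ℓ 0 (by simpa using hd)
  have hlim := hc.tendsto_right.const_mul ((T / (2 * Real.pi)) ^ 2)
  rw [hc.period_sq_mul] at hlim
  have := eq_one_of_hasDerivAt hd' (by rw [sub_zero]; exact hc.warpFunction_eq_zero K hc.right)
    hc.length_pos
    (fun s hs => hc.warpFunction_pos ⟨by linarith [hs.2], by linarith [hs.1]⟩)
    (hlim.congr fun s => by rw [hc.warpFunction_sq K, mul_div_assoc])
  rwa [show deriv (warpFunction H c T) ℓ = -1 by linarith] at hd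

lemma injOn_polarMap (K : KillingData h X Fl H) (hc : IsMeridian h X Fl H c ℓ T) :
    InjOn (polarMap Fl c T) (Ioo 0 ℓ ×ˢ univ) := by
  rintro ⟨r, z⟩ ⟨hr, -⟩ ⟨r', z'⟩ ⟨hr', -⟩ he
  obtain ⟨h1, k, hk⟩ := (hc.flow_eq_iff K hr hr').1 he
  simp only at h1 hk
  refine Prod.ext h1 ?_
  rw [← Circle.exp_arg z, ← Circle.exp_arg z']
  refine Circle.exp_eq_exp.2 ⟨k, ?_⟩
  have := hc.period_pos
  have := Real.pi_pos
  field_simp at hk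
  linarith

lemma polarMap_period (K : KillingData h X Fl H) (hc : IsMeridian h X Fl H c ℓ T) (r t : ℝ) :
    polarMap Fl c T (r, Circle.exp (2 * Real.pi / T * t)) = Fl t (c r) := by
  have := hc.period_pos
  rw [hc.polarMap_exp K]
  congr 1
  field_simp

lemma bijOn_polarMap (K : KillingData h X Fl H) (hc : IsMeridian h X Fl H c ℓ T) :
    BijOn (polarMap Fl c T) (Ioo 0 ℓ ×ˢ univ) {c 0, c ℓ}ᶜ := by
  refine ⟨?_, hc.injOn_polarMap K, ?_⟩
  · rintro ⟨r, z⟩ ⟨hr, -⟩ hmem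
    have h1 : X (polarMap Fl c T (r, z)) ≠ 0 := K.field_flow_ne_zero (hc.field_ne_zero K hr) _
    rcases hmem with h0 | h0
    · rw [h0] at h1
      exact h1 hc.left
    · rw [mem_singleton_iff.1 h0] at h1
      exact h1 hc.right
  · intro x hx
    simp only [mem_compl_iff, mem_insert_iff, mem_singleton_iff, not_or] at hx
    obtain ⟨s, hs, t, rfl⟩ := hc.exists_of_ne K hx.1 hx.2
    exact ⟨(s, Circle.exp (2 * Real.pi / T * t)), ⟨hs, mem_univ _⟩, hc.polarMap_period K s t⟩

/-- Injectivity gives a set-theoretic inverse. Near each regular point it coincides with a smooth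
local inverse of `(s, t) ↦ Fl t (c s)`, with `t` read as an angle. -/
lemma exists_inverse (K : KillingData h X Fl H) (hc : IsMeridian h X Fl H c ℓ T) :
    ∃ Ψ : M → ℝ × Circle,
      ContMDiffOn (𝓡 2) (𝓘(ℝ, ℝ).prod (𝓡 1)) ∞ Ψ {c 0, c ℓ}ᶜ ∧
        LeftInvOn Ψ (polarMap Fl c T) (Ioo 0 ℓ ×ˢ univ) := by
  have hleft := (hc.injOn_polarMap K).leftInvOn_invFunOn
  refine ⟨_, fun x hx => ContMDiffAt.contMDiffWithinAt ?_, hleft⟩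
  simp only [mem_compl_iff, mem_insert_iff, mem_singleton_iff, not_or] at hx
  obtain ⟨s, hs, t, rfl⟩ := hc.exists_of_ne K hx.1 hx.2
  obtain ⟨G, hG, hG0, -, hG1⟩ := K.exists_local_inverse hc.normal (hc.field_ne_zero K hs) t
  have h1 : ContMDiffAt (𝓡 2) 𝓘(ℝ, ℝ) ∞ (fun x => (G x).1) (Fl t (c s)) :=
    (contDiff_fst.contMDiff (n := ∞)).contMDiffAt.comp _ hG
  have h2 : ContMDiffAt (𝓡 2) (𝓡 1) ∞ (fun x => Circle.exp (2 * Real.pi / T * (G x).2))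
      (Fl t (c s)) := by
    have h3 : ContMDiff 𝓘(ℝ, ℝ × ℝ) 𝓘(ℝ, ℝ) ∞ (fun p : ℝ × ℝ => 2 * Real.pi / T * p.2) :=
      (contDiff_const.mul contDiff_snd).contMDiff
    exact contMDiff_circleExp.contMDiffAt.comp _ (h3.contMDiffAt.comp _ hG)
  refine (h1.prodMk h2).congr_of_eventuallyEq ?_
  have h4 : ∀ᶠ x in 𝓝 (Fl t (c s)), (G x).1 ∈ Ioo 0 ℓ := by
    refine h1.continuousAt.eventually (p := (· ∈ Ioo 0 ℓ)) ?_
    simp only [hG0]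
    exact isOpen_Ioo.mem_nhds hs
  filter_upwards [h4, hG1] with x hx hx'
  have h5 := hleft (x := ((G x).1, Circle.exp (2 * Real.pi / T * (G x).2))) ⟨hx, mem_univ _⟩
  rwa [hc.polarMap_period K, hx'] at h5

theorem isWarpedProduct (K : KillingData h X Fl H) (hc : IsMeridian h X Fl H c ℓ T) :
    IsWarpedProduct h ℓ (warpFunction H c T) (polarMap Fl c T) (c 0) (c ℓ) where
  length_pos := hc.length_pos
  warp_smooth := (hc.contDiff_warpFunction K).contDiffOn
  warp_pos _ hr := hc.warpFunction_pos hr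
  warp_left := hc.warpFunction_eq_zero K hc.left
  warp_right := hc.warpFunction_eq_zero K hc.right
  warp_deriv_left := (hc.hasDerivAt_warpFunction_left K).hasDerivWithinAt
  warp_deriv_right := (hc.hasDerivAt_warpFunction_right K).hasDerivWithinAt
  smooth := (hc.contMDiff_polarMap K).contMDiffOn
  map_left _ := K.flow_eq_of_eq_zero hc.left _
  map_right _ := K.flow_eq_of_eq_zero hc.right _
  poles_ne := hc.poles_ne
  bijOn := hc.bijOn_polarMap K
  smooth_inverse := hc.exists_inverse K
  isometry x _ u v := hc.isometry_polarMap K x u v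

lemma isMIntegralCurve_polarMap (K : KillingData h X Fl H) (hc : IsMeridian h X Fl H c ℓ T)
    (r : ℝ) (z : Circle) :
    IsMIntegralCurve (fun t : ℝ => polarMap Fl c T (r, z * Circle.exp (2 * Real.pi / T * t)))
      X := by
  obtain ⟨θ, rfl⟩ : ∃ θ, z = Circle.exp θ := ⟨_, (Circle.exp_arg z).symm⟩
  have h1 := (K.flow.integral (c r)).comp_add (T / (2 * Real.pi) * θ)
  convert h1 using 1
  funext t
  have := hc.period_pos
  have := Real.pi_pos
  rw [← Circle.exp_add, hc.polarMap_exp K, Function.comp_apply]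
  congr 1
  field_simp
  ring

end IsMeridian

end Assembly

theorem lemmaA1 {M : Type*} [TopologicalSpace M] [ChartedSpace (EuclideanSpace ℝ (Fin 2)) M]
    [IsManifold (𝓡 2) ∞ M]
    (hM : Nonempty (M ≃ₜ Metric.sphere (0 : EuclideanSpace ℝ (Fin 3)) 1))
    (h : SurfaceMetric M) (X : (x : M) → TangentSpace (𝓡 2) x)
    (hX : IsKillingField h X) (hX0 : ∃ x, X x ≠ 0) :
    ∃ t₀ : ℝ, 0 < t₀ ∧
      -- `(M, h)` is a warped product whose circles are the orbits of `X`
      (∃ (ℓ : ℝ) (φ : ℝ → ℝ) (Φ : ℝ × Circle → M) (p q : M), IsWarpedProduct h ℓ φ Φ p q ∧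
        ∀ r ∈ Icc 0 ℓ, ∀ z : Circle,
          IsMIntegralCurve (fun t : ℝ => Φ (r, z * Circle.exp (2 * Real.pi / t₀ * t))) X) ∧
      -- every orbit is closed, with period `t₀`, the least one unless the orbit is a zero of `X`
      (∀ x : M, ∃ γ : ℝ → M, γ 0 = x ∧ IsMIntegralCurve γ X) ∧
      (∀ γ : ℝ → M, IsMIntegralCurve γ X → Function.Periodic γ t₀ ∧
        (X (γ 0) ≠ 0 → ∀ s : ℝ, 0 < s → Function.Periodic γ s → t₀ ≤ s)) := by
  obtain ⟨e⟩ := hM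
  have hS : IsPreconnected (Metric.sphere (0 : EuclideanSpace ℝ (Fin 3)) 1) :=
    isPreconnected_sphere
      (by rw [rank_eq_card_basis (EuclideanSpace.basisFun (Fin 3) ℝ).toBasis]; norm_num) _ _
  have : PreconnectedSpace (Metric.sphere (0 : EuclideanSpace ℝ (Fin 3)) 1) :=
    isPreconnected_iff_preconnectedSpace.1 hS
  have : CompactSpace M := e.symm.compactSpace
  have : T2Space M := e.symm.t2Space
  have : PreconnectedSpace M := ⟨by
    rw [← e.symm.surjective.range_eq]
    exact isPreconnected_range e.symm.continuous⟩
  obtain ⟨Fl, hF⟩ := exists_isFlow hX.smooth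
  obtain ⟨H, hH⟩ := exists_hamiltonian ⟨e⟩ hX hX0
  have K : KillingData h X Fl H := ⟨hX, hX0, hF, hH⟩
  obtain ⟨c, ℓ, T, hc⟩ := K.exists_isMeridian
  refine ⟨T, hc.period_pos, ⟨ℓ, _, _, _, _, hc.isWarpedProduct K, fun r _ z =>
    hc.isMIntegralCurve_polarMap K r z⟩, fun x => ⟨_, hF.zero x, hF.integral x⟩, fun γ hγ => ?_⟩
  -- An arbitrary integral curve is a flow line, so its periods are governed by the common period
  -- `T` of the flow.
  have hγF := hF.eq_flow hX.smooth hγ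
  refine ⟨fun t => ?_, fun hX₀ s hs hper => hc.period_le K hX₀ hs ?_⟩
  · rw [hγF (t + T), hγF t, add_comm, K.flow_add, hc.flow_period K]
  · rw [← hγF s]
    simpa using hper 0
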